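/- Let $n\in\{1,2\}$, $T=\mathbb R^{n+1}/\pi\mathbb Z^{n+1}$ with coordinates $y$, and $T^*T=M_{\mathbb R}\times T$ with $M_{\mathbb R}=\mathbb R^{n+1}$; write $\langle x,y\rangle=\sum_j x_jy_j$. Let $u_1,\dots,u_{n+1}$ be the standard basis of $M_{\mathbb R}$, $u_0=-\sum_{j\ge1} u_j$; let $e_1,\dots,e_{n+1}$ be the standard basis of $N_{\mathbb R}=\mathbb R^{n+1}$, $p_0=0$, $p_j=\frac{\pi}{2}e_j$. For $J\subsetneq\{0,\dots,n+1\}$ with $|J|\le n$ let $E_J^+\subset T$ be the set of classes of the vertices and of the relative interior points of the simplex with vertices $p_k$, $k\notin J$; let $E_J^-=-E_J^+$, $E_J=E_J^+\cup E_J^-$, $C^\pm=E_\emptyset^\pm$, $C=E_\emptyset$. Let $\tilde E_J$ be the real blow-up of $E_J$ at its vertices (the fibre over $p_k$ consists of the lines through $p_k$ that enter the relative interior of $E_J$), $\tilde C=\tilde E_\emptyset$, and $\pi$ the blow-down map. Let $V_J=\mathrm{span}\{u_j\}_{j\in J}$, $\mathrm{int}\,\Gamma_J=\{\sum_{j\in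 J}t_ju_j: t_j>0\}$, and let $T_J\subset T$ be the (translated) subtorus containing $E_J$, with tangent space $V_J^\perp\subset N_{\mathbb R}$. Let $F=\big(\cos(\sum_j y_j)\prod_j\sin y_j\big)^{1/(n+1)}$ on $C^+$ and $F=(-1)^n\big(\cos(\sum_j y_j)\prod_j\sin y_j\big)^{1/(n+1)}$ on $C^-$ (real roots). Let $\mathbf h:\tilde C\to M_{\mathbb R}$ be the extension of $(F_{y_1},\dots,F_{y_{n+1}})$ by continuity, and $\Phi=(\mathbf h,\pi):\tilde C\to M_{\mathbb R}\times T$. Let $1\le|J|\le n$ and let $L\subset N_{\mathbb R}$ be a linear subspace of dimension $|J|$ transversal to $E_J$ (a complement of $V_J^\perp$), $L^\perp\subset M_{\mathbb R}$ its annihilator, $\mathbf x_{J,L}:M_{\mathbb R}\to V_J$ the projection along $L^\perp$. Let $\tilde U_{J,L}\subset\tilde C$ be the set of points that have a projection $\mathbf y_{J,L}$ to $\tilde E_J$ along $L$, that is, of (a) the interior points $y$ of $C^\pm$ (taken in the simplex with vertices $\pm p_k$) such that $y-y'\in L$ for a (unique) relative interior point $y'=:\mathbf y_{J,L}(y)$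 of the corresponding simplex $E_J^\pm$; (b) the lines through a vertex $p_k$, $k\notin J$, spanned by a direction $v$ pointing into $C^+$, such that $v$ is mapped by the projection along $L$ to a direction $v'$ pointing into the relative interior of $E_J^+$; then $\mathbf y_{J,L}$ is the line through $p_k$ spanned by $v'$. Put $\mathbf h_{J,L}=\mathbf x_{J,L}\circ\mathbf h$ and $\mathbf g_{J,L}=(\mathbf y_{J,L},\mathbf h_{J,L}):\tilde U_{J,L}\to\tilde E_J\times V_J$. Identify the cotangent bundle of $V_J\times T_J$ with $(V_J\times T_J)\times(L^\perp\times L)$, where $(\ell',\ell)$ is the form $(v,w)\mapsto\langle v,\ell\rangle-\langle\ell',w\rangle$; it covers $M_{\mathbb R}\times T$ by $(a,\theta,\ell',\ell)\mapsto(a+\ell',\theta+[\ell])$. A set $\Lambda\subset M_{\mathbb R}\times T$ is the graph of the exact one-form $dG$ over an open set $Z\subset\tilde E_J\times V_J$ if $G$ is smooth on $Z$, the section of this cotangent bundle defined by $dG$ outside the exceptional fibres extends smoothly to $Z$, the resulting map from $Z$ to the cotangent bundle is an embedding, and its image is mapped by the covering onto $\Lambda$. Then $\mathbf h$ is smooth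 on $\tilde C$, and: 1. For all such $J,L$, the set $\tilde U_{J,L}$ is open, and $\mathbf g_{J,L}$ is a diffeomorphism from $\tilde U_{J,L}$ onto an open subset $Z_{J,L}$ of $\tilde E_J\times V_J$. Moreover $\Phi(\tilde U_{J,L})$ is the graph over $Z_{J,L}$ of $dG$, where $G$ is the Legendre transform of $F$ given by $G(\mathbf g_{J,L}(y))=\langle \mathbf h_{J,L}(y),\,y-\mathbf y_{J,L}(y)\rangle-F(y)$ (with $y-\mathbf y_{J,L}(y)\in L$, equal to $0$ on the exceptional fibres). 2. For $k\notin J$ let $L$ be spanned by $p_j-p_k$, $j\in J$, and write $\mathbf h_{J,k},\mathbf g_{J,k}$ for the corresponding maps. Let $\mathcal W_{J,k}^+\subset C^+$ be the set of points whose barycentric coordinates satisfy $b_j\le b_k$ for all $j\in J$, $\mathcal W_{J,k}=\mathcal W_{J,k}^+\cup(-\mathcal W_{J,k}^+)$, $\tilde{\mathcal W}_{J,k}=\pi^{-1}(\mathcal W_{J,k})$. Then $\mathrm{int}\,\tilde{\mathcal W}_{J,k}\subset\tilde U_{J,L}$, and $\mathbf g_{J,k}:\mathrm{int}\,\tilde{\mathcal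 W}_{J,k}\to\tilde E_J\times\mathrm{int}\,\Gamma_J$ is a diffeomorphism. The set $\Phi(\mathrm{int}\,\tilde{\mathcal W}_{J,k})$ is the graph of the differential of the Legendre transform of $F$ (given by the same formula) over $\tilde E_J\times\mathrm{int}\,\Gamma_J$, and $\mathbf h_{J,k}:\mathrm{int}\,\tilde{\mathcal W}_{J,k}\to\mathrm{int}\,\Gamma_J$ is a trivial smooth fibre bundle with fibre $\tilde E_J$. -/

import Mathlib

open Set Filter Topology
open scoped Manifold ContDiff Matrix

noncomputable section

namespace PairOfPants

/-- `M_ℝ` in the coordinates `x₁, …, x_{n+1}`. -/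
abbrev MR (n : ℕ) := Fin (n + 1) → ℝ

/-- `N_ℝ` in the coordinates `y₁, …, y_{n+1}`; the pairing of `x : MR n` and `y : NR n`
is `x ⬝ᵥ y = ∑ xⱼ yⱼ`. -/
abbrev NR (n : ℕ) := Fin (n + 1) → ℝ

/-- The torus `T = ℝ^{n+1} / π ℤ^{n+1}`. -/
abbrev Torus (n : ℕ) := Fin (n + 1) → AddCircle Real.pi

/-- The class `[y]` in `T` of a vector `y`. -/
def toTorus {n : ℕ} (y : NR n) : Torus n := fun j => (y j : AddCircle Real.pi)

/-- The rays of the fan of projective space: `u_j` is the `j`-th basis vector for `j ≥ 1`, and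
`u_0 = -(u_1 + ⋯ + u_{n+1})`. -/
def u (n : ℕ) (i : Fin (n + 2)) : MR n :=
  Fin.cases (fun _ => -1) (fun j => Pi.single j 1) i

/-- The vertices of the coamoeba: `p_0 = 0` and `p_j = (π/2) u_j^*`. -/
def p (n : ℕ) (i : Fin (n + 2)) : NR n :=
  Fin.cases 0 (fun j => Pi.single j (Real.pi / 2)) i

/-- The barycentric coordinates with respect to `p_0, …, p_{n+1}`:
`bary 0 y = 1 - (2/π) ∑ yⱼ` and `bary j y = (2/π) yⱼ` for `j ≥ 1`
(see `sum_bary`, `sum_bary_smul` and `bary_p`). -/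
def bary {n : ℕ} (i : Fin (n + 2)) (y : NR n) : ℝ :=
  (if i = 0 then 1 else 0) + 2 / Real.pi * (u n i ⬝ᵥ y)

/-- The relative interior of the simplex with vertices `p_k`, `k ∉ J`. -/
def openSimplex {n : ℕ} (J : Finset (Fin (n + 2))) : Set (NR n) :=
  {y | ∀ i, (i ∈ J → bary i y = 0) ∧ (i ∉ J → 0 < bary i y)}

/-- The index sets `J` of the faces `E_J` of dimension at least one. -/
abbrev Face (n : ℕ) := {J : Finset (Fin (n + 2)) // J.card ≤ n}

/-- The index set `∅`, with `E_∅ = C`. -/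
def whole (n : ℕ) : Face n := ⟨∅, Nat.zero_le n⟩

/-- The face `E_J = E_J⁺ ∪ E_J⁻` of the coamoeba: `E_J⁺` consists of the classes of the vertices
and of the relative interior points of the simplex with vertices `p_k`, `k ∉ J`, and `E_J⁻` is
its image under `[y] ↦ [-y]`. In particular `C = coamoebaFace (whole n)`. -/
def coamoebaFace {n : ℕ} (J : Face n) : Set (Torus n) :=
  {q | ∃ y, (y ∈ openSimplex J.1 ∨ ∃ k ∉ J.1, y = p n k) ∧ (q = toTorus y ∨ q = toTorus (-y))}

/-- The linear space `{v | ⟨u_i, v⟩ = 0 for i ∈ J}` of vectors tangent to `E_J`, i.e. to the torus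
`T_J`. -/
def tangentDir {n : ℕ} (J : Face n) : Submodule ℝ (NR n) where
  carrier := {v | ∀ i ∈ J.1, u n i ⬝ᵥ v = 0}
  add_mem' := by
    intro a b ha hb i hi
    rw [dotProduct_add, ha i hi, hb i hi, add_zero]
  zero_mem' := by
    intro i _
    simp
  smul_mem' := by
    intro c a ha i hi
    rw [dotProduct_smul, ha i hi, smul_zero]

/-! ### Barycentric coordinates -/

lemma exists_notMem {n : ℕ} (J : Face n) : ∃ k, k ∉ J.1 := by
  obtain ⟨k, -, hk⟩ := Finset.exists_mem_notMem_of_card_lt_card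
    (show J.1.card < (Finset.univ : Finset (Fin (n + 2))).card by
      rw [Finset.card_univ, Fintype.card_fin]
      have := J.2
      omega)
  exact ⟨k, hk⟩

lemma sum_u (n : ℕ) : ∑ i, u n i = 0 := by
  rw [Fin.sum_univ_succ]
  funext j
  simp [u, Finset.sum_apply, Pi.single_apply]

lemma sum_bary {n : ℕ} (y : NR n) : ∑ i, bary i y = 1 := by
  simp only [bary, Finset.sum_add_distrib, ← Finset.mul_sum, ← sum_dotProduct, sum_u]
  simp

lemma bary_p {n : ℕ} (i k : Fin (n + 2)) : bary i (p n k) = if i = k then 1 else 0 := by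
  have hpi := Real.pi_pos.ne'
  refine Fin.cases ?_ (fun k => ?_) k
  · simp [bary, p]
  · refine Fin.cases ?_ (fun i => ?_) i
    · have : (fun _ => (-1 : ℝ)) ⬝ᵥ (Pi.single k (Real.pi / 2) : NR n) = -(Real.pi / 2) := by
        simp
      simp only [bary, u, p, Fin.cases_zero, Fin.cases_succ, this]
      rw [if_neg (Fin.succ_ne_zero k).symm]
      field_simp
      simp
    · simp only [bary, u, p, Fin.cases_succ]
      by_cases h : i = k
      · subst h
        simp [Fin.succ_ne_zero]
      · simp [Fin.succ_ne_zero, h, Fin.succ_inj, Ne.symm h]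

lemma bary_add_smul {n : ℕ} (i : Fin (n + 2)) (y v : NR n) (c : ℝ) :
    bary i (y + c • v) = bary i y + c * (2 / Real.pi * (u n i ⬝ᵥ v)) := by
  simp only [bary, dotProduct_add, dotProduct_smul, smul_eq_mul]
  ring

lemma dot_sub_p {n : ℕ} (i k : Fin (n + 2)) (y : NR n) :
    2 / Real.pi * (u n i ⬝ᵥ (y - p n k)) = bary i y - if i = k then 1 else 0 := by
  rw [← bary_p i k]
  simp only [bary, dotProduct_sub]
  ring

lemma sum_bary_smul {n : ℕ} (y : NR n) : ∑ i, bary i y • p n i = y := by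
  have hpi := Real.pi_pos.ne'
  rw [Fin.sum_univ_succ]
  funext j
  simp [bary, p, u, Finset.sum_apply, Pi.single_apply, Fin.succ_ne_zero]
  field_simp

lemma openSimplex_nonempty {n : ℕ} (J : Finset (Fin (n + 2))) (hJ : J.card ≤ n + 1) :
    (openSimplex J).Nonempty := by
  have hc : 0 < (Jᶜ).card := by
    rw [Finset.card_compl, Fintype.card_fin]
    omega
  have hb : ∀ c : Fin (n + 2) → ℝ, ∑ i, c i = 1 → ∀ i, bary i (∑ j, c j • p n j) = c i := by
    intro c hc i
    have h1 : ∀ j, 2 / Real.pi * (u n i ⬝ᵥ (c j • p n j))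
        = c j * (if i = j then 1 else 0) - c j * (if i = 0 then 1 else 0) := by
      intro j
      rw [← bary_p i j]
      simp only [bary, dotProduct_smul, smul_eq_mul]
      ring
    rw [bary, dotProduct_sum, Finset.mul_sum, Finset.sum_congr rfl (fun j _ => h1 j),
      Finset.sum_sub_distrib, ← Finset.sum_mul, hc]
    simp
  refine ⟨∑ j, (if j ∈ J then (0 : ℝ) else ((Jᶜ).card : ℝ)⁻¹) • p n j, fun i => ?_⟩
  rw [hb]
  · constructor
    · intro h
      simp [h]
    · intro h
      simp only [h, if_false]
      positivity
  · have : ∀ j, (if j ∈ J then (0 : ℝ) else ((Jᶜ).card : ℝ)⁻¹)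
        = if j ∈ Jᶜ then ((Jᶜ).card : ℝ)⁻¹ else 0 := by
      intro j
      by_cases h : j ∈ J <;> simp [h]
    simp only [this]
    rw [Finset.sum_ite_mem, Finset.univ_inter, Finset.sum_const, nsmul_eq_mul]
    exact mul_inv_cancel₀ (by positivity)

/-! ### The blow-up of a face at its vertices -/

/-- The points of the real blow-up `Ẽ_J` of `E_J` at its vertices (`C̃` for `J = ∅`):
* `plus y` is the point `[y]` of the interior of `E_J⁺`;
* `minus y` is the point `[-y]` of the interior of `E_J⁻`;
* `exc k m` is the point of the exceptional fibre over the vertex `p_k`, `k ∉ J`, given by the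
  line through `p_k` and `m`, where `m` is a point of the open facet of `E_J⁺` opposite to `p_k`:
  every line at `p_k` that enters `E_J` meets this facet in exactly one point. -/
inductive BlowUp {n : ℕ} (J : Face n) : Type
  | plus (y : NR n) (hy : y ∈ openSimplex J.1) : BlowUp J
  | minus (y : NR n) (hy : y ∈ openSimplex J.1) : BlowUp J
  | exc (k : Fin (n + 2)) (hk : k ∉ J.1) (m : NR n) (hm : m ∈ openSimplex (insert k J.1)) :
      BlowUp J

namespace BlowUp

variable {n : ℕ} {J : Face n}

instance : Nonempty (BlowUp J) := by
  obtain ⟨y, hy⟩ := openSimplex_nonempty J.1 (J.2.trans (Nat.le_succ n))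
  exact ⟨plus y hy⟩

/-- A representative in `N_ℝ` of the image of a point in the torus. -/
def rep : BlowUp J → NR n
  | plus y _ => y
  | minus y _ => -y
  | exc k _ _ _ => p n k

/-- The blow-down map `π : Ẽ_J → E_J ⊆ T`. -/
def proj (x : BlowUp J) : Torus n := toTorus (rep x)

/-- The point of the closed simplex with image `± π x`. -/
def base : BlowUp J → NR n
  | plus y _ => y
  | minus y _ => y
  | exc k _ _ _ => p n k

/-- The points of `Ẽ_J` outside the exceptional fibres. -/
def regular (J : Face n) : Set (BlowUp J) :=
  {x | (∃ y hy, x = plus y hy) ∨ ∃ y hy, x = minus y hy}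

/-- The star of `p_k` in `Ẽ_J`: all points, except those over the other vertices. -/
def vertexStar (k : Fin (n + 2)) : Set (BlowUp J) :=
  {x | match x with
    | plus _ _ => True
    | minus _ _ => True
    | exc k' _ _ _ => k' = k}

/-- On the star of `p_k`, the lift of `π` to a smooth map to `N_ℝ` that is equal to `p_k` on the
exceptional fibre over `p_k` (see `toTorus_lift`). -/
def lift (k : Fin (n + 2)) : BlowUp J → NR n
  | plus y _ => y
  | minus y _ => (2 : ℝ) • p n k - y
  | exc k' _ _ _ => p n k'

lemma toTorus_two_p_sub (k : Fin (n + 2)) (y : NR n) :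
    toTorus ((2 : ℝ) • p n k - y) = toTorus (-y) := by
  funext j
  have h2 : ((((2 : ℝ) • p n k) j : ℝ) : AddCircle Real.pi) = 0 := by
    rw [AddCircle.coe_eq_zero_iff]
    refine Fin.cases ⟨0, ?_⟩ (fun i => ?_) k
    · simp [p]
    · by_cases h : j = i
      · subst h
        refine ⟨1, ?_⟩
        simp [p]
        ring
      · refine ⟨0, ?_⟩
        simp [p, h]
  simp only [toTorus, Pi.sub_apply, Pi.neg_apply]
  rw [sub_eq_add_neg, AddCircle.coe_add, h2, zero_add]

lemma toTorus_lift (k : Fin (n + 2)) (x : BlowUp J) : toTorus (lift k x) = proj x := by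
  cases x with
  | plus y hy => rfl
  | exc k' hk m hm => rfl
  | minus y hy =>
    simp only [proj, rep, lift]
    exact toTorus_two_p_sub k y

lemma range_proj (J : Face n) : range (proj : BlowUp J → Torus n) = coamoebaFace J := by
  ext q
  constructor
  · rintro ⟨x, rfl⟩
    cases x with
    | plus y hy => exact ⟨y, Or.inl hy, Or.inl rfl⟩
    | minus y hy => exact ⟨y, Or.inl hy, Or.inr rfl⟩
    | exc k hk m hm => exact ⟨p n k, Or.inr ⟨k, hk, rfl⟩, Or.inl rfl⟩
  · rintro ⟨y, hy | ⟨k, hk, rfl⟩, rfl | rfl⟩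
    · exact ⟨plus y hy, rfl⟩
    · exact ⟨minus y hy, rfl⟩
    all_goals
      obtain ⟨m, hm⟩ := openSimplex_nonempty (insert k J.1)
        ((Finset.card_insert_le _ _).trans (Nat.succ_le_succ J.2))
    · exact ⟨exc k hk m hm, rfl⟩
    · refine ⟨exc k hk m hm, ?_⟩
      rw [← toTorus_two_p_sub k (p n k), two_smul, add_sub_cancel_right]
      rfl

/-! ### The smooth structure

Around `p_k` we use polar coordinates `(v, t)`, where the points `[p_k + t v]`, `-1 < t < 1`, run
along the line in the direction `v`, normalized by `radius k v = 1`; so `p_k + v` lies on the facet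
opposite to `p_k`, the points with `t > 0` and `t < 0` lie in `E_J⁺` and `E_J⁻`, and `t = 0` is the
exceptional fibre. The pair `(v, t)` is recorded by the single vector `w = (1 + t) v`. -/

/-- The linear form with value `1` on the vectors from `p_k` to the facet opposite to `p_k`. -/
def radius (k : Fin (n + 2)) (v : NR n) : ℝ := -(2 / Real.pi * (u n k ⬝ᵥ v))

/-- The vector `(1 + t) v` for the point `[p_k + t v]` of the star of `p_k`. -/
def polar (k : Fin (n + 2)) : BlowUp J → NR n
  | plus y _ => ((1 + radius k (y - p n k)) / radius k (y - p n k)) • (y - p n k)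
  | minus y _ => ((1 - radius k (y - p n k)) / radius k (y - p n k)) • (y - p n k)
  | exc _ _ m _ => m - p n k

/-- The range of `polar k`. -/
def polarTarget (J : Face n) (k : Fin (n + 2)) : Set (tangentDir J) :=
  {w | (∀ i, i ∉ J.1 → i ≠ k → 0 < u n i ⬝ᵥ (w : NR n)) ∧ 0 < radius k (w : NR n) ∧
    radius k (w : NR n) < 2}

lemma radius_smul (k : Fin (n + 2)) (c : ℝ) (v : NR n) : radius k (c • v) = c * radius k v := by
  simp only [radius, dotProduct_smul, smul_eq_mul]
  ring

lemma radius_sub_p (k : Fin (n + 2)) (y : NR n) : radius k (y - p n k) = 1 - bary k y := by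
  rw [radius, dot_sub_p, if_pos rfl]
  ring

lemma bary_eq_zero_iff_dot {i k : Fin (n + 2)} (h : i ≠ k) (y : NR n) :
    bary i y = 0 ↔ u n i ⬝ᵥ (y - p n k) = 0 := by
  have h1 := dot_sub_p i k y
  rw [if_neg h, sub_zero] at h1
  rw [← h1]
  have := Real.pi_pos
  constructor
  · intro h2
    rcases mul_eq_zero.1 h2 with h3 | h3
    · exact absurd h3 (by positivity)
    · exact h3
  · intro h2
    rw [h2, mul_zero]

lemma bary_pos_iff_dot {i k : Fin (n + 2)} (h : i ≠ k) (y : NR n) :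
    0 < bary i y ↔ 0 < u n i ⬝ᵥ (y - p n k) := by
  have h1 := dot_sub_p i k y
  rw [if_neg h, sub_zero] at h1
  rw [← h1]
  have := Real.pi_pos
  exact mul_pos_iff_of_pos_left (by positivity)

/-- Points of the open simplex in terms of vectors at a vertex. -/
lemma mem_openSimplex_iff {J : Finset (Fin (n + 2))} {k : Fin (n + 2)} (hk : k ∉ J) (y : NR n) :
    y ∈ openSimplex J ↔ (∀ i ∈ J, u n i ⬝ᵥ (y - p n k) = 0) ∧
      (∀ i, i ∉ J → i ≠ k → 0 < u n i ⬝ᵥ (y - p n k)) ∧ radius k (y - p n k) < 1 := by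
  rw [radius_sub_p]
  constructor
  · intro h
    refine ⟨fun i hi => ?_, fun i hi hik => (bary_pos_iff_dot hik y).1 ((h i).2 hi), ?_⟩
    · exact (bary_eq_zero_iff_dot (ne_of_mem_of_not_mem hi hk) y).1 ((h i).1 hi)
    · have := (h k).2 hk
      linarith
  · rintro ⟨h1, h2, h3⟩ i
    refine ⟨fun hi => (bary_eq_zero_iff_dot (ne_of_mem_of_not_mem hi hk) y).2 (h1 i hi), fun hi => ?_⟩
    by_cases hik : i = k
    · subst hik
      linarith
    · exact (bary_pos_iff_dot hik y).2 (h2 i hi hik)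

/-- Points of the open facet opposite to `p_k` in terms of vectors at `p_k`. -/
lemma mem_openSimplex_insert_iff {J : Finset (Fin (n + 2))} {k : Fin (n + 2)} (hk : k ∉ J)
    (y : NR n) :
    y ∈ openSimplex (insert k J) ↔ (∀ i ∈ J, u n i ⬝ᵥ (y - p n k) = 0) ∧
      (∀ i, i ∉ J → i ≠ k → 0 < u n i ⬝ᵥ (y - p n k)) ∧ radius k (y - p n k) = 1 := by
  rw [radius_sub_p]
  constructor
  · intro h
    refine ⟨fun i hi => ?_, fun i hi hik => (bary_pos_iff_dot hik y).1 ((h i).2 ?_), ?_⟩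
    · exact (bary_eq_zero_iff_dot (ne_of_mem_of_not_mem hi hk) y).1
        ((h i).1 (Finset.mem_insert_of_mem hi))
    · simp [hi, hik]
    · rw [(h k).1 (Finset.mem_insert_self k J), sub_zero]
  · rintro ⟨h1, h2, h3⟩ i
    rw [Finset.mem_insert]
    refine ⟨?_, fun hi => ?_⟩
    · rintro (rfl | hi)
      · linarith
      · exact (bary_eq_zero_iff_dot (ne_of_mem_of_not_mem hi hk) y).2 (h1 i hi)
    · rw [not_or] at hi
      exact (bary_pos_iff_dot hi.1 y).2 (h2 i hi.2 hi.1)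

lemma radius_pos {y : NR n} (hy : y ∈ openSimplex J.1) (k : Fin (n + 2)) :
    0 < radius k (y - p n k) := by
  rw [radius_sub_p]
  have h1 := sum_bary y
  have h0 : ∀ i, 0 ≤ bary i y := by
    intro i
    by_cases hi : i ∈ J.1
    · exact ((hy i).1 hi).ge
    · exact ((hy i).2 hi).le
  obtain ⟨i, hi, hik⟩ : ∃ i, i ∉ J.1 ∧ i ≠ k := by
    have hlt : (insert k J.1).card < (Finset.univ : Finset (Fin (n + 2))).card := by
      rw [Finset.card_univ, Fintype.card_fin]
      have := Finset.card_insert_le k J.1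
      have := J.2
      omega
    obtain ⟨i, -, hi⟩ := Finset.exists_mem_notMem_of_card_lt_card hlt
    rw [Finset.mem_insert, not_or] at hi
    exact ⟨i, hi.2, hi.1⟩
  have h2 : bary i y + bary k y ≤ ∑ j, bary j y := by
    rw [← Finset.sum_pair (f := fun j => bary j y) hik]
    exact Finset.sum_le_sum_of_subset_of_nonneg (Finset.subset_univ _) (fun j _ _ => h0 j)
  have h3 := (hy i).2 hi
  linarith

lemma polar_mem {k : Fin (n + 2)} (hk : k ∉ J.1) {x : BlowUp J} (hx : x ∈ vertexStar k) :
    polar k x ∈ tangentDir J := by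
  intro i hi
  cases x with
  | plus y hy =>
    rw [polar, dotProduct_smul, ((mem_openSimplex_iff hk y).1 hy).1 i hi, smul_zero]
  | minus y hy =>
    rw [polar, dotProduct_smul, ((mem_openSimplex_iff hk y).1 hy).1 i hi, smul_zero]
  | exc k' hk' m hm =>
    obtain rfl : k' = k := hx
    exact ((mem_openSimplex_insert_iff hk m).1 hm).1 i hi

lemma plus_mem {k : Fin (n + 2)} (hk : k ∉ J.1) {w : tangentDir J} (hw : w ∈ polarTarget J k)
    (h1 : 1 < radius k (w : NR n)) :
    p n k + ((radius k (w : NR n) - 1) / radius k (w : NR n)) • (w : NR n) ∈ openSimplex J.1 := by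
  have hc : 0 < (radius k (w : NR n) - 1) / radius k (w : NR n) :=
    div_pos (by linarith) hw.2.1
  rw [mem_openSimplex_iff hk, add_sub_cancel_left]
  refine ⟨fun i hi => ?_, fun i hi hik => ?_, ?_⟩
  · rw [dotProduct_smul, w.2 i hi, smul_zero]
  · rw [dotProduct_smul]
    exact mul_pos hc (hw.1 i hi hik)
  · rw [radius_smul, div_mul_cancel₀ _ hw.2.1.ne']
    linarith [hw.2.2]

lemma minus_mem {k : Fin (n + 2)} (hk : k ∉ J.1) {w : tangentDir J} (hw : w ∈ polarTarget J k)
    (h1 : radius k (w : NR n) < 1) :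
    p n k + ((1 - radius k (w : NR n)) / radius k (w : NR n)) • (w : NR n) ∈ openSimplex J.1 := by
  have hc : 0 < (1 - radius k (w : NR n)) / radius k (w : NR n) :=
    div_pos (by linarith) hw.2.1
  rw [mem_openSimplex_iff hk, add_sub_cancel_left]
  refine ⟨fun i hi => ?_, fun i hi hik => ?_, ?_⟩
  · rw [dotProduct_smul, w.2 i hi, smul_zero]
  · rw [dotProduct_smul]
    exact mul_pos hc (hw.1 i hi hik)
  · rw [radius_smul, div_mul_cancel₀ _ hw.2.1.ne']
    linarith [hw.2.1]

lemma exc_mem {k : Fin (n + 2)} (hk : k ∉ J.1) {w : tangentDir J} (hw : w ∈ polarTarget J k)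
    (h1 : radius k (w : NR n) = 1) : p n k + (w : NR n) ∈ openSimplex (insert k J.1) := by
  rw [mem_openSimplex_insert_iff hk, add_sub_cancel_left]
  exact ⟨w.2, hw.1, h1⟩

open Classical in
/-- The point `[p_k + t v]` for `w = (1 + t) v` in the range of `polar k`. -/
def ofPolar {k : Fin (n + 2)} (hk : k ∉ J.1) (w : tangentDir J) : BlowUp J :=
  if hw : w ∈ polarTarget J k then
    if h1 : 1 < radius k (w : NR n) then plus _ (plus_mem hk hw h1)
    else if h2 : radius k (w : NR n) < 1 then minus _ (minus_mem hk hw h2)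
    else exc k hk _ (exc_mem hk hw (le_antisymm (not_lt.1 h1) (not_lt.1 h2)))
  else Classical.arbitrary _

lemma radius_polar_plus (k : Fin (n + 2)) {y : NR n} (hy : y ∈ openSimplex J.1) :
    radius k (polar k (plus y hy)) = 1 + radius k (y - p n k) := by
  rw [polar, radius_smul, div_mul_cancel₀ _ (radius_pos hy k).ne']

lemma radius_polar_minus (k : Fin (n + 2)) {y : NR n} (hy : y ∈ openSimplex J.1) :
    radius k (polar k (minus y hy)) = 1 - radius k (y - p n k) := by
  rw [polar, radius_smul, div_mul_cancel₀ _ (radius_pos hy k).ne']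

lemma radius_polar_exc {k : Fin (n + 2)} (hk : k ∉ J.1) {m : NR n}
    (hm : m ∈ openSimplex (insert k J.1)) : radius k (polar k (exc k hk m hm)) = 1 :=
  ((mem_openSimplex_insert_iff hk m).1 hm).2.2

lemma polar_mem_target {k : Fin (n + 2)} (hk : k ∉ J.1) {x : BlowUp J} (hx : x ∈ vertexStar k) :
    (⟨polar k x, polar_mem hk hx⟩ : tangentDir J) ∈ polarTarget J k := by
  cases x with
  | plus y hy =>
    have hr := radius_pos hy k
    obtain ⟨-, h2, h3⟩ := (mem_openSimplex_iff hk y).1 hy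
    refine ⟨fun i hi hik => ?_, ?_, ?_⟩
    · simp only [polar]
      rw [dotProduct_smul]
      exact mul_pos (by positivity) (h2 i hi hik)
    · simp only [radius_polar_plus]
      positivity
    · simp only [radius_polar_plus]
      linarith
  | minus y hy =>
    have hr := radius_pos hy k
    obtain ⟨-, h2, h3⟩ := (mem_openSimplex_iff hk y).1 hy
    have hc : 0 < 1 - radius k (y - p n k) := by linarith
    refine ⟨fun i hi hik => ?_, ?_, ?_⟩
    · simp only [polar]
      rw [dotProduct_smul]
      exact mul_pos (by positivity) (h2 i hi hik)
    · simp only [radius_polar_minus]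
      exact hc
    · simp only [radius_polar_minus]
      linarith
  | exc k' hk' m hm =>
    obtain rfl : k' = k := hx
    obtain ⟨-, h2, h3⟩ := (mem_openSimplex_insert_iff hk m).1 hm
    refine ⟨h2, ?_, ?_⟩ <;> simp only [radius_polar_exc] <;> norm_num

lemma plus_congr {y y' : NR n} (hy : y ∈ openSimplex J.1) (hy' : y' ∈ openSimplex J.1)
    (h : y = y') : plus y hy = plus y' hy' := by
  subst h
  rfl

lemma minus_congr {y y' : NR n} (hy : y ∈ openSimplex J.1) (hy' : y' ∈ openSimplex J.1)
    (h : y = y') : minus y hy = minus y' hy' := by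
  subst h
  rfl

lemma exc_congr {k : Fin (n + 2)} (hk : k ∉ J.1) {m m' : NR n}
    (hm : m ∈ openSimplex (insert k J.1)) (hm' : m' ∈ openSimplex (insert k J.1)) (h : m = m') :
    exc k hk m hm = exc k hk m' hm' := by
  subst h
  rfl

lemma ofPolar_polar {k : Fin (n + 2)} (hk : k ∉ J.1) {x : BlowUp J} (hx : x ∈ vertexStar k) :
    ofPolar hk ⟨polar k x, polar_mem hk hx⟩ = x := by
  rw [ofPolar, dif_pos (polar_mem_target hk hx)]
  cases x with
  | plus y hy =>
    have hr := radius_pos hy k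
    rw [dif_pos (by simp only [radius_polar_plus]; linarith)]
    apply plus_congr
    simp only [radius_polar_plus]
    rw [polar, smul_smul, show (1 + radius k (y - p n k) - 1) / (1 + radius k (y - p n k)) *
      ((1 + radius k (y - p n k)) / radius k (y - p n k)) = 1 by field_simp; ring, one_smul,
      add_sub_cancel]
  | minus y hy =>
    have hr := radius_pos hy k
    have hr1 := ((mem_openSimplex_iff hk y).1 hy).2.2
    have hc : 1 - radius k (y - p n k) ≠ 0 := by linarith
    rw [dif_neg (by simp only [radius_polar_minus]; linarith),
      dif_pos (by simp only [radius_polar_minus]; linarith)]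
    apply minus_congr
    simp only [radius_polar_minus]
    rw [polar, smul_smul, show (1 - (1 - radius k (y - p n k))) / (1 - radius k (y - p n k)) *
      ((1 - radius k (y - p n k)) / radius k (y - p n k)) = 1 by field_simp; ring, one_smul,
      add_sub_cancel]
  | exc k' hk' m hm =>
    obtain rfl : k' = k := hx
    have h1 := radius_polar_exc hk' hm
    rw [dif_neg (by simp only [radius_polar_exc]; linarith),
      dif_neg (by simp only [radius_polar_exc]; linarith)]
    apply exc_congr
    simp only [polar]
    rw [add_sub_cancel]

lemma ofPolar_mem {k : Fin (n + 2)} (hk : k ∉ J.1) {w : tangentDir J} (hw : w ∈ polarTarget J k) :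
    ofPolar hk w ∈ vertexStar k := by
  rw [ofPolar, dif_pos hw]
  split_ifs
  · trivial
  · trivial
  · rfl

lemma polar_ofPolar {k : Fin (n + 2)} (hk : k ∉ J.1) {w : tangentDir J}
    (hw : w ∈ polarTarget J k) : polar k (ofPolar hk w) = w := by
  have hr := hw.2.1
  rw [ofPolar, dif_pos hw]
  split_ifs with h1 h2
  · have hc : radius k (w : NR n) - 1 ≠ 0 := by linarith
    rw [polar, add_sub_cancel_left, radius_smul, div_mul_cancel₀ _ hr.ne', smul_smul]
    convert one_smul ℝ (w : NR n) using 2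
    field_simp
    ring
  · have hc : 1 - radius k (w : NR n) ≠ 0 := by linarith
    rw [polar, add_sub_cancel_left, radius_smul, div_mul_cancel₀ _ hr.ne', smul_smul]
    convert one_smul ℝ (w : NR n) using 2
    field_simp
    ring
  · rw [polar, add_sub_cancel_left]

open Classical in
/-- The chart of `Ẽ_J` on the star of `p_k`. -/
def chart {k : Fin (n + 2)} (hk : k ∉ J.1) : PartialEquiv (BlowUp J) (tangentDir J) where
  toFun x := if hx : x ∈ vertexStar k then ⟨polar k x, polar_mem hk hx⟩ else 0
  invFun := ofPolar hk
  source := vertexStar k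
  target := polarTarget J k
  map_source' := by
    intro x hx
    rw [dif_pos hx]
    exact polar_mem_target hk hx
  map_target' := fun w hw => ofPolar_mem hk hw
  left_inv' := by
    intro x hx
    rw [dif_pos hx]
    exact ofPolar_polar hk hx
  right_inv' := by
    intro w hw
    rw [dif_pos (ofPolar_mem hk hw)]
    exact Subtype.ext (polar_ofPolar hk hw)

/-- A chart whose domain contains the given point. -/
def chartAround : BlowUp J → PartialEquiv (BlowUp J) (tangentDir J)
  | exc _ hk _ _ => chart hk
  | _ => chart (exists_notMem J).choose_spec

lemma isOpen_polarTarget (J : Face n) (k : Fin (n + 2)) : IsOpen (polarTarget J k) := by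
  have hc : ∀ i, Continuous fun w : tangentDir J => u n i ⬝ᵥ (w : NR n) := fun i =>
    Continuous.dotProduct continuous_const continuous_subtype_val
  have hr : Continuous fun w : tangentDir J => radius k (w : NR n) :=
    (continuous_const.mul (hc k)).neg
  have : polarTarget J k = (⋂ i, ⋂ (_ : i ∉ J.1), ⋂ (_ : i ≠ k),
      {w : tangentDir J | 0 < u n i ⬝ᵥ (w : NR n)}) ∩
      ({w | 0 < radius k (w : NR n)} ∩ {w | radius k (w : NR n) < 2}) := by
    ext w
    simp [polarTarget]
  rw [this]
  refine IsOpen.inter ?_ ((isOpen_lt continuous_const hr).inter (isOpen_lt hr continuous_const))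
  exact isOpen_iInter_of_finite fun i => isOpen_iInter_of_finite fun _ =>
    isOpen_iInter_of_finite fun _ => isOpen_lt continuous_const (hc i)

lemma contDiffAt_of_coe {f : tangentDir J → tangentDir J} {w : tangentDir J}
    (h : ContDiffAt ℝ ∞ (fun x => (f x : NR n)) w) : ContDiffAt ℝ ∞ f w := by
  obtain ⟨P, hP⟩ := (tangentDir J).subtype.exists_leftInverse_of_injective
    (LinearMap.ker_eq_bot.2 Subtype.val_injective)
  have h1 : f = fun x => P.toContinuousLinearMap (f x : NR n) := by
    funext x
    exact (LinearMap.congr_fun hP (f x)).symm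
  rw [h1]
  exact P.toContinuousLinearMap.contDiff.contDiffAt.comp w h

lemma contDiff_radius (k : Fin (n + 2)) : ContDiff ℝ ∞ (radius k : NR n → ℝ) := by
  unfold radius dotProduct
  fun_prop

lemma chart_symm_mem_vertexStar {k l : Fin (n + 2)} (hk : k ∉ J.1) (hkl : k ≠ l) {w : tangentDir J}
    (hw : w ∈ polarTarget J k) : ofPolar hk w ∈ vertexStar l ↔ radius k (w : NR n) ≠ 1 := by
  rw [ofPolar, dif_pos hw]
  split_ifs with h1 h2
  · exact ⟨fun _ => h1.ne', fun _ => trivial⟩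
  · exact ⟨fun _ => h2.ne, fun _ => trivial⟩
  · exact ⟨fun h => absurd h hkl, fun h => absurd (le_antisymm (not_lt.1 h1) (not_lt.1 h2)) h⟩

/-- The changes of coordinates are smooth on open sets. -/
lemma chart_trans {k l : Fin (n + 2)} (hk : k ∉ J.1) (hl : l ∉ J.1) :
    IsOpen ((chart hk).symm.trans (chart hl)).source ∧
      ContDiffOn ℝ ∞ ((chart hk).symm.trans (chart hl))
        ((chart hk).symm.trans (chart hl)).source := by
  have hsrc : ((chart hk).symm.trans (chart hl)).source
      = polarTarget J k ∩ {w | ofPolar hk w ∈ vertexStar l} := rfl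
  have hval : ∀ w ∈ polarTarget J k ∩ {w | ofPolar hk w ∈ vertexStar l},
      (((chart hk).symm.trans (chart hl)) w : NR n) = polar l (ofPolar hk w) := by
    intro w hw
    have : ((chart hk).symm.trans (chart hl)) w = ⟨polar l (ofPolar hk w), polar_mem hl hw.2⟩ :=
      dif_pos hw.2
    rw [this]
  rw [hsrc]
  by_cases hkl : k = l
  · subst hkl
    have h1 : polarTarget J k ∩ {w | ofPolar hk w ∈ vertexStar k} = polarTarget J k :=
      inter_eq_left.2 fun w hw => ofPolar_mem hk hw
    rw [h1] at hval ⊢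
    refine ⟨isOpen_polarTarget J k, contDiffOn_id.congr fun w hw => ?_⟩
    exact Subtype.ext ((hval w hw).trans (polar_ofPolar hk hw))
  · have hrc : Continuous fun w : tangentDir J => radius k (w : NR n) :=
      (contDiff_radius k).continuous.comp continuous_subtype_val
    have h1 : polarTarget J k ∩ {w | ofPolar hk w ∈ vertexStar l}
        = polarTarget J k ∩ {w : tangentDir J | radius k (w : NR n) ≠ 1} := by
      ext w
      exact and_congr_right fun hw => chart_symm_mem_vertexStar hk hkl hw
    have hopen : IsOpen (polarTarget J k ∩ {w : tangentDir J | radius k (w : NR n) ≠ 1}) :=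
      (isOpen_polarTarget J k).inter (isOpen_ne_fun hrc continuous_const)
    rw [h1] at hval ⊢
    refine ⟨hopen, fun w hw => ContDiffAt.contDiffWithinAt (contDiffAt_of_coe ?_)⟩
    have hcoe : ContDiff ℝ ∞ fun w : tangentDir J => (w : NR n) :=
      (tangentDir J).subtypeL.contDiff
    have hrk : ContDiff ℝ ∞ fun w : tangentDir J => radius k (w : NR n) :=
      (contDiff_radius k).comp hcoe
    rcases lt_or_gt_of_ne hw.2 with hlt | hgt
    · have hA : ContDiffAt ℝ ∞ (fun w : tangentDir J =>
          p n k + ((1 - radius k (w : NR n)) / radius k (w : NR n)) • (w : NR n) - p n l) w :=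
        ((contDiffAt_const.add (((contDiffAt_const.sub hrk.contDiffAt).div hrk.contDiffAt
          hw.1.2.1.ne').smul hcoe.contDiffAt)).sub contDiffAt_const)
      have hrl := (contDiff_radius l).contDiffAt.comp w hA
      have hpos := radius_pos (minus_mem hk hw.1 hlt) l
      refine (((contDiffAt_const (c := (1 : ℝ)).sub hrl).div hrl hpos.ne').smul hA).congr_of_eventuallyEq ?_
      filter_upwards [hopen.mem_nhds hw, (isOpen_lt hrc continuous_const).mem_nhds hlt]
        with x hx hx1
      rw [hval x hx, ofPolar, dif_pos hx.1, dif_neg (not_lt.2 (le_of_lt hx1)), dif_pos hx1]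
      rfl
    · have hA : ContDiffAt ℝ ∞ (fun w : tangentDir J =>
          p n k + ((radius k (w : NR n) - 1) / radius k (w : NR n)) • (w : NR n) - p n l) w :=
        ((contDiffAt_const.add (((hrk.contDiffAt.sub contDiffAt_const).div hrk.contDiffAt
          hw.1.2.1.ne').smul hcoe.contDiffAt)).sub contDiffAt_const)
      have hrl := (contDiff_radius l).contDiffAt.comp w hA
      have hpos := radius_pos (plus_mem hk hw.1 hgt) l
      refine (((contDiffAt_const (c := (1 : ℝ)).add hrl).div hrl hpos.ne').smul hA).congr_of_eventuallyEq ?_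
      filter_upwards [hopen.mem_nhds hw, (isOpen_lt continuous_const hrc).mem_nhds hgt]
        with x hx hx1
      rw [hval x hx, ofPolar, dif_pos hx.1, dif_pos hx1]
      rfl

/-- The atlas of `Ẽ_J` formed by the charts on the stars of the vertices. -/
def core (J : Face n) : ChartedSpaceCore (tangentDir J) (BlowUp J) where
  atlas := {e | ∃ (k : Fin (n + 2)) (hk : k ∉ J.1), e = chart hk}
  chartAt := chartAround
  mem_chart_source := by
    intro x
    cases x with
    | plus y hy => trivial
    | minus y hy => trivial
    | exc k hk m hm => rfl
  chart_mem_atlas := by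
    intro x
    cases x with
    | plus y hy => exact ⟨_, _, rfl⟩
    | minus y hy => exact ⟨_, _, rfl⟩
    | exc k hk m hm => exact ⟨_, _, rfl⟩
  open_source := by
    rintro _ _ ⟨k, hk, rfl⟩ ⟨l, hl, rfl⟩
    exact (chart_trans hk hl).1
  continuousOn_toFun := by
    rintro _ _ ⟨k, hk, rfl⟩ ⟨l, hl, rfl⟩
    exact (chart_trans hk hl).2.continuousOn

instance (J : Face n) : TopologicalSpace (BlowUp J) := (core J).toTopologicalSpace

instance (J : Face n) : ChartedSpace (tangentDir J) (BlowUp J) := (core J).toChartedSpace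

instance (J : Face n) : IsManifold 𝓘(ℝ, tangentDir J) ∞ (BlowUp J) := by
  apply isManifold_of_contDiffOn
  intro e e' he he'
  obtain ⟨_, ⟨f, rfl⟩, _, ⟨⟨k, hk, rfl⟩, rfl⟩, rfl⟩ := he
  obtain ⟨_, ⟨f', rfl⟩, _, ⟨⟨l, hl, rfl⟩, rfl⟩, rfl⟩ := he'
  have h := (chart_trans hk hl).2
  simp only [modelWithCornersSelf_coe, modelWithCornersSelf_coe_symm, Function.id_comp,
    Function.comp_id, preimage_id, range_id, inter_univ]
  exact h

end BlowUp

/-! ### The function `F` and the pair of pants -/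

/-- The real root of order `n + 1` (of a non-negative number, or of a negative one for `n`
even). -/
def realRoot (n : ℕ) (a : ℝ) : ℝ := Real.sign a * |a| ^ (1 / ((n : ℝ) + 1))

/-- The product `cos (∑ yⱼ) ∏ sin yⱼ`. -/
def trigProd {n : ℕ} (y : NR n) : ℝ := Real.cos (∑ j, y j) * ∏ j, Real.sin (y j)

/-- The function `F` on `C⁺`. -/
def Fplus {n : ℕ} (y : NR n) : ℝ := realRoot n (trigProd y)

/-- The function `F` on `C⁻`. -/
def Fminus {n : ℕ} (y : NR n) : ℝ := (-1) ^ n * realRoot n (trigProd y)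

/-- The real blow-up `C̃` of the coamoeba `C` at its vertices. -/
abbrev Ctilde (n : ℕ) := BlowUp (whole n)

open BlowUp

/-- The function `F`, lifted to `C̃`. -/
def F {n : ℕ} : Ctilde n → ℝ
  | plus y _ => Fplus y
  | minus y _ => Fminus (-y)
  | exc k _ _ _ => Fplus (p n k)

/-- The vector of partial derivatives of a function on `N_ℝ`. -/
def partials {n : ℕ} (f : NR n → ℝ) (y : NR n) : MR n := fun j => fderiv ℝ f y (Pi.single j 1)

/-- The map `(F_{y_1}, …, F_{y_{n+1}})` on `C` without its vertices (and `0` elsewhere). -/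
def gradF {n : ℕ} : Ctilde n → MR n
  | plus y _ => partials Fplus y
  | minus y _ => partials Fminus (-y)
  | exc _ _ _ _ => 0

/-- The map `h : C̃ → M_ℝ`: the extension by continuity of the gradient of `F` from the complement
of the exceptional fibres. -/
def h (n : ℕ) : Ctilde n → MR n := extendFrom (regular (whole n)) gradF

/-- The map `Φ = (h, π) : C̃ → M_ℝ × T`, whose image is the Lagrangian pair of pants. -/
def Phi {n : ℕ} (x : Ctilde n) : MR n × Torus n := (h n x, proj x)

/-! ### Projections to faces -/

/-- The space `V_J` spanned by the cone `Γ_J`. -/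
def VJ {n : ℕ} (J : Face n) : Submodule ℝ (MR n) := Submodule.span ℝ (u n '' J.1)

/-- The relative interior of the cone `Γ_J`, as a subset of `V_J`. -/
def interiorCone {n : ℕ} (J : Face n) : Set (VJ J) :=
  {x | ∃ t : Fin (n + 2) → ℝ, (∀ j ∈ J.1, 0 < t j) ∧ (x : MR n) = ∑ j ∈ J.1, t j • u n j}

/-- The annihilator `L^⊥ ⊆ M_ℝ` of `L ⊆ N_ℝ`. -/
def perp {n : ℕ} (L : Submodule ℝ (NR n)) : Submodule ℝ (MR n) where
  carrier := {x | ∀ y ∈ L, x ⬝ᵥ y = 0}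
  add_mem' := by
    intro a b ha hb y hy
    rw [add_dotProduct, ha y hy, hb y hy, add_zero]
  zero_mem' := by
    intro y _
    simp
  smul_mem' := by
    intro c a ha y hy
    rw [smul_dotProduct, ha y hy, smul_zero]

lemma finrank_perp {n : ℕ} (L : Submodule ℝ (NR n)) :
    Module.finrank ℝ (perp L) + Module.finrank ℝ L = n + 1 := by
  let B : LinearMap.BilinForm ℝ (NR n) := dotProductBilin ℝ ℝ
  have hsymm : B.IsRefl := by
    intro x y hxy
    change y ⬝ᵥ x = 0
    rw [dotProduct_comm]
    exact hxy
  have hB : B.Nondegenerate := by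
    constructor
    · intro x hx
      exact dotProduct_eq_zero x hx
    · intro x hx
      refine dotProduct_eq_zero x fun y => ?_
      rw [dotProduct_comm]
      exact hx y
  have hp : perp L = B.orthogonal L := by
    ext x
    refine forall₂_congr fun y _ => ?_
    change x ⬝ᵥ y = 0 ↔ y ⬝ᵥ x = 0
    rw [dotProduct_comm]
  have h1 := LinearMap.BilinForm.finrank_orthogonal hB L
  have h2 := Submodule.finrank_le L
  have h3 : Module.finrank ℝ (NR n) = n + 1 := by simp
  rw [hp, h1]
  omega

lemma tangentDir_eq_perp {n : ℕ} (J : Face n) : tangentDir J = perp (VJ J) := by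
  ext v
  constructor
  · intro hv x hx
    induction hx using Submodule.span_induction with
    | mem x hx =>
      obtain ⟨i, hi, rfl⟩ := hx
      rw [dotProduct_comm]
      exact hv i hi
    | zero => simp
    | add x y _ _ hx hy => rw [dotProduct_add, hx, hy, add_zero]
    | smul c x _ hx => rw [dotProduct_smul, hx, smul_zero]
  · intro hv i hi
    rw [dotProduct_comm]
    exact hv _ (Submodule.subset_span ⟨i, hi, rfl⟩)

/-- If `L` is a complement of the tangent space of `E_J`, then `L^⊥` is a complement of `V_J`. -/
lemma isCompl_perp {n : ℕ} {J : Face n} {L : Submodule ℝ (NR n)}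
    (hL : IsCompl L (tangentDir J)) : IsCompl (VJ J) (perp L) := by
  have h1 := finrank_perp L
  have h2 := finrank_perp (VJ J)
  rw [← tangentDir_eq_perp] at h2
  have h3 := Submodule.finrank_add_eq_of_isCompl hL
  have h4 : Module.finrank ℝ (NR n) = n + 1 := by simp
  have h5 : Module.finrank ℝ (MR n) = n + 1 := by simp
  have h6 : Module.finrank ℝ (tangentDir J) + Module.finrank ℝ (VJ J) = n + 1 := h2
  refine (Submodule.isCompl_iff_disjoint _ _ (by omega)).2 ?_
  rw [Submodule.disjoint_def]
  intro x hx hxL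
  refine dotProduct_eq_zero x fun y => ?_
  obtain ⟨a, ha, b, hb, rfl⟩ := Submodule.mem_sup.1 (hL.sup_eq_top ▸ Submodule.mem_top (x := y))
  rw [dotProduct_add, hxL a ha, dotProduct_comm]
  rw [tangentDir_eq_perp] at hb
  rw [hb x hx, add_zero]

variable {n : ℕ} {J : Face n}

/-- The projection `x_{J,L} : M_ℝ → V_J` along `L^⊥`. -/
def xProj {L : Submodule ℝ (NR n)} (hL : IsCompl L (tangentDir J)) : MR n →ₗ[ℝ] VJ J :=
  (VJ J).projectionOnto (perp L) (isCompl_perp hL)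

/-- `IsProj L x x'` says that `x' ∈ Ẽ_J` is the projection of `x ∈ C̃` along `L`. For interior
points `y` of `C^±` this means that `y' ∈ E_J^±` satisfies `y - y' ∈ L`. Over a vertex `p_k` of
`E_J`, it means that the line through `p_k` and `m` is mapped by the projection along `L` to the
line through `p_k` and `m'`, where the ray from `p_k` to `m` goes to the ray from `p_k` to
`m'`. -/
def IsProj (L : Submodule ℝ (NR n)) : Ctilde n → BlowUp J → Prop
  | plus y _, plus y' _ => y - y' ∈ L
  | minus y _, minus y' _ => y - y' ∈ L
  | exc k _ m _, exc k' _ m' _ => k = k' ∧ ∃ c : ℝ, 0 < c ∧ (m - p n k) - c • (m' - p n k) ∈ L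
  | _, _ => False

/-- The set `Ũ_{J,L}` of the points of `C̃` that have a projection to `Ẽ_J` along `L`. -/
def Utilde (J : Face n) (L : Submodule ℝ (NR n)) : Set (Ctilde n) :=
  {x | ∃ x' : BlowUp J, IsProj L x x'}

open Classical in
/-- The projection `y_{J,L} : Ũ_{J,L} → Ẽ_J` (with arbitrary values outside `Ũ_{J,L}`). -/
def yProj (J : Face n) (L : Submodule ℝ (NR n)) (x : Ctilde n) : BlowUp J :=
  if hx : ∃ x' : BlowUp J, IsProj L x x' then hx.choose else Classical.arbitrary _

/-- The map `h_{J,L} = x_{J,L} ∘ h`. -/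
def hProj {L : Submodule ℝ (NR n)} (hL : IsCompl L (tangentDir J)) (x : Ctilde n) : VJ J :=
  xProj hL (h n x)

/-- The map `g_{J,L} = (y_{J,L}, h_{J,L})`. -/
def gProj {L : Submodule ℝ (NR n)} (hL : IsCompl L (tangentDir J)) (x : Ctilde n) :
    BlowUp J × VJ J :=
  (yProj J L x, hProj hL x)

/-- The space `L` parallel to the face with vertices `p_k` and `p_j`, `j ∈ J`, which gives the
standard projections `y_{J,k}` and `x_{J,k}`. -/
def stdL (J : Face n) (k : Fin (n + 2)) : Submodule ℝ (NR n) :=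
  Submodule.span ℝ ((fun j => p n j - p n k) '' J.1)

lemma dot_p_sub_p (i j k : Fin (n + 2)) :
    2 / Real.pi * (u n i ⬝ᵥ (p n j - p n k)) =
      (if i = j then 1 else 0) - if i = k then 1 else 0 := by
  rw [dot_sub_p, bary_p]

lemma isCompl_stdL {k : Fin (n + 2)} (hk : k ∉ J.1) : IsCompl (stdL J k) (tangentDir J) := by
  have hpi : (2 / Real.pi : ℝ) ≠ 0 := by
    have := Real.pi_pos
    positivity
  have hdot : ∀ (c : Fin (n + 2) → ℝ), ∀ i ∈ J.1,
      2 / Real.pi * (u n i ⬝ᵥ ∑ j ∈ J.1, c j • (p n j - p n k)) = c i := by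
    intro c i hi
    have hik : i ≠ k := ne_of_mem_of_not_mem hi hk
    rw [dotProduct_sum, Finset.mul_sum, Finset.sum_congr rfl (g := fun j => if i = j then c j else 0)]
    · simp [hi]
    · intro j _
      rw [dotProduct_smul, smul_eq_mul, mul_left_comm, dot_p_sub_p, if_neg hik]
      simp
  have hmem : ∀ c : Fin (n + 2) → ℝ, ∑ j ∈ J.1, c j • (p n j - p n k) ∈ stdL J k := fun c =>
    Submodule.sum_mem _ fun j hj => Submodule.smul_mem _ _ (Submodule.subset_span ⟨j, hj, rfl⟩)
  constructor
  · rw [Submodule.disjoint_def]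
    intro v hv hvJ
    obtain ⟨c, rfl⟩ : ∃ c : Fin (n + 2) → ℝ, ∑ j ∈ J.1, c j • (p n j - p n k) = v := by
      obtain ⟨c, hc⟩ := (Submodule.mem_span_image_finset_iff_exists_fun ℝ).1 hv
      refine ⟨fun j => if hj : j ∈ J.1 then c ⟨j, hj⟩ else 0, ?_⟩
      rw [← hc, ← Finset.sum_attach]
      exact Finset.sum_congr rfl fun j _ => by simp only [dif_pos j.2]
    refine Finset.sum_eq_zero fun i hi => ?_
    rw [← hdot c i hi, hvJ i hi, mul_zero, zero_smul]
  · rw [codisjoint_iff, eq_top_iff]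
    intro v _
    refine Submodule.mem_sup.2 ⟨_, hmem fun j => 2 / Real.pi * (u n j ⬝ᵥ v), _, ?_,
      add_sub_cancel _ v⟩
    intro i hi
    have h1 := hdot (fun j => 2 / Real.pi * (u n j ⬝ᵥ v)) i hi
    rw [dotProduct_sub, sub_eq_zero]
    exact (mul_left_cancel₀ hpi h1).symm

/-- The set `W̃_{J,k} = π⁻¹(W_{J,k})`, where `W_{J,k}^+` consists of the points of `C⁺` lying, for
each `j ∈ J`, in the half `Δ_{jk}` containing `p_k` into which `C⁺` is cut by the hyperplane through
the midpoint of `p_j, p_k` and the other vertices. -/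
def Wtilde (J : Face n) (k : Fin (n + 2)) : Set (Ctilde n) :=
  {x | ∀ j ∈ J.1, bary j (base x) ≤ bary k (base x)}

/-! ### Diffeomorphisms, graphs of exact one-forms, and trivial bundles -/

section Manifolds

variable {E₁ H₁ M₁ E₂ H₂ M₂ E₃ H₃ M₃ : Type}
  [NormedAddCommGroup E₁] [NormedSpace ℝ E₁] [TopologicalSpace H₁] [TopologicalSpace M₁]
  [ChartedSpace H₁ M₁]
  [NormedAddCommGroup E₂] [NormedSpace ℝ E₂] [TopologicalSpace H₂] [TopologicalSpace M₂]
  [ChartedSpace H₂ M₂]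
  [NormedAddCommGroup E₃] [NormedSpace ℝ E₃] [TopologicalSpace H₃] [TopologicalSpace M₃]
  [ChartedSpace H₃ M₃]

/-- The map `f` restricts to a diffeomorphism from the open set `s` onto the open set `t`. -/
def IsDiffeoOnto (I₁ : ModelWithCorners ℝ E₁ H₁) (I₂ : ModelWithCorners ℝ E₂ H₂)
    (f : M₁ → M₂) (s : Set M₁) (t : Set M₂) : Prop :=
  IsOpen s ∧ IsOpen t ∧ ContMDiffOn I₁ I₂ ∞ f s ∧
    ∃ f' : M₂ → M₁, MapsTo f s t ∧ MapsTo f' t s ∧ InvOn f' f s t ∧ ContMDiffOn I₂ I₁ ∞ f' t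

/-- The map `f` restricts to a trivial smooth fibre bundle from the open set `s` to the open set
`b`, with fibre `M₃`. -/
def IsTrivialBundleOn (I₁ : ModelWithCorners ℝ E₁ H₁) (I₂ : ModelWithCorners ℝ E₂ H₂)
    (I₃ : ModelWithCorners ℝ E₃ H₃) (M₃ : Type) [TopologicalSpace M₃] [ChartedSpace H₃ M₃]
    (f : M₁ → M₂) (s : Set M₁) (b : Set M₂) : Prop :=
  ∃ Ψ : M₁ → M₂ × M₃, IsDiffeoOnto I₁ (I₂.prod I₃) Ψ s (b ×ˢ univ) ∧ ∀ x ∈ s, (Ψ x).1 = f x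

end Manifolds

/-- The model of the manifold `C̃`. -/
abbrev modelC (n : ℕ) := 𝓘(ℝ, tangentDir (whole n))

/-- The model of the manifold `Ẽ_J × V_J`. -/
abbrev modelEV (J : Face n) := (𝓘(ℝ, tangentDir J)).prod 𝓘(ℝ, VJ J)

/-- The linear form on the tangent space `V_J × T(T_J)` of `V_J × T_J` identified with
`(ℓ', ℓ) ∈ L^⊥ × L`: it maps `(v, w)` to `⟨v, ℓ⟩ - ⟨ℓ', w⟩`. -/
def cotangentForm {L : Submodule ℝ (NR n)} (s : perp L × L) (v : MR n) (w : NR n) : ℝ :=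
  v ⬝ᵥ (s.2 : NR n) - (s.1 : MR n) ⬝ᵥ w

/-- The covering `(V_J × T_J) × (L^⊥ × L) → M_ℝ × T`, `(a, θ, ℓ', ℓ) ↦ (a + ℓ', θ + [ℓ])`. -/
def covering {L : Submodule ℝ (NR n)} (a : VJ J) (θ : Torus n) (s : perp L × L) :
    MR n × Torus n :=
  ((a : MR n) + (s.1 : MR n), θ + toTorus (s.2 : NR n))

/-- With `(V_J × T_J) × (L^⊥ × L)` as the cotangent bundle of `V_J × T_J` and as a covering of
`M_ℝ × T`, the subset `Λ` of `M_ℝ × T` is the graph over `Z ⊆ Ẽ_J × V_J` of the exact one-form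
`dG`. As `Ẽ_J → T_J` is not a local diffeomorphism on the exceptional fibres, this means that `G` is
smooth, that the section of the cotangent bundle of `V_J × T_J` given by `dG` outside these fibres
extends to a smooth map `σ : Z → L^⊥ × L`, and that the resulting map from `Z` to the cotangent
bundle is an embedding (a topological embedding and an immersion) whose image is mapped onto `Λ`.
The derivatives are computed with the local lifts of `π` to `N_ℝ`. -/
def IsExactGraph (J : Face n) (L : Submodule ℝ (NR n)) (Z : Set (BlowUp J × VJ J))
    (G : BlowUp J × VJ J → ℝ) (Λ : Set (MR n × Torus n)) : Prop :=
  ∃ σ : BlowUp J × VJ J → perp L × L,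
    ContMDiffOn (modelEV J) 𝓘(ℝ, ℝ) ∞ G Z ∧
    ContMDiffOn (modelEV J) 𝓘(ℝ, perp L × L) ∞ σ Z ∧
    (∀ z ∈ Z, ∀ k ∉ J.1, z.1 ∈ vertexStar k → ∀ ξ : tangentDir J, ∀ v : VJ J,
      (mfderiv (modelEV J) 𝓘(ℝ, ℝ) G z (ξ, v) : ℝ) =
        cotangentForm (σ z) v (mfderiv 𝓘(ℝ, tangentDir J) 𝓘(ℝ, NR n) (lift k) z.1 ξ)) ∧
    IsEmbedding (fun z : Z => ((z.1.2, proj z.1.1), σ z.1)) ∧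
    (∀ z ∈ Z, ∀ k ∉ J.1, z.1 ∈ vertexStar k →
      Function.Injective (mfderiv (modelEV J) 𝓘(ℝ, (VJ J × NR n) × (perp L × L))
        (fun z => ((z.2, lift k z.1), σ z)) z)) ∧
    Λ = (fun z => covering z.2 (proj z.1) (σ z)) '' Z

/-- The function `G` is the partial Legendre transform of `F` along `L`:
`G(y_{J,L}, h_{J,L}) = ⟨h_{J,L}, y - y_{J,L}⟩ - F` on the set `s`. -/
def IsLegendreTransform {L : Submodule ℝ (NR n)} (hL : IsCompl L (tangentDir J))
    (s : Set (Ctilde n)) (G : BlowUp J × VJ J → ℝ) : Prop :=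
  ∀ x ∈ s, G (gProj hL x) = (hProj hL x : MR n) ⬝ᵥ (rep x - rep (yProj J L x)) - F x

end PairOfPants

end

open PairOfPants PairOfPants.BlowUp

noncomputable section

namespace PairOfPants

section

/-! ### Analysis of the function `F` near a vertex -/

/-! Near a vertex `p_k` write points as p_k + t v. The n + 2 factors of F^(n+1) belong to the
vectors u_i, and all but the k-th vanish at `p_k`. Dividing those by t gives F = t Ψ(v, t), with Ψ
positive and smooth across t = 0 (`contDiffOn_Psi`). Since Ψ is even in t, the sign chosen for F on
C^- makes the same formula valid for t < 0 (`Fminus_neg`, `F_paramC`). The gradient of F is the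
v-gradient of Ψ(·, t), which is smooth on the blow-up; this gives the smoothness of h
(`partials_Fplus`, `h_paramC`, `contMDiff_h`). The coordinates are redundant: (v, t) and (c v, t/c)
with c > 0 name one point, and Ψ is homogeneous accordingly.

The main inequality is concavity (`hessian_neg`): the Hessian of Ψ(·, t) is negative definite,
except that at t = 0 it degenerates along the ray of v. In polar coordinates the points with a given
projection along L form an open convex part of an affine space v + L, with v tangent to E_J and
nonzero, so no direction in L is radial and Ψ is strictly concave there. The component h_{J,L} is
the gradient of Ψ along this affine space. Hence g is injective with injective derivative, and the
inverse function theorem applies (`injOn_fibreMap`, `injective_fderiv_fibreMap`,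
`isDiffeoOnto_gProj`).

The formula for dG is the usual cancellation in a Legendre transform, carried out in the redundant
coordinates so that t = 0 is included (`mfderiv_legendre`). The graph followed by the covering is Φ
∘ g⁻¹ (`covering_legendreDiff`), so the embedding property comes from Φ. There the point is that v
can be recovered smoothly from h and t v up to scale, even at t = 0, because the coefficient of u_i
in h is then inversely proportional to ⟨u_i, v⟩ (`exists_chart_eq`, `isEmbedding_Phi`).

For the standard projections, the coefficients of the gradient are ordered oppositely to the
barycentric coordinates, which identifies the interior of W̃ with the part of Ũ lying over the open
cone (`interior_Wtilde_eq`). To reach every covector τ in the cone, one maximizes Ψ - τ on a fibre: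
Ψ vanishes where the maximum must not be, and near the face it grows like ε^(|J|/(n+1)), faster than
linearly because |J| ≤ n (`exists_critical`). Over `p_k` itself the fibre is unbounded, but the
equations can be solved explicitly (`exists_critical_vertex`). -/

lemma contDiff_sinc : ContDiff ℝ ∞ Real.sinc := by
  rw [contDiff_iff_contDiffAt]
  intro x
  by_cases hx : x = 0
  · subst hx
    obtain ⟨q, hq⟩ := Real.analyticAt_sin (x := 0)
    rw [Real.sinc_eq_dslope]
    exact hq.has_fpower_series_dslope_fslope.analyticAt.contDiffAt
  · have h : ContDiffAt ℝ ∞ (fun y => Real.sin y / y) x :=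
      Real.contDiff_sin.contDiffAt.div contDiffAt_id hx
    refine h.congr_of_eventuallyEq ?_
    filter_upwards [isOpen_ne.mem_nhds hx] with y hy using Real.sinc_of_ne_zero hy

lemma sinc_pos {x : ℝ} (hx : |x| < Real.pi) : 0 < Real.sinc x := by
  by_cases h0 : x = 0
  · simp [h0]
  · rw [Real.sinc_of_ne_zero h0]
    rcases lt_or_gt_of_ne h0 with h | h
    · rw [abs_of_neg h] at hx
      exact div_pos_of_neg_of_neg (Real.sin_neg_of_neg_of_neg_pi_lt h (by linarith)) h
    · rw [abs_of_pos h] at hx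
      exact div_pos (Real.sin_pos_of_pos_of_lt_pi h hx) h

/-- The function `sin (t a) / t`, extended smoothly to `t = 0`. -/
def sinQuot (t a : ℝ) : ℝ := a * Real.sinc (t * a)

lemma mul_sinQuot (t a : ℝ) : t * sinQuot t a = Real.sin (t * a) := by
  unfold sinQuot
  by_cases h : t * a = 0
  · rw [h]
    rcases mul_eq_zero.1 h with h | h <;> simp [h]
  · rw [Real.sinc_of_ne_zero h]
    have := left_ne_zero_of_mul h
    have := right_ne_zero_of_mul h
    field_simp

lemma sinQuot_zero (a : ℝ) : sinQuot 0 a = a := by simp [sinQuot]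

lemma sinQuot_pos {t a : ℝ} (ha : 0 < a) (h : |t| * a < Real.pi) : 0 < sinQuot t a :=
  mul_pos ha (sinc_pos (by rwa [abs_mul, abs_of_pos ha]))

lemma contDiff_sinQuot : ContDiff ℝ ∞ fun q : ℝ × ℝ => sinQuot q.1 q.2 :=
  contDiff_snd.mul (contDiff_sinc.comp (contDiff_fst.mul contDiff_snd))

lemma hasDerivAt_sinQuot (t a : ℝ) : HasDerivAt (sinQuot t) (Real.cos (t * a)) a := by
  by_cases ht : t = 0
  · subst ht
    have : sinQuot 0 = id := funext sinQuot_zero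
    rw [this]
    simpa using hasDerivAt_id a
  · have : sinQuot t = fun a => Real.sin (t * a) / t := by
      funext a
      rw [← mul_sinQuot, mul_div_cancel_left₀ _ ht]
    rw [this]
    convert! ((Real.hasDerivAt_sin _).comp a ((hasDerivAt_id a).const_mul t)).div_const t using 1
    simp only [id]
    field_simp

/-- Negative definiteness of the Hessian of `log F + (∇ log F)²`, in terms of angles. -/
lemma sq_sum_cos_lt {ι : Type*} [Fintype ι] [Nonempty ι] {θ x : ι → ℝ} {d : ℝ}
    (hd : Fintype.card ι = d + 1)
    (h0 : ∀ i, 0 < θ i) (h1 : ∀ i, θ i < Real.pi / 2)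
    (hcard : ∃ i j : ι, i ≠ j)
    (hs : ∑ i, Real.sin (θ i) * x i = 0) (hx : x ≠ 0) :
    (∑ i, Real.cos (θ i) * x i) ^ 2 < d * ∑ i, x i ^ 2 := by
  classical
  set s := fun i => Real.sin (θ i) with hsdef
  set c := fun i => Real.cos (θ i) with hcdef
  have hspos : ∀ i, 0 < s i := fun i =>
    Real.sin_pos_of_pos_of_lt_pi (h0 i) (by linarith [h1 i, Real.pi_pos])
  set A := ∑ i, s i ^ 2 with hA
  set B := ∑ i, c i * s i with hB
  set Cc := ∑ i, c i ^ 2 with hC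
  have hAC : Cc + A = d + 1 := by
    rw [hC, hA, ← Finset.sum_add_distrib, ← hd]
    simp [hsdef, hcdef]
  have hApos : 0 < A := Finset.sum_pos (fun i _ => pow_pos (hspos i) 2) Finset.univ_nonempty
  -- A² + B² is the squared modulus of ∑ s_i e^{iθ_i}. Its expansion as a double sum has diagonal A,
  -- and the off-diagonal terms are positive because all angles lie in an open quadrant.
  have key : A < A ^ 2 + B ^ 2 := by
    have e : A ^ 2 + B ^ 2 = ∑ i, ∑ j, s i * s j * Real.cos (θ i - θ j) := by
      rw [hA, hB, pow_two, pow_two, Finset.sum_mul_sum, Finset.sum_mul_sum,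
        ← Finset.sum_add_distrib]
      refine Finset.sum_congr rfl fun i _ => ?_
      rw [← Finset.sum_add_distrib]
      refine Finset.sum_congr rfl fun j _ => ?_
      rw [Real.cos_sub]
      ring
    have hterm : ∀ i j, 0 < s i * s j * Real.cos (θ i - θ j) := fun i j =>
      mul_pos (mul_pos (hspos i) (hspos j)) (Real.cos_pos_of_mem_Ioo
        ⟨by linarith [h0 i, h1 j], by linarith [h1 i, h0 j]⟩)
    rw [e, hA]
    have hle : ∀ i, s i ^ 2 ≤ ∑ j, s i * s j * Real.cos (θ i - θ j) := by
      intro i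
      refine le_trans (le_of_eq ?_) (Finset.single_le_sum (fun j _ => (hterm i j).le)
        (Finset.mem_univ i))
      simp [pow_two]
    obtain ⟨i, j, hij⟩ := hcard
    refine Finset.sum_lt_sum (fun i _ => hle i) ⟨i, Finset.mem_univ i, ?_⟩
    have h2 := Finset.sum_le_sum_of_subset_of_nonneg (Finset.subset_univ {i, j})
      (f := fun j => s i * s j * Real.cos (θ i - θ j)) (fun j _ _ => (hterm i j).le)
    rw [Finset.sum_pair hij] at h2
    have h3 := hterm i j
    simp only [sub_self, Real.cos_zero, mul_one] at h2
    nlinarith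
  have hX : 0 < ∑ i, x i ^ 2 := by
    obtain ⟨i, hi⟩ := Function.ne_iff.1 hx
    exact Finset.sum_pos' (fun i _ => sq_nonneg _) ⟨i, Finset.mem_univ i, by
      have : x i ≠ 0 := hi
      positivity⟩
  -- As x is orthogonal to the sine vector, the cosine vector may be replaced by its component
  -- orthogonal to the sine vector; Cauchy–Schwarz with this shorter vector gives the strict bound.
  have h4 : (∑ i, c i * x i) = ∑ i, (c i - B / A * s i) * x i := by
    have hs' : ∑ i, s i * x i = 0 := hs
    simp only [sub_mul, Finset.sum_sub_distrib, mul_assoc, ← Finset.mul_sum, hs', mul_zero, sub_zero]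
  have h5 : ∑ i, (c i - B / A * s i) ^ 2 = Cc - B ^ 2 / A := by
    have : ∀ i, (c i - B / A * s i) ^ 2 = c i ^ 2 - 2 * (B / A) * (c i * s i)
        + (B / A) ^ 2 * s i ^ 2 := fun i => by ring
    simp only [this, Finset.sum_add_distrib, Finset.sum_sub_distrib, ← Finset.mul_sum]
    rw [← hA, ← hB, ← hC]
    field_simp
    ring
  have h6 : Cc - B ^ 2 / A < d := by
    have : 1 < A + B ^ 2 / A := by
      rw [← sub_pos]
      have : A + B ^ 2 / A - 1 = (A ^ 2 + B ^ 2 - A) / A := by field_simp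
      rw [this]
      exact div_pos (by linarith) hApos
    linarith
  calc (∑ i, c i * x i) ^ 2 ≤ (∑ i, (c i - B / A * s i) ^ 2) * ∑ i, x i ^ 2 := by
        rw [h4]
        exact Finset.sum_mul_sq_le_sq_mul_sq _ _ _
    _ < d * ∑ i, x i ^ 2 := by
        rw [h5]
        exact mul_lt_mul_of_pos_right h6 hX

end

/-! ### Polar domains, the factors of F, and the first and second derivatives of Ψ -/

section

variable {n : ℕ}

lemma dot_u_succ (j : Fin (n + 1)) (v : NR n) : u n j.succ ⬝ᵥ v = v j := by
  simp [u]

lemma sum_dot_u (v : NR n) : ∑ i, u n i ⬝ᵥ v = 0 := by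
  rw [← sum_dotProduct, sum_u, zero_dotProduct]

lemma dot_u_eq_neg_sum (k : Fin (n + 2)) (v : NR n) :
    u n k ⬝ᵥ v = -∑ i ∈ Finset.univ.erase k, u n i ⬝ᵥ v := by
  have := Finset.add_sum_erase Finset.univ (fun i => u n i ⬝ᵥ v) (Finset.mem_univ k)
  rw [sum_dot_u] at this
  linarith

lemma eq_of_dot_u {k : Fin (n + 2)} {v w : NR n} (h : ∀ i, i ≠ k → u n i ⬝ᵥ v = u n i ⬝ᵥ w) :
    v = w := by
  have h' : ∀ i, u n i ⬝ᵥ v = u n i ⬝ᵥ w := by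
    intro i
    by_cases hi : i = k
    · subst hi
      rw [dot_u_eq_neg_sum, dot_u_eq_neg_sum]
      congr 1
      exact Finset.sum_congr rfl fun j hj => h j (Finset.ne_of_mem_erase hj)
    · exact h i hi
  funext j
  rw [← dot_u_succ j v, ← dot_u_succ j w, h']

/-- The pairs `(v, t)`, with `v` a vector at `p_k` pointing into the face `E_J⁺` (if `v` is tangent
to it) and `p_k + |t| v` not beyond the opposite facet. -/
def polarDomain (J : Face n) (k : Fin (n + 2)) : Set (NR n × ℝ) :=
  {q | (∀ i, i ∉ J.1 → i ≠ k → 0 < u n i ⬝ᵥ q.1) ∧ |q.2| * radius k q.1 < 1}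

lemma contDiff_dot_u (i : Fin (n + 2)) : ContDiff ℝ ∞ fun v : NR n => u n i ⬝ᵥ v := by
  unfold dotProduct
  fun_prop

lemma isOpen_polarDomain (J : Face n) (k : Fin (n + 2)) : IsOpen (polarDomain J k) := by
  have hc : ∀ i, Continuous fun q : NR n × ℝ => u n i ⬝ᵥ q.1 := fun i =>
    (contDiff_dot_u i).continuous.comp continuous_fst
  have : polarDomain J k = (⋂ i, ⋂ (_ : i ∉ J.1), ⋂ (_ : i ≠ k),
      {q : NR n × ℝ | 0 < u n i ⬝ᵥ q.1}) ∩ {q | |q.2| * radius k q.1 < 1} := by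
    ext q
    simp [polarDomain]
  rw [this]
  refine IsOpen.inter ?_ (isOpen_lt (continuous_snd.abs.mul
    ((contDiff_radius k).continuous.comp continuous_fst)) continuous_const)
  exact isOpen_iInter_of_finite fun i => isOpen_iInter_of_finite fun _ =>
    isOpen_iInter_of_finite fun _ => isOpen_lt continuous_const (hc i)

lemma dot_pos_of_mem {k i : Fin (n + 2)} {v : NR n} {t : ℝ} (h : (v, t) ∈ polarDomain (whole n) k)
    (hi : i ≠ k) : 0 < u n i ⬝ᵥ v :=
  h.1 i (Finset.notMem_empty i) hi

lemma dot_vertex_neg {k : Fin (n + 2)} {v : NR n} {t : ℝ}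
    (h : (v, t) ∈ polarDomain (whole n) k) : u n k ⬝ᵥ v < 0 := by
  rw [dot_u_eq_neg_sum, neg_lt_zero]
  refine Finset.sum_pos (fun i hi => dot_pos_of_mem h (Finset.ne_of_mem_erase hi)) ?_
  rw [← Finset.card_pos, Finset.card_erase_of_mem (Finset.mem_univ k), Finset.card_univ,
    Fintype.card_fin]
  omega

lemma abs_mul_dot_vertex_lt {k : Fin (n + 2)} {v : NR n} {t : ℝ}
    (h : (v, t) ∈ polarDomain (whole n) k) : |t| * -(u n k ⬝ᵥ v) < Real.pi / 2 := by
  have h1 : |t| * radius k v < 1 := h.2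
  have := Real.pi_pos
  have e : |t| * radius k v = |t| * -(u n k ⬝ᵥ v) * (2 / Real.pi) := by
    rw [radius]
    ring
  rw [e, ← lt_div_iff₀ (by positivity)] at h1
  simpa using h1

lemma dot_le_neg_dot_vertex {k i : Fin (n + 2)} {v : NR n} {t : ℝ}
    (h : (v, t) ∈ polarDomain (whole n) k) (hi : i ≠ k) : u n i ⬝ᵥ v ≤ -(u n k ⬝ᵥ v) := by
  rw [dot_u_eq_neg_sum k, neg_neg]
  exact Finset.single_le_sum (f := fun i => u n i ⬝ᵥ v)
    (fun j hj => (dot_pos_of_mem h (Finset.ne_of_mem_erase hj)).le)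
    (Finset.mem_erase.2 ⟨hi, Finset.mem_univ i⟩)

/-- Since the u_i sum to zero, the angle at the vertex k dominates all the others, so the single
bound on `radius` in `polarDomain` controls every angle. -/
lemma abs_mul_dot_lt {k i : Fin (n + 2)} {v : NR n} {t : ℝ}
    (h : (v, t) ∈ polarDomain (whole n) k) (hi : i ≠ k) : |t| * (u n i ⬝ᵥ v) < Real.pi / 2 :=
  (mul_le_mul_of_nonneg_left (dot_le_neg_dot_vertex h hi) (abs_nonneg t)).trans_lt
    (abs_mul_dot_vertex_lt h)

/-- The factors of the product `F^{n+1}` at `p_k + t v`, those other than `i = k` divided by `t`. -/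
def factor (k i : Fin (n + 2)) (t a : ℝ) : ℝ :=
  if i = k then Real.cos (t * a) else sinQuot t a

/-- The logarithmic derivatives of the factors. -/
def logDer (k i : Fin (n + 2)) (t a : ℝ) : ℝ :=
  if i = k then -(t * (Real.sin (t * a) / Real.cos (t * a))) else Real.cos (t * a) / sinQuot t a

/-- The negatives of the second logarithmic derivatives of the factors are squares of these. -/
def curvRoot (k i : Fin (n + 2)) (t a : ℝ) : ℝ :=
  if i = k then t / Real.cos (t * a) else 1 / sinQuot t a

/-- All angles have absolute value less than π/2, where cosine and sinc are positive; the sign of t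
plays no role. -/
lemma factor_pos {k : Fin (n + 2)} {v : NR n} {t : ℝ} (h : (v, t) ∈ polarDomain (whole n) k)
    (i : Fin (n + 2)) : 0 < factor k i t (u n i ⬝ᵥ v) := by
  unfold factor
  have := Real.pi_pos
  split_ifs with hi
  · subst hi
    rw [← Real.cos_abs, abs_mul, abs_of_neg (dot_vertex_neg h)]
    refine Real.cos_pos_of_mem_Ioo ⟨?_, abs_mul_dot_vertex_lt h⟩
    have : 0 ≤ |t| * -(u n i ⬝ᵥ v) :=
      mul_nonneg (abs_nonneg t) (neg_nonneg.2 (dot_vertex_neg h).le)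
    linarith
  · exact sinQuot_pos (dot_pos_of_mem h hi) (by linarith [abs_mul_dot_lt h hi])

lemma contDiff_factor (k i : Fin (n + 2)) :
    ContDiff ℝ ∞ fun q : NR n × ℝ => factor k i q.2 (u n i ⬝ᵥ q.1) := by
  unfold factor
  have ha : ContDiff ℝ ∞ fun q : NR n × ℝ => u n i ⬝ᵥ q.1 := (contDiff_dot_u i).comp contDiff_fst
  split_ifs
  · exact Real.contDiff_cos.comp (contDiff_snd.mul ha)
  · exact contDiff_sinQuot.comp (contDiff_snd.prodMk ha)

lemma hasDerivAt_factor (k i : Fin (n + 2)) {t a : ℝ} (h : factor k i t a ≠ 0) :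
    HasDerivAt (factor k i t) (factor k i t a * logDer k i t a) a := by
  unfold factor at h ⊢
  unfold logDer
  by_cases hi : i = k
  · simp only [hi, if_true] at h ⊢
    convert! (Real.hasDerivAt_cos _).comp a ((hasDerivAt_id a).const_mul t) using 1
    simp only [id]
    field_simp
  · simp only [hi, if_false] at h ⊢
    convert! hasDerivAt_sinQuot t a using 1
    field_simp

/-- Every factor is log-concave: by sin² + cos² = 1, the second logarithmic derivative is -t²/cos²
for the vertex factor and -1/`sinQuot`² for the others. -/
lemma hasDerivAt_logDer (k i : Fin (n + 2)) {t a : ℝ} (h : factor k i t a ≠ 0) :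
    HasDerivAt (logDer k i t) (-(curvRoot k i t a) ^ 2) a := by
  unfold factor at h
  unfold logDer curvRoot
  have hc := (Real.hasDerivAt_cos _).comp a ((hasDerivAt_id a).const_mul t)
  have hs := (Real.hasDerivAt_sin _).comp a ((hasDerivAt_id a).const_mul t)
  have h1 := Real.sin_sq_add_cos_sq (t * a)
  by_cases hi : i = k
  · simp only [hi, if_true] at h ⊢
    convert! ((hs.div hc h).const_mul t).neg using 1
    simp only [id, Function.comp]
    field_simp
    linear_combination t ^ 2 * h1
  · simp only [hi, if_false] at h ⊢
    convert! hc.div (hasDerivAt_sinQuot t a) h using 1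
    simp only [id, Function.comp]
    -- Writing the sine as t times `sinQuot` avoids dividing by t, so that t = 0 needs no separate
    -- case.
    rw [← mul_sinQuot] at h1 ⊢
    field_simp
    linear_combination h1

/-- The function with `F (p_k + t v) = t Ψ (v, t)`. -/
def Psi (k : Fin (n + 2)) (v : NR n) (t : ℝ) : ℝ :=
  (∏ i, factor k i t (u n i ⬝ᵥ v)) ^ (1 / ((n : ℝ) + 1))

/-- The coefficients of the gradient of `F` at `p_k + t v` with respect to the vectors `u_i`. -/
def gradCoeff (k : Fin (n + 2)) (v : NR n) (t : ℝ) (i : Fin (n + 2)) : ℝ :=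
  Psi k v t / ((n : ℝ) + 1) * logDer k i t (u n i ⬝ᵥ v)

/-- The gradient of `F` at `p_k + t v`. -/
def gradVec (k : Fin (n + 2)) (v : NR n) (t : ℝ) : MR n := ∑ i, gradCoeff k v t i • u n i

lemma gradVec_dot (k : Fin (n + 2)) (v : NR n) (t : ℝ) (ξ : NR n) :
    gradVec k v t ⬝ᵥ ξ =
      Psi k v t / ((n : ℝ) + 1) * ∑ i, logDer k i t (u n i ⬝ᵥ v) * (u n i ⬝ᵥ ξ) := by
  rw [gradVec, sum_dotProduct, Finset.mul_sum]
  refine Finset.sum_congr rfl fun i _ => ?_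
  rw [smul_dotProduct, smul_eq_mul, gradCoeff, mul_assoc]

lemma Psi_pos {k : Fin (n + 2)} {v : NR n} {t : ℝ} (h : (v, t) ∈ polarDomain (whole n) k) :
    0 < Psi k v t :=
  Real.rpow_pos_of_pos (Finset.prod_pos fun i _ => factor_pos h i) _

lemma Psi_pow {k : Fin (n + 2)} {v : NR n} {t : ℝ}
    (h : 0 ≤ ∏ i, factor k i t (u n i ⬝ᵥ v)) :
    Psi k v t ^ (n + 1) = ∏ i, factor k i t (u n i ⬝ᵥ v) := by
  rw [Psi, ← Real.rpow_natCast, ← Real.rpow_mul h]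
  push_cast
  rw [one_div_mul_cancel (by positivity), Real.rpow_one]

lemma contDiffOn_Psi (k : Fin (n + 2)) :
    ContDiffOn ℝ ∞ (fun q : NR n × ℝ => Psi k q.1 q.2) (polarDomain (whole n) k) := by
  unfold Psi
  refine ContDiffOn.rpow_const_of_ne
    (contDiff_prod fun i _ => contDiff_factor k i).contDiffOn ?_
  intro q hq
  exact (Finset.prod_pos fun i _ => factor_pos (v := q.1) (t := q.2) hq i).ne'

lemma contDiffOn_logDer (k i : Fin (n + 2)) :
    ContDiffOn ℝ ∞ (fun q : NR n × ℝ => logDer k i q.2 (u n i ⬝ᵥ q.1))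
      (polarDomain (whole n) k) := by
  have ha : ContDiff ℝ ∞ fun q : NR n × ℝ => u n i ⬝ᵥ q.1 := (contDiff_dot_u i).comp contDiff_fst
  have hf : ∀ q ∈ polarDomain (whole n) k, factor k i q.2 (u n i ⬝ᵥ q.1) ≠ 0 := fun q hq =>
    (factor_pos (v := q.1) (t := q.2) hq i).ne'
  unfold factor at hf
  unfold logDer
  split_ifs with hi
  · simp only [hi, if_true] at hf
    refine (contDiff_snd.contDiffOn.mul (ContDiffOn.div
      (Real.contDiff_sin.comp (contDiff_snd.mul ha)).contDiffOn
      (Real.contDiff_cos.comp (contDiff_snd.mul ha)).contDiffOn ?_)).neg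
    subst hi
    exact hf
  · simp only [hi, if_false] at hf
    exact ContDiffOn.div (Real.contDiff_cos.comp (contDiff_snd.mul ha)).contDiffOn
      (contDiff_sinQuot.comp (contDiff_snd.prodMk ha)).contDiffOn hf

lemma contDiffOn_gradCoeff (k i : Fin (n + 2)) :
    ContDiffOn ℝ ∞ (fun q : NR n × ℝ => gradCoeff k q.1 q.2 i) (polarDomain (whole n) k) :=
  ((contDiffOn_Psi k).div_const _).mul (contDiffOn_logDer k i)

lemma contDiffOn_gradVec (k : Fin (n + 2)) :
    ContDiffOn ℝ ∞ (fun q : NR n × ℝ => gradVec k q.1 q.2) (polarDomain (whole n) k) :=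
  ContDiffOn.sum fun i _ => (contDiffOn_gradCoeff k i).smul contDiffOn_const

lemma hasDerivAt_dot_line (i : Fin (n + 2)) (v ξ : NR n) (s : ℝ) :
    HasDerivAt (fun s : ℝ => u n i ⬝ᵥ (v + s • ξ)) (u n i ⬝ᵥ ξ) s := by
  simp only [dotProduct_add, dotProduct_smul, smul_eq_mul]
  simpa using ((hasDerivAt_id s).mul_const (u n i ⬝ᵥ ξ)).const_add (u n i ⬝ᵥ v)

/-- Logarithmic differentiation, with t fixed and possibly zero. It shows that `gradVec` is the
gradient of Ψ(·, t). -/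
lemma hasDerivAt_Psi_line {k : Fin (n + 2)} {v ξ : NR n} {t s : ℝ}
    (h : (v + s • ξ, t) ∈ polarDomain (whole n) k) :
    HasDerivAt (fun s : ℝ => Psi k (v + s • ξ) t) (gradVec k (v + s • ξ) t ⬝ᵥ ξ) s := by
  have hpos : ∀ i, 0 < factor k i t (u n i ⬝ᵥ (v + s • ξ)) := factor_pos h
  have hlog : HasDerivAt (fun s : ℝ => Real.exp ((1 / ((n : ℝ) + 1)) *
      ∑ i, Real.log (factor k i t (u n i ⬝ᵥ (v + s • ξ)))))
      (Psi k (v + s • ξ) t * ((1 / ((n : ℝ) + 1)) *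
        ∑ i, logDer k i t (u n i ⬝ᵥ (v + s • ξ)) * (u n i ⬝ᵥ ξ))) s := by
    have e : Psi k (v + s • ξ) t = Real.exp ((1 / ((n : ℝ) + 1)) *
      ∑ i, Real.log (factor k i t (u n i ⬝ᵥ (v + s • ξ)))) := by
      rw [Psi, Real.rpow_def_of_pos (Finset.prod_pos fun i _ => hpos i),
        Real.log_prod fun i _ => (hpos i).ne', mul_comm]
    rw [e]
    refine (HasDerivAt.const_mul _ (HasDerivAt.fun_sum fun i _ => ?_)).exp
    have hc : HasDerivAt (factor k i t ∘ fun s : ℝ => u n i ⬝ᵥ (v + s • ξ)) _ s :=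
      (hasDerivAt_factor k i (hpos i).ne').comp s (hasDerivAt_dot_line i v ξ s)
    convert! hc.log (hpos i).ne' using 1
    have := (hpos i).ne'
    simp only [Function.comp]
    field_simp
  have e2 : gradVec k (v + s • ξ) t ⬝ᵥ ξ = Psi k (v + s • ξ) t * ((1 / ((n : ℝ) + 1)) *
        ∑ i, logDer k i t (u n i ⬝ᵥ (v + s • ξ)) * (u n i ⬝ᵥ ξ)) := by
    rw [gradVec_dot]
    ring
  rw [e2]
  refine hlog.congr_of_eventuallyEq ?_
  have hc : Continuous fun s : ℝ => (v + s • ξ, t) := by fun_prop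
  filter_upwards [hc.continuousAt.preimage_mem_nhds ((isOpen_polarDomain _ k).mem_nhds h)]
    with s hs
  have hpos : ∀ i, 0 < factor k i t (u n i ⬝ᵥ (v + s • ξ)) := factor_pos hs
  rw [Psi, Real.rpow_def_of_pos (Finset.prod_pos fun i _ => hpos i),
    Real.log_prod fun i _ => (hpos i).ne', mul_comm]

/-- The second derivative of `Ψ (·, t)` at `v` in the direction `ξ`. -/
def hessian (k : Fin (n + 2)) (v : NR n) (t : ℝ) (ξ : NR n) : ℝ :=
  Psi k v t / ((n : ℝ) + 1) * ((∑ i, logDer k i t (u n i ⬝ᵥ v) * (u n i ⬝ᵥ ξ)) ^ 2 / ((n : ℝ) + 1)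
    - ∑ i, (curvRoot k i t (u n i ⬝ᵥ v) * (u n i ⬝ᵥ ξ)) ^ 2)

/-- With ℓ = log Ψ, the second derivative of Ψ along a line is Ψ (ℓ'² + ℓ''). -/
lemma hasDerivAt_gradVec_line {k : Fin (n + 2)} {v ξ : NR n} {t s : ℝ}
    (h : (v + s • ξ, t) ∈ polarDomain (whole n) k) :
    HasDerivAt (fun s : ℝ => gradVec k (v + s • ξ) t ⬝ᵥ ξ) (hessian k (v + s • ξ) t ξ) s := by
  have h1 : HasDerivAt (fun s : ℝ => ∑ i, logDer k i t (u n i ⬝ᵥ (v + s • ξ)) * (u n i ⬝ᵥ ξ))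
      (∑ i, (-(curvRoot k i t (u n i ⬝ᵥ (v + s • ξ))) ^ 2 * (u n i ⬝ᵥ ξ)) * (u n i ⬝ᵥ ξ)) s :=
    HasDerivAt.fun_sum fun i _ => HasDerivAt.mul_const
      ((hasDerivAt_logDer k i (factor_pos h i).ne').comp s (hasDerivAt_dot_line i v ξ s)) _
  simp only [gradVec_dot]
  convert! ((hasDerivAt_Psi_line h).div_const _).mul h1 using 1
  rw [hessian, gradVec_dot]
  have : ∀ i, (-(curvRoot k i t (u n i ⬝ᵥ (v + s • ξ))) ^ 2 * (u n i ⬝ᵥ ξ)) * (u n i ⬝ᵥ ξ)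
      = -(curvRoot k i t (u n i ⬝ᵥ (v + s • ξ)) * (u n i ⬝ᵥ ξ)) ^ 2 := fun i => by ring
  simp only [this, Finset.sum_neg_distrib]
  ring

end

/-! ### Concavity of Ψ in the vector variable -/

section

variable {n : ℕ}

/-- This is `sq_sum_cos_lt` for the n + 2 angles |t|⟨u_i, v⟩, the one at the vertex being shifted by
π/2 to turn its cosine into a sine. The linear constraint there becomes ∑ ⟨u_i, ξ⟩ = 0. -/
lemma sum_logDer_sq_lt_of_ne_zero {k : Fin (n + 2)} {v ξ : NR n} {t : ℝ}
    (h : (v, t) ∈ polarDomain (whole n) k) (hξ : ξ ≠ 0) (ht : t ≠ 0) :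
    (∑ i, logDer k i t (u n i ⬝ᵥ v) * (u n i ⬝ᵥ ξ)) ^ 2 <
      ((n : ℝ) + 1) * ∑ i, (curvRoot k i t (u n i ⬝ᵥ v) * (u n i ⬝ᵥ ξ)) ^ 2 := by
  have hpi := Real.pi_pos
  have hat : 0 < |t| := abs_pos.2 ht
  set θ : Fin (n + 2) → ℝ := fun i => (if i = k then Real.pi / 2 else 0) + |t| * (u n i ⬝ᵥ v)
    with hθ
  -- Up to sign, x_i is `curvRoot` times ⟨u_i, ξ⟩, and multiplying it by cos θ_i gives the
  -- logarithmic derivative term.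
  set x : Fin (n + 2) → ℝ := fun i => |t| * (u n i ⬝ᵥ ξ) / Real.sin (θ i) with hx
  have h0 : ∀ i, 0 < θ i := by
    intro i
    by_cases hi : i = k
    · subst hi
      have := abs_mul_dot_vertex_lt h
      simp only [hθ, if_true]
      linarith
    · simp only [hθ, hi, if_false, zero_add]
      exact mul_pos hat (dot_pos_of_mem h hi)
  have h1 : ∀ i, θ i < Real.pi / 2 := by
    intro i
    by_cases hi : i = k
    · subst hi
      have := mul_neg_of_pos_of_neg hat (dot_vertex_neg h)
      simp only [hθ, if_true]
      linarith
    · simp only [hθ, hi, if_false, zero_add]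
      exact abs_mul_dot_lt h hi
  have hsin : ∀ i, Real.sin (θ i) ≠ 0 := fun i =>
    (Real.sin_pos_of_pos_of_lt_pi (h0 i) (by linarith [h1 i])).ne'
  have hsq : ∀ i, x i ^ 2 = (curvRoot k i t (u n i ⬝ᵥ v) * (u n i ⬝ᵥ ξ)) ^ 2 := by
    intro i
    have hs := hsin i
    rcases abs_choice t with ht' | ht' <;> by_cases hi : i = k <;>
    simp only [hx, hθ, curvRoot, hi, if_true, if_false, zero_add, ht', neg_mul, 
      Real.sin_neg, add_comm (Real.pi / 2), Real.sin_add_pi_div_two, Real.cos_neg, ← mul_sinQuot] at hs ⊢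
    · ring
    · have := right_ne_zero_of_mul hs
      field_simp
    · ring
    · rw [neg_ne_zero] at hs
      have := right_ne_zero_of_mul hs
      field_simp
  have hcos : ∀ i, Real.cos (θ i) * x i = logDer k i t (u n i ⬝ᵥ v) * (u n i ⬝ᵥ ξ) := by
    intro i
    have hs := hsin i
    rcases abs_choice t with ht' | ht' <;> by_cases hi : i = k <;>
    simp only [hx, hθ, logDer, hi, if_true, if_false, zero_add, ht', neg_mul, Real.sin_neg,
      add_comm (Real.pi / 2), Real.sin_add_pi_div_two, Real.cos_add_pi_div_two,
      Real.cos_neg, ← mul_sinQuot] at hs ⊢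
    · ring
    · have := right_ne_zero_of_mul hs
      field_simp
    · ring
    · rw [neg_ne_zero] at hs
      have := right_ne_zero_of_mul hs
      field_simp
  have hsum : ∑ i, Real.sin (θ i) * x i = 0 := by
    have : ∀ i, Real.sin (θ i) * x i = |t| * (u n i ⬝ᵥ ξ) := fun i => mul_div_cancel₀ _ (hsin i)
    simp only [this, ← Finset.mul_sum, sum_dot_u, mul_zero]
  have hxne : x ≠ 0 := by
    intro h
    refine hξ (eq_of_dot_u (k := k) fun i _ => ?_)
    have := congrFun h i
    simp only [hx, Pi.zero_apply, div_eq_zero_iff, hsin i, or_false, mul_eq_zero, hat.ne',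
      false_or] at this
    simpa using this
  have := sq_sum_cos_lt (d := (n : ℝ) + 1) (by simp; ring) h0 h1
    ⟨0, 1, by simp⟩ hsum hxne
  simpa only [hsq, hcos] using this

/-- At t = 0 the vertex factor drops out and the other logarithmic derivatives are 1/⟨u_i, v⟩. What
remains is the Cauchy–Schwarz inequality for the n + 1 quotients ⟨u_i, ξ⟩/⟨u_i, v⟩; equality would
make them all equal, that is, ξ a multiple of v. -/
lemma sum_logDer_sq_lt_of_eq_zero {k : Fin (n + 2)} {v ξ : NR n}
    (h : (v, (0 : ℝ)) ∈ polarDomain (whole n) k) (hξ : ∀ c : ℝ, ξ ≠ c • v) :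
    (∑ i, logDer k i 0 (u n i ⬝ᵥ v) * (u n i ⬝ᵥ ξ)) ^ 2 <
      ((n : ℝ) + 1) * ∑ i, (curvRoot k i 0 (u n i ⬝ᵥ v) * (u n i ⬝ᵥ ξ)) ^ 2 := by
  set z : Fin (n + 2) → ℝ := fun i => (u n i ⬝ᵥ ξ) / (u n i ⬝ᵥ v) with hz
  have e1 : ∑ i, logDer k i 0 (u n i ⬝ᵥ v) * (u n i ⬝ᵥ ξ) = ∑ i ∈ Finset.univ.erase k, z i := by
    rw [← Finset.add_sum_erase _ _ (Finset.mem_univ k)]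
    simp only [logDer, if_true, zero_mul, neg_zero, zero_add]
    refine Finset.sum_congr rfl fun i hi => ?_
    rw [if_neg (Finset.ne_of_mem_erase hi)]
    simp [hz, sinQuot_zero]
    ring
  have e2 : ∑ i, (curvRoot k i 0 (u n i ⬝ᵥ v) * (u n i ⬝ᵥ ξ)) ^ 2
      = ∑ i ∈ Finset.univ.erase k, z i ^ 2 := by
    rw [← Finset.add_sum_erase _ _ (Finset.mem_univ k)]
    simp only [curvRoot, if_true, zero_div, zero_mul, zero_add, ne_eq, OfNat.ofNat_ne_zero,
      not_false_eq_true, zero_pow]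
    refine Finset.sum_congr rfl fun i hi => ?_
    rw [if_neg (Finset.ne_of_mem_erase hi)]
    simp [hz, sinQuot_zero]
    ring
  rw [e1, e2]
  set s := Finset.univ.erase k with hs
  have hcard : (s.card : ℝ) = n + 1 := by
    rw [hs, Finset.card_erase_of_mem (Finset.mem_univ k), Finset.card_univ, Fintype.card_fin]
    push_cast
    simp
  set m : ℝ := (∑ i ∈ s, z i) / (n + 1) with hm
  have hvar : ∑ i ∈ s, (z i - m) ^ 2 = ∑ i ∈ s, z i ^ 2 - (∑ i ∈ s, z i) ^ 2 / (n + 1) := by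
    have : ∀ i, (z i - m) ^ 2 = z i ^ 2 - 2 * m * z i + m ^ 2 := fun i => by ring
    simp only [this, Finset.sum_add_distrib, Finset.sum_sub_distrib, ← Finset.mul_sum,
      Finset.sum_const, nsmul_eq_mul, hcard]
    rw [hm]
    field_simp
    ring
  have hpos : 0 < ∑ i ∈ s, (z i - m) ^ 2 := by
    by_contra! hle
    have h0 := (Finset.sum_eq_zero_iff_of_nonneg fun i _ => sq_nonneg (z i - m)).1
      (le_antisymm hle (Finset.sum_nonneg fun i _ => sq_nonneg _))
    refine hξ m (eq_of_dot_u (k := k) fun i hi => ?_)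
    have h1 := h0 i (Finset.mem_erase.2 ⟨hi, Finset.mem_univ i⟩)
    have h2 : z i = m := by
      rw [sq_eq_zero_iff] at h1
      linarith
    rw [dotProduct_smul, smul_eq_mul, ← h2, hz]
    exact (div_mul_cancel₀ _ (dot_pos_of_mem h hi).ne').symm
  rw [hvar, sub_pos, div_lt_iff₀ (by positivity)] at hpos
  linarith

/-- The function `Ψ (·, t)` is strictly concave, except that for `t = 0` it is linear on rays. -/
lemma hessian_neg {k : Fin (n + 2)} {v ξ : NR n} {t : ℝ}
    (h : (v, t) ∈ polarDomain (whole n) k) (hξ : ξ ≠ 0) (hξ' : ∀ c : ℝ, ξ ≠ c • v) :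
    hessian k v t ξ < 0 := by
  have hn : (0 : ℝ) < n + 1 := by positivity
  refine mul_neg_of_pos_of_neg (div_pos (Psi_pos h) hn) ?_
  rw [sub_neg, div_lt_iff₀ hn, mul_comm]
  by_cases ht : t = 0
  · subst ht
    exact sum_logDer_sq_lt_of_eq_zero h hξ'
  · exact sum_logDer_sq_lt_of_ne_zero h hξ ht

lemma polarDomain_convex (J : Face n) (k : Fin (n + 2)) (t : ℝ) :
    Convex ℝ {v | (v, t) ∈ polarDomain J k} := by
  intro v hv w hw a b ha hb hab
  have hr : radius k (a • v + b • w) = a * radius k v + b * radius k w := by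
    simp only [radius, dotProduct_add, dotProduct_smul, smul_eq_mul]
    ring
  refine ⟨fun i hi hik => ?_, ?_⟩
  · have h1 := hv.1 i hi hik
    have h2 := hw.1 i hi hik
    simp only [dotProduct_add, dotProduct_smul, smul_eq_mul] at h1 h2 ⊢
    rcases ha.eq_or_lt with rfl | ha
    · rw [zero_add] at hab
      simpa [hab] using h2
    · exact add_pos_of_pos_of_nonneg (mul_pos ha h1) (mul_nonneg hb h2.le)
  · have h1 := hv.2
    have h2 := hw.2
    simp only [hr] at h1 h2 ⊢
    have e : |t| * (a * radius k v + b * radius k w)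
      = a * (|t| * radius k v) + b * (|t| * radius k w) := by ring
    rw [e]
    rcases ha.eq_or_lt with rfl | ha
    · rw [zero_add] at hab
      simpa [hab] using h2
    · nlinarith

/-- Strict monotonicity of the gradient along segments not contained in rays. -/
lemma gradVec_dot_lt {k : Fin (n + 2)} {v ξ : NR n} {t : ℝ}
    (h0 : (v, t) ∈ polarDomain (whole n) k) (h1 : (v + ξ, t) ∈ polarDomain (whole n) k)
    (hξ : ∀ c : ℝ, ξ ≠ c • v) :
    gradVec k (v + ξ) t ⬝ᵥ ξ < gradVec k v t ⬝ᵥ ξ := by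
  have hmem : ∀ s ∈ Icc (0 : ℝ) 1, (v + s • ξ, t) ∈ polarDomain (whole n) k := by
    intro s hs
    have := polarDomain_convex (whole n) k t h0 h1 (sub_nonneg.2 hs.2) hs.1 (by ring)
    have e : (1 - s) • v + s • (v + ξ) = v + s • ξ := by
      rw [smul_add, sub_smul, one_smul]
      abel
    rwa [e] at this
  have hξ0 : ξ ≠ 0 := by simpa using hξ 0
  have := strictAntiOn_of_deriv_neg (convex_Icc (0 : ℝ) 1)
    (f := fun s : ℝ => gradVec k (v + s • ξ) t ⬝ᵥ ξ)
    (fun s hs => (hasDerivAt_gradVec_line (hmem s hs)).continuousAt.continuousWithinAt)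
    (fun s hs => by
      rw [interior_Icc] at hs
      rw [(hasDerivAt_gradVec_line (hmem s (Ioo_subset_Icc_self hs))).deriv]
      refine hessian_neg (hmem s (Ioo_subset_Icc_self hs)) hξ0 fun c hc => ?_
      -- If ξ were a multiple c of the moving point v + s ξ, then (1 - c s) ξ = c v. Either 1 - c s
      -- = 0, which forces v = 0, or ξ is a multiple of v; both are excluded.
      by_cases h : 1 - c * s = 0
      · have h2 : c • v = (1 - c * s) • ξ := by
          rw [sub_smul, one_smul, mul_smul, eq_sub_iff_add_eq, ← smul_add]
          exact hc.symm
        rw [h, zero_smul] at h2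
        have hcne : c ≠ 0 := fun hc => by simp [hc] at h
        have hv := (smul_eq_zero.1 h2).resolve_left hcne
        have := dot_vertex_neg h0
        simp [hv] at this
      · refine hξ ((1 - c * s)⁻¹ * c) ?_
        rw [mul_smul, eq_inv_smul_iff₀ h, sub_smul, one_smul, mul_smul, sub_eq_iff_eq_add,
          ← smul_add]
        exact hc)
    (left_mem_Icc.2 zero_le_one) (right_mem_Icc.2 zero_le_one) one_pos
  simpa using this

end

section

variable {n : ℕ}

/-! ### Rescaling and reflection -/

/-- The pairs (v, t) and (c v, t/c) describe the same point p_k + t v. The scaling rules that follow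
make Ψ and its gradient compatible with this redundancy. -/
lemma polarDomain_smul {J : Face n} {k : Fin (n + 2)} {v : NR n} {t c : ℝ} (hc : 0 < c)
    (h : (v, t) ∈ polarDomain J k) : (c • v, c⁻¹ * t) ∈ polarDomain J k := by
  refine ⟨fun i hi hik => ?_, ?_⟩
  · simp only [dotProduct_smul]
    exact mul_pos hc (h.1 i hi hik)
  · have := h.2
    simp only [radius_smul, abs_mul, abs_inv, abs_of_pos hc] at this ⊢
    have e : c⁻¹ * |t| * (c * radius k v) = |t| * radius k v := by field_simp
    rwa [e]

lemma polarDomain_neg {J : Face n} {k : Fin (n + 2)} {v : NR n} {t : ℝ} :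
    (v, -t) ∈ polarDomain J k ↔ (v, t) ∈ polarDomain J k := by
  simp [polarDomain]

lemma sinQuot_smul {c : ℝ} (hc : c ≠ 0) (t a : ℝ) :
    sinQuot (c⁻¹ * t) (c * a) = c * sinQuot t a := by
  unfold sinQuot
  rw [show c⁻¹ * t * (c * a) = t * a by field_simp]
  ring

lemma sinQuot_neg (t a : ℝ) : sinQuot (-t) a = sinQuot t a := by
  simp [sinQuot]

lemma factor_smul (k i : Fin (n + 2)) {c : ℝ} (hc : c ≠ 0) (t a : ℝ) :
    factor k i (c⁻¹ * t) (c * a) = (if i = k then 1 else c) * factor k i t a := by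
  unfold factor
  split_ifs
  · rw [show c⁻¹ * t * (c * a) = t * a by field_simp, one_mul]
  · exact sinQuot_smul hc t a

lemma factor_neg (k i : Fin (n + 2)) (t a : ℝ) : factor k i (-t) a = factor k i t a := by
  simp [factor, sinQuot_neg]

lemma logDer_smul (k i : Fin (n + 2)) {c : ℝ} (hc : c ≠ 0) (t a : ℝ) :
    logDer k i (c⁻¹ * t) (c * a) = c⁻¹ * logDer k i t a := by
  unfold logDer
  rw [show c⁻¹ * t * (c * a) = t * a by field_simp, sinQuot_smul hc]
  split_ifs
  · ring
  · rw [mul_comm c, ← div_div, div_eq_inv_mul]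

lemma logDer_neg (k i : Fin (n + 2)) (t a : ℝ) : logDer k i (-t) a = logDer k i t a := by
  simp [logDer, sinQuot_neg, neg_div]

lemma prod_ite_vertex (k : Fin (n + 2)) (c : ℝ) :
    ∏ i : Fin (n + 2), (if i = k then 1 else c) = c ^ (n + 1) := by
  rw [← Finset.mul_prod_erase _ _ (Finset.mem_univ k), if_pos rfl, one_mul,
    Finset.prod_congr rfl fun i hi => if_neg (Finset.ne_of_mem_erase hi), Finset.prod_const,
    Finset.card_erase_of_mem (Finset.mem_univ k), Finset.card_univ, Fintype.card_fin]
  simp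

lemma rpow_pow_mul {c a : ℝ} (hc : 0 ≤ c) (ha : 0 ≤ a) :
    (c ^ (n + 1) * a) ^ (1 / ((n : ℝ) + 1)) = c * a ^ (1 / ((n : ℝ) + 1)) := by
  rw [Real.mul_rpow (by positivity) ha, ← Real.rpow_natCast, ← Real.rpow_mul hc]
  push_cast
  rw [mul_one_div_cancel (by positivity), Real.rpow_one]

/-- Each of the n + 1 factors other than the vertex factor is multiplied by c, and the root of order
n + 1 turns this into a single c. -/
lemma Psi_smul {k : Fin (n + 2)} {v : NR n} {t c : ℝ} (hc : 0 < c)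
    (h : (v, t) ∈ polarDomain (whole n) k) : Psi k (c • v) (c⁻¹ * t) = c * Psi k v t := by
  unfold Psi
  simp only [dotProduct_smul, smul_eq_mul, factor_smul _ _ hc.ne', Finset.prod_mul_distrib,
    prod_ite_vertex]
  exact rpow_pow_mul hc.le (Finset.prod_pos fun i _ => factor_pos h i).le

/-- The gradient of a function homogeneous of degree one is homogeneous of degree zero, so it
depends only on the point of the blow-up. -/
lemma gradVec_smul {k : Fin (n + 2)} {v : NR n} {t c : ℝ} (hc : 0 < c)
    (h : (v, t) ∈ polarDomain (whole n) k) : gradVec k (c • v) (c⁻¹ * t) = gradVec k v t := by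
  refine Finset.sum_congr rfl fun i _ => ?_
  rw [gradCoeff, gradCoeff, Psi_smul hc h, dotProduct_smul, smul_eq_mul, logDer_smul k i hc.ne']
  congr 1
  field_simp

lemma Psi_neg (k : Fin (n + 2)) (v : NR n) (t : ℝ) : Psi k v (-t) = Psi k v t := by
  simp [Psi, factor_neg]

lemma gradVec_neg (k : Fin (n + 2)) (v : NR n) (t : ℝ) :
    gradVec k v (-t) = gradVec k v t := by
  simp [gradVec, gradCoeff, Psi_neg, logDer_neg]

/-! ### The differential of `t Ψ (v, t)` -/

lemma fderiv_Psi_fst {k : Fin (n + 2)} {q : NR n × ℝ} (h : q ∈ polarDomain (whole n) k)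
    (ξ : NR n) :
    fderiv ℝ (fun q : NR n × ℝ => Psi k q.1 q.2) q (ξ, 0) = gradVec k q.1 q.2 ⬝ᵥ ξ := by
  have hd : DifferentiableAt ℝ (fun q : NR n × ℝ => Psi k q.1 q.2) q :=
    ((contDiffOn_Psi k).contDiffAt ((isOpen_polarDomain _ k).mem_nhds h)).differentiableAt (by simp)
  have hl : HasDerivAt (fun s : ℝ => q + s • (ξ, (0 : ℝ))) (ξ, (0 : ℝ)) 0 := by
    simpa using ((hasDerivAt_id (0 : ℝ)).smul_const (ξ, (0 : ℝ))).const_add q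
  have h0 : q + (0 : ℝ) • (ξ, (0 : ℝ)) = q := by simp
  rw [← h0] at hd
  have h1 := hd.hasFDerivAt.comp_hasDerivAt 0 hl
  rw [h0] at h1
  refine h1.unique ?_
  have h2 := hasDerivAt_Psi_line (k := k) (v := q.1) (ξ := ξ) (t := q.2) (s := 0) (by simpa using h)
  rw [zero_smul, add_zero] at h2
  refine h2.congr_of_eventuallyEq (Eventually.of_forall fun s => ?_)
  simp

/-- Euler's relation, the derivative of `Psi_smul` at c = 1. It expresses the t-derivative of Ψ,
multiplied by t, through the v-gradient. -/
lemma fderiv_Psi_euler {k : Fin (n + 2)} {q : NR n × ℝ} (h : q ∈ polarDomain (whole n) k) :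
    fderiv ℝ (fun q : NR n × ℝ => Psi k q.1 q.2) q (q.1, -q.2) = Psi k q.1 q.2 := by
  have hd : DifferentiableAt ℝ (fun q : NR n × ℝ => Psi k q.1 q.2) q :=
    ((contDiffOn_Psi k).contDiffAt ((isOpen_polarDomain _ k).mem_nhds h)).differentiableAt (by simp)
  have hl : HasDerivAt (fun s : ℝ => (s • q.1, s⁻¹ * q.2)) (q.1, -q.2) 1 := by
    have h1 := (hasDerivAt_id (1 : ℝ)).smul_const q.1
    have h2 := (hasDerivAt_inv (one_ne_zero (α := ℝ))).mul_const q.2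
    convert! h1.prodMk h2 using 1
    simp
  have h0 : ((1 : ℝ) • q.1, (1 : ℝ)⁻¹ * q.2) = q := by simp
  rw [← h0] at hd
  have h1 := hd.hasFDerivAt.comp_hasDerivAt 1 hl
  rw [h0] at h1
  refine h1.unique ?_
  have h2 : HasDerivAt (fun s : ℝ => s * Psi k q.1 q.2) (Psi k q.1 q.2) 1 := by
    simpa using (hasDerivAt_id (1 : ℝ)).mul_const (Psi k q.1 q.2)
  refine h2.congr_of_eventuallyEq ?_
  filter_upwards [lt_mem_nhds (zero_lt_one' ℝ)] with s hs using Psi_smul hs h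

/-- Formally this is the chain rule for F composed with (v, t) ↦ p_k + t v. Proving it by Euler's
relation makes it valid at t = 0, where F need not be differentiable at the vertex. -/
lemma fderiv_mul_Psi {k : Fin (n + 2)} {q : NR n × ℝ} (h : q ∈ polarDomain (whole n) k)
    (δ : NR n × ℝ) :
    fderiv ℝ (fun q : NR n × ℝ => q.2 * Psi k q.1 q.2) q δ =
      gradVec k q.1 q.2 ⬝ᵥ (q.2 • δ.1 + δ.2 • q.1) := by
  have hd : DifferentiableAt ℝ (fun q : NR n × ℝ => Psi k q.1 q.2) q :=
    ((contDiffOn_Psi k).contDiffAt ((isOpen_polarDomain _ k).mem_nhds h)).differentiableAt (by simp)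
  rw [HasFDerivAt.fderiv (HasFDerivAt.fun_mul hasFDerivAt_snd hd.hasFDerivAt)]
  set D := fderiv ℝ (fun q : NR n × ℝ => Psi k q.1 q.2) q with hD
  have h1 : D (δ.1, 0) = gradVec k q.1 q.2 ⬝ᵥ δ.1 := fderiv_Psi_fst h δ.1
  have h2 : D (q.1, 0) = gradVec k q.1 q.2 ⬝ᵥ q.1 := fderiv_Psi_fst h q.1
  have h3 : D (q.1, -q.2) = Psi k q.1 q.2 := fderiv_Psi_euler h
  have e1 : δ = (δ.1, 0) + δ.2 • ((0 : NR n), (1 : ℝ)) := by ext <;> simp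
  have e2 : (q.1, -q.2) = (q.1, 0) + (-q.2) • ((0 : NR n), (1 : ℝ)) := by ext <;> simp
  rw [e2, map_add, map_smul, h2] at h3
  have e3 : D δ = gradVec k q.1 q.2 ⬝ᵥ δ.1 + δ.2 • D ((0 : NR n), (1 : ℝ)) := by
    rw [← h1, ← map_smul, ← map_add, ← e1]
  simp only [add_apply, smul_apply,
    ContinuousLinearMap.coe_snd', smul_eq_mul, dotProduct_add, dotProduct_smul, e3] at h3 ⊢
  linear_combination (-δ.2) * h3

/-! ### The function `F` -/

lemma dot_u_p (i k : Fin (n + 2)) : (if i = 0 then Real.pi / 2 else 0) + u n i ⬝ᵥ p n k =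
    if i = k then Real.pi / 2 else 0 := by
  have h := bary_p (n := n) i k
  have hpi := Real.pi_pos.ne'
  rw [bary] at h
  have : (if i = 0 then Real.pi / 2 else 0) + u n i ⬝ᵥ p n k =
      Real.pi / 2 * ((if i = 0 then 1 else 0) + 2 / Real.pi * (u n i ⬝ᵥ p n k)) := by
    (split_ifs <;> field_simp); ring
  rw [this, h]
  split_ifs <;> simp

/-- The cosine is the sine of π/2 + ⟨u_0, y⟩, so all n + 2 factors have the same shape and every
vertex can be treated alike. -/
lemma trigProd_eq (y : NR n) :
    trigProd y = ∏ i, Real.sin ((if i = 0 then Real.pi / 2 else 0) + u n i ⬝ᵥ y) := by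
  rw [trigProd, Fin.prod_univ_succ (n := n + 1)]
  congr 1
  · have : u n 0 ⬝ᵥ y = -∑ j, y j := by simp [u, dotProduct]
    rw [this, if_pos rfl, ← sub_eq_add_neg, Real.sin_pi_div_two_sub]
  · refine Finset.prod_congr rfl fun j _ => ?_
    rw [dot_u_succ, if_neg (Fin.succ_ne_zero j), zero_add]

lemma trigProd_add_smul (k : Fin (n + 2)) (v : NR n) (t : ℝ) :
    trigProd (p n k + t • v) = t ^ (n + 1) * ∏ i, factor k i t (u n i ⬝ᵥ v) := by
  rw [trigProd_eq, ← prod_ite_vertex k t, ← Finset.prod_mul_distrib]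
  refine Finset.prod_congr rfl fun i _ => ?_
  rw [dotProduct_add, ← add_assoc, dot_u_p, dotProduct_smul, smul_eq_mul, factor]
  split_ifs
  · rw [add_comm, Real.sin_add_pi_div_two, one_mul]
  · rw [zero_add, mul_sinQuot]

lemma realRoot_of_nonneg {a : ℝ} (ha : 0 ≤ a) : realRoot n a = a ^ (1 / ((n : ℝ) + 1)) := by
  rcases ha.eq_or_lt with rfl | ha
  · rw [realRoot, Real.sign_zero, zero_mul, Real.zero_rpow (by positivity)]
  · rw [realRoot, Real.sign_of_pos ha, one_mul, abs_of_pos ha]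

lemma realRoot_neg (a : ℝ) : realRoot n (-a) = -realRoot n a := by
  rw [realRoot, realRoot, Real.sign_neg, abs_neg, neg_mul]

/-- The product changes by (-1)^(n+1) under y ↦ -y. Together with the factor (-1)^n and the oddness
of the real root, this gives the sign -1 for either parity of n, as required for F = t Ψ at negative
t. -/
lemma Fminus_neg (y : NR n) : Fminus (-y) = -Fplus y := by
  have h : trigProd (-y) = (-1) ^ (n + 1) * trigProd y := by
    simp only [trigProd, Pi.neg_apply, Real.sin_neg, Finset.sum_neg_distrib, Real.cos_neg,
      Finset.prod_neg]
    simp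
    ring
  rw [Fminus, Fplus, h]
  rcases Nat.even_or_odd n with hn | hn
  · rw [hn.neg_one_pow, hn.add_one.neg_one_pow, neg_one_mul, realRoot_neg, one_mul]
  · rw [hn.neg_one_pow, hn.add_one.neg_one_pow, one_mul, neg_one_mul]

lemma Fplus_add_smul {k : Fin (n + 2)} {v : NR n} {t : ℝ} (ht : 0 ≤ t)
    (h : (v, t) ∈ polarDomain (whole n) k) : Fplus (p n k + t • v) = t * Psi k v t := by
  have h1 := (Finset.prod_pos fun i (_ : i ∈ Finset.univ) => factor_pos h i).le
  rw [Fplus, trigProd_add_smul, realRoot_of_nonneg (mul_nonneg (by positivity) h1),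
    rpow_pow_mul ht h1, Psi]

/-- With t fixed, F near the point is z ↦ t Ψ((z - p_k)/t, t); the factor t cancels the 1/t from the
inner derivative. -/
lemma partials_Fplus {k : Fin (n + 2)} {v : NR n} {t : ℝ} (ht : 0 < t)
    (h : (v, t) ∈ polarDomain (whole n) k) :
    partials Fplus (p n k + t • v) = gradVec k v t := by
  have hc : Continuous fun z : NR n => (t⁻¹ • (z - p n k), t) := by fun_prop
  have he : (t⁻¹ • (p n k + t • v - p n k), t) ∈ polarDomain (whole n) k := by
    simpa [smul_smul, ht.ne'] using h
  have hev : Fplus =ᶠ[𝓝 (p n k + t • v)] fun z => t * Psi k (t⁻¹ • (z - p n k)) t := by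
    filter_upwards [hc.continuousAt.preimage_mem_nhds
      ((isOpen_polarDomain (whole n) k).mem_nhds (he))] with z hz
    rw [← Fplus_add_smul ht.le hz, smul_smul, mul_inv_cancel₀ ht.ne', one_smul, add_sub_cancel]
  funext j
  have hsm : ContDiff ℝ ∞ fun z : NR n => (t⁻¹ • (z - p n k), t) := by fun_prop
  have hd : DifferentiableAt ℝ Fplus (p n k + t • v) := by
    refine DifferentiableAt.congr_of_eventuallyEq ?_ hev
    have hP : ContDiffAt ℝ ∞ (fun q : NR n × ℝ => Psi k q.1 q.2)
        (t⁻¹ • (p n k + t • v - p n k), t) :=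
      (contDiffOn_Psi k).contDiffAt ((isOpen_polarDomain _ k).mem_nhds (he))
    exact (contDiffAt_const.mul (hP.comp (p n k + t • v) hsm.contDiffAt)).differentiableAt (by simp)
  have h1 := hd.lineDeriv_eq_fderiv (v := Pi.single j 1)
  rw [partials, ← h1]
  refine HasLineDerivAt.lineDeriv ?_
  have h2 := (hasDerivAt_Psi_line (k := k) (v := v) (ξ := t⁻¹ • Pi.single j 1) (t := t) (s := 0)
    (by simpa using h)).const_mul t
  have e : t * (gradVec k (v + (0 : ℝ) • t⁻¹ • Pi.single j 1) t ⬝ᵥ t⁻¹ • Pi.single j 1)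
      = gradVec k v t j := by
    simp
    field_simp
  rw [e] at h2
  have hl : Continuous fun s : ℝ => p n k + t • v + s • (Pi.single j 1 : NR n) := by fun_prop
  refine h2.congr_of_eventuallyEq ?_
  have hev2 := hl.continuousAt (x := 0)
  simp only [ContinuousAt, zero_smul, add_zero] at hev2
  filter_upwards [hev2.eventually hev] with s hs
  rw [hs]
  congr 2
  -- The line p_k + t v + s e_j in z is the line v + s e_j/t in the vector variable.
  rw [add_assoc, add_sub_cancel_left, smul_add, smul_smul, inv_mul_cancel₀ ht.ne', one_smul,
    smul_comm]

lemma partials_Fminus_neg (y : NR n) : partials Fminus (-y) = partials (Fplus (n := n)) y := by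
  have : (Fminus : NR n → ℝ) = fun z => -Fplus (-z) := by
    funext z
    rw [← Fminus_neg, neg_neg]
  funext j
  have h := (ContinuousLinearEquiv.neg ℝ (M := NR n)).comp_right_fderiv (f := Fplus) (x := -y)
  have e : (Fplus ∘ (ContinuousLinearEquiv.neg ℝ (M := NR n)) : NR n → ℝ) =
      fun z => Fplus (-z) := rfl
  rw [e] at h
  rw [partials, partials, this, fderiv_fun_neg, h]
  simp

end

section

variable {n : ℕ} {J : Face n} {k : Fin (n + 2)}

/-! ### Redundant polar coordinates on the stars of the vertices -/

namespace BlowUp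

/-- The chart on the star of `p_k` as a member of the atlas. -/
def starChart (hk : k ∉ J.1) : OpenPartialHomeomorph (BlowUp J) (tangentDir J) :=
  (core J).openPartialHomeomorph (chart hk) ⟨k, hk, rfl⟩

lemma starChart_mem_atlas (hk : k ∉ J.1) : starChart hk ∈ atlas (tangentDir J) (BlowUp J) :=
  ⟨_, ⟨chart hk, rfl⟩, _, ⟨⟨k, hk, rfl⟩, rfl⟩, rfl⟩

lemma starChart_mem_maximalAtlas (hk : k ∉ J.1) :
    starChart hk ∈ IsManifold.maximalAtlas 𝓘(ℝ, tangentDir J) ∞ (BlowUp J) :=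
  IsManifold.subset_maximalAtlas (starChart_mem_atlas hk)

lemma contMDiffOn_starChart (hk : k ∉ J.1) :
    ContMDiffOn 𝓘(ℝ, tangentDir J) 𝓘(ℝ, tangentDir J) ∞ (starChart hk) (vertexStar k) :=
  contMDiffOn_of_mem_maximalAtlas (starChart_mem_maximalAtlas hk)

lemma contMDiffOn_ofPolar (hk : k ∉ J.1) :
    ContMDiffOn 𝓘(ℝ, tangentDir J) 𝓘(ℝ, tangentDir J) ∞ (ofPolar hk) (polarTarget J k) :=
  contMDiffOn_symm_of_mem_maximalAtlas (starChart_mem_maximalAtlas hk)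

lemma isOpen_vertexStar (hk : k ∉ J.1) : IsOpen (vertexStar k : Set (BlowUp J)) :=
  (starChart hk).open_source

/-- The domain of the redundant polar coordinates. -/
def paramDomain (J : Face n) (k : Fin (n + 2)) : Set (tangentDir J × ℝ) :=
  {q | ((q.1 : NR n), q.2) ∈ polarDomain J k}

lemma contDiff_coe_prod : ContDiff ℝ ∞ fun q : tangentDir J × ℝ => ((q.1 : NR n), q.2) :=
  ((tangentDir J).subtypeL.contDiff.comp contDiff_fst).prodMk contDiff_snd

lemma isOpen_paramDomain (J : Face n) (k : Fin (n + 2)) : IsOpen (paramDomain J k) :=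
  (isOpen_polarDomain J k).preimage contDiff_coe_prod.continuous

/-- The point `[p_k + t v]` of the star of `p_k`, on the line through `p_k` in the direction `v`. -/
def param (hk : k ∉ J.1) (q : tangentDir J × ℝ) : BlowUp J :=
  ofPolar hk (((1 + q.2 * radius k (q.1 : NR n)) / radius k (q.1 : NR n)) • q.1)

lemma radius_pos_of_mem {q : tangentDir J × ℝ} (hq : q ∈ paramDomain J k) :
    0 < radius k (q.1 : NR n) := by
  have h : radius k (q.1 : NR n) = 2 / Real.pi *
      ∑ i ∈ Finset.univ.erase k, u n i ⬝ᵥ (q.1 : NR n) := by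
    rw [radius, dot_u_eq_neg_sum]
    ring
  have := Real.pi_pos
  rw [h]
  refine mul_pos (by positivity) (Finset.sum_pos' (fun i hi => ?_) ?_)
  · by_cases hiJ : i ∈ J.1
    · exact (q.1.2 i hiJ).ge
    · exact (hq.1 i hiJ (Finset.ne_of_mem_erase hi)).le
  · have hlt : (insert k J.1).card < (Finset.univ : Finset (Fin (n + 2))).card := by
      rw [Finset.card_univ, Fintype.card_fin]
      have := Finset.card_insert_le k J.1
      have := J.2
      omega
    obtain ⟨i, -, hi⟩ := Finset.exists_mem_notMem_of_card_lt_card hlt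
    rw [Finset.mem_insert, not_or] at hi
    exact ⟨i, Finset.mem_erase.2 ⟨hi.1, Finset.mem_univ i⟩, hq.1 i hi.2 hi.1⟩

lemma radius_smul_param {q : tangentDir J × ℝ} (hq : q ∈ paramDomain J k) :
    radius k ((((1 + q.2 * radius k (q.1 : NR n)) / radius k (q.1 : NR n)) • q.1 : tangentDir J) :
      NR n) = 1 + q.2 * radius k (q.1 : NR n) := by
  rw [Submodule.coe_smul, radius_smul, div_mul_cancel₀ _ (radius_pos_of_mem hq).ne']

lemma abs_mul_radius_lt {q : tangentDir J × ℝ} (hq : q ∈ paramDomain J k) :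
    |q.2 * radius k (q.1 : NR n)| < 1 := by
  rw [abs_mul, abs_of_pos (radius_pos_of_mem hq)]
  exact hq.2

lemma smul_mem_polarTarget {q : tangentDir J × ℝ} (hq : q ∈ paramDomain J k) :
    ((1 + q.2 * radius k (q.1 : NR n)) / radius k (q.1 : NR n)) • q.1 ∈ polarTarget J k := by
  have h := abs_lt.1 (abs_mul_radius_lt hq)
  refine ⟨fun i hi hik => ?_, ?_, ?_⟩
  · rw [Submodule.coe_smul, dotProduct_smul]
    exact mul_pos (div_pos (by linarith [h.1]) (radius_pos_of_mem hq)) (hq.1 i hi hik)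
  · rw [radius_smul_param hq]
    linarith [h.1]
  · rw [radius_smul_param hq]
    linarith [h.2]

lemma param_mem (hk : k ∉ J.1) {q : tangentDir J × ℝ} (hq : q ∈ paramDomain J k) :
    param hk q ∈ vertexStar k :=
  ofPolar_mem hk (smul_mem_polarTarget hq)

lemma contDiff_radius_coe : ContDiff ℝ ∞ fun v : tangentDir J => radius k (v : NR n) :=
  (contDiff_radius k).comp (tangentDir J).subtypeL.contDiff

lemma contMDiffOn_param (hk : k ∉ J.1) :
    ContMDiffOn 𝓘(ℝ, tangentDir J × ℝ) 𝓘(ℝ, tangentDir J) ∞ (param hk) (paramDomain J k) := by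
  refine (contMDiffOn_ofPolar hk).comp (ContDiffOn.contMDiffOn ?_)
    fun q hq => smul_mem_polarTarget hq
  have hr : ContDiff ℝ ∞ fun q : tangentDir J × ℝ => radius k (q.1 : NR n) :=
    contDiff_radius_coe.comp contDiff_fst
  exact ((contDiff_const.add (contDiff_snd.mul hr)).contDiffOn.div hr.contDiffOn
    fun q hq => (radius_pos_of_mem hq).ne').smul contDiff_fst.contDiffOn

/-- The normalized polar coordinates, with `radius k v = 1`. -/
def sec (hk : k ∉ J.1) (x : BlowUp J) : tangentDir J × ℝ :=
  ((radius k (starChart hk x : NR n))⁻¹ • starChart hk x, radius k (starChart hk x : NR n) - 1)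

lemma starChart_mem (hk : k ∉ J.1) {x : BlowUp J} (hx : x ∈ vertexStar k) :
    starChart hk x ∈ polarTarget J k :=
  (starChart hk).map_source hx

lemma contMDiffOn_sec (hk : k ∉ J.1) :
    ContMDiffOn 𝓘(ℝ, tangentDir J) 𝓘(ℝ, tangentDir J × ℝ) ∞ (sec hk) (vertexStar k) := by
  have h : ContDiffOn ℝ ∞ (fun w : tangentDir J =>
      ((radius k (w : NR n))⁻¹ • w, radius k (w : NR n) - 1)) (polarTarget J k) :=
    ((contDiff_radius_coe.contDiffOn.inv fun w hw => hw.2.1.ne').smul contDiffOn_id).prodMk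
      (contDiff_radius_coe.contDiffOn.sub contDiffOn_const)
  exact h.contMDiffOn.comp (contMDiffOn_starChart hk) fun x hx => starChart_mem hk hx

lemma radius_sec (hk : k ∉ J.1) {x : BlowUp J} (hx : x ∈ vertexStar k) :
    radius k ((sec hk x).1 : NR n) = 1 := by
  rw [sec, Submodule.coe_smul, radius_smul, inv_mul_cancel₀ (starChart_mem hk hx).2.1.ne']

lemma sec_mem (hk : k ∉ J.1) {x : BlowUp J} (hx : x ∈ vertexStar k) :
    sec hk x ∈ paramDomain J k := by
  have h := starChart_mem hk hx
  refine ⟨fun i hi hik => ?_, ?_⟩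
  · simp only [sec, Submodule.coe_smul, dotProduct_smul]
    exact mul_pos (inv_pos.2 h.2.1) (h.1 i hi hik)
  · simp only [radius_sec hk hx, mul_one]
    rw [sec, abs_lt]
    constructor <;> simp only <;> linarith [h.2.1, h.2.2]

lemma param_sec (hk : k ∉ J.1) {x : BlowUp J} (hx : x ∈ vertexStar k) :
    param hk (sec hk x) = x := by
  have h := starChart_mem hk hx
  rw [param, radius_sec hk hx, div_one, mul_one]
  simp only [sec]
  rw [add_sub_cancel, smul_smul, mul_inv_cancel₀ h.2.1.ne', one_smul]
  exact (starChart hk).left_inv hx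

lemma starChart_param (hk : k ∉ J.1) {q : tangentDir J × ℝ} (hq : q ∈ paramDomain J k) :
    starChart hk (param hk q) =
      ((1 + q.2 * radius k (q.1 : NR n)) / radius k (q.1 : NR n)) • q.1 :=
  (starChart hk).right_inv (smul_mem_polarTarget hq)

/-- Composing `param` with `sec` does not give the identity: it rescales to the representative with
`radius` equal to one. -/
lemma sec_param (hk : k ∉ J.1) {q : tangentDir J × ℝ} (hq : q ∈ paramDomain J k) :
    sec hk (param hk q) = ((radius k (q.1 : NR n))⁻¹ • q.1, q.2 * radius k (q.1 : NR n)) := by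
  have h := abs_lt.1 (abs_mul_radius_lt hq)
  have h1 : 1 + q.2 * radius k (q.1 : NR n) ≠ 0 := by linarith [h.1]
  rw [sec, starChart_param hk hq, radius_smul_param hq, smul_smul]
  congr 1
  · congr 1
    field_simp
  · ring

lemma param_smul (hk : k ∉ J.1) {q : tangentDir J × ℝ} {c : ℝ} (hc : c ≠ 0) :
    param hk (c • q.1, c⁻¹ * q.2) = param hk q := by
  unfold param
  congr 1
  simp only [Submodule.coe_smul, radius_smul, smul_smul]
  rw [show c⁻¹ * q.2 * (c * radius k (q.1 : NR n)) = q.2 * radius k (q.1 : NR n) by field_simp]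
  congr 1
  by_cases hr : radius k (q.1 : NR n) = 0
  · simp [hr]
  · field_simp

lemma param_of_pos (hk : k ∉ J.1) {q : tangentDir J × ℝ} (hq : q ∈ paramDomain J k)
    (ht : 0 < q.2) : ∃ hy, param hk q = plus (p n k + q.2 • (q.1 : NR n)) hy := by
  have hr := radius_pos_of_mem hq
  have h1 : 1 < radius k ((((1 + q.2 * radius k (q.1 : NR n)) / radius k (q.1 : NR n)) • q.1 :
      tangentDir J) : NR n) := by
    rw [radius_smul_param hq]
    linarith [mul_pos ht hr]
  have e : p n k + ((radius k ((((1 + q.2 * radius k (q.1 : NR n)) / radius k (q.1 : NR n)) • q.1 :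
      tangentDir J) : NR n) - 1) / radius k ((((1 + q.2 * radius k (q.1 : NR n)) /
      radius k (q.1 : NR n)) • q.1 : tangentDir J) : NR n)) •
      ((((1 + q.2 * radius k (q.1 : NR n)) / radius k (q.1 : NR n)) • q.1 : tangentDir J) : NR n)
      = p n k + q.2 • (q.1 : NR n) := by
    have := mul_pos ht hr
    rw [radius_smul_param hq, Submodule.coe_smul, smul_smul]
    congr 2
    field_simp
    ring
  have hmem := plus_mem hk (smul_mem_polarTarget hq) h1
  refine ⟨e ▸ hmem, ?_⟩
  rw [param, ofPolar, dif_pos (smul_mem_polarTarget hq), dif_pos h1]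
  exact plus_congr _ _ e

lemma param_of_neg (hk : k ∉ J.1) {q : tangentDir J × ℝ} (hq : q ∈ paramDomain J k)
    (ht : q.2 < 0) : ∃ hy, param hk q = minus (p n k - q.2 • (q.1 : NR n)) hy := by
  have hr := radius_pos_of_mem hq
  have h2 := abs_lt.1 (abs_mul_radius_lt hq)
  have h1 : radius k ((((1 + q.2 * radius k (q.1 : NR n)) / radius k (q.1 : NR n)) • q.1 :
      tangentDir J) : NR n) < 1 := by
    rw [radius_smul_param hq]
    linarith [mul_neg_of_neg_of_pos ht hr]
  have e : p n k + ((1 - radius k ((((1 + q.2 * radius k (q.1 : NR n)) / radius k (q.1 : NR n)) •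
      q.1 : tangentDir J) : NR n)) / radius k ((((1 + q.2 * radius k (q.1 : NR n)) /
      radius k (q.1 : NR n)) • q.1 : tangentDir J) : NR n)) •
      ((((1 + q.2 * radius k (q.1 : NR n)) / radius k (q.1 : NR n)) • q.1 : tangentDir J) : NR n)
      = p n k - q.2 • (q.1 : NR n) := by
    have : 1 + q.2 * radius k (q.1 : NR n) ≠ 0 := by linarith [h2.1]
    rw [radius_smul_param hq, Submodule.coe_smul, smul_smul, sub_eq_add_neg (p n k), ← neg_smul]
    congr 2
    field_simp
    ring
  have hmem := minus_mem hk (smul_mem_polarTarget hq) h1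
  refine ⟨e ▸ hmem, ?_⟩
  rw [param, ofPolar, dif_pos (smul_mem_polarTarget hq), dif_neg (not_lt.2 h1.le), dif_pos h1]
  exact minus_congr _ _ e

lemma param_of_zero (hk : k ∉ J.1) {q : tangentDir J × ℝ} (hq : q ∈ paramDomain J k)
    (ht : q.2 = 0) :
    ∃ hm, param hk q = exc k hk (p n k + (radius k (q.1 : NR n))⁻¹ • (q.1 : NR n)) hm := by
  have h1 : radius k ((((1 + q.2 * radius k (q.1 : NR n)) / radius k (q.1 : NR n)) • q.1 :
      tangentDir J) : NR n) = 1 := by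
    rw [radius_smul_param hq, ht, zero_mul, add_zero]
  have e : p n k + ((((1 + q.2 * radius k (q.1 : NR n)) / radius k (q.1 : NR n)) • q.1 :
      tangentDir J) : NR n) = p n k + (radius k (q.1 : NR n))⁻¹ • (q.1 : NR n) := by
    rw [ht, zero_mul, add_zero, one_div]
    rfl
  have hmem := exc_mem hk (smul_mem_polarTarget hq) h1
  refine ⟨e ▸ hmem, ?_⟩
  rw [param, ofPolar, dif_pos (smul_mem_polarTarget hq), dif_neg h1.not_gt, dif_neg h1.not_lt]
  exact exc_congr hk _ _ e

/-- The reflection through `p_k` built into `lift` gives one formula for both signs of t. This is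
why `lift` is smooth across the exceptional fibre. -/
lemma lift_param (hk : k ∉ J.1) {q : tangentDir J × ℝ} (hq : q ∈ paramDomain J k) :
    lift k (param hk q) = p n k + q.2 • (q.1 : NR n) := by
  rcases lt_trichotomy q.2 0 with ht | ht | ht
  · obtain ⟨hy, h⟩ := param_of_neg hk hq ht
    rw [h, lift, two_smul]
    abel
  · obtain ⟨hy, h⟩ := param_of_zero hk hq ht
    rw [h, lift, ht, zero_smul, add_zero]
  · obtain ⟨hy, h⟩ := param_of_pos hk hq ht
    rw [h, lift]

lemma base_param (hk : k ∉ J.1) {q : tangentDir J × ℝ} (hq : q ∈ paramDomain J k) :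
    base (param hk q) = p n k + |q.2| • (q.1 : NR n) := by
  rcases lt_trichotomy q.2 0 with ht | ht | ht
  · obtain ⟨hy, h⟩ := param_of_neg hk hq ht
    rw [h, base, abs_of_neg ht, neg_smul, sub_eq_add_neg]
  · obtain ⟨hy, h⟩ := param_of_zero hk hq ht
    rw [h, base, ht, abs_zero, zero_smul, add_zero]
  · obtain ⟨hy, h⟩ := param_of_pos hk hq ht
    rw [h, base, abs_of_pos ht]

lemma lift_sub_p_eq (hk : k ∉ J.1) {x : BlowUp J} (hx : x ∈ vertexStar k) :
    lift k x = p n k + (sec hk x).2 • ((sec hk x).1 : NR n) := by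
  conv_lhs => rw [← param_sec hk hx]
  exact lift_param hk (sec_mem hk hx)

lemma contMDiffOn_lift (hk : k ∉ J.1) :
    ContMDiffOn 𝓘(ℝ, tangentDir J) 𝓘(ℝ, NR n) ∞ (lift k : BlowUp J → NR n) (vertexStar k) := by
  have h : ContDiff ℝ ∞ fun q : tangentDir J × ℝ => p n k + q.2 • (q.1 : NR n) :=
    contDiff_const.add (contDiff_snd.smul ((tangentDir J).subtypeL.contDiff.comp contDiff_fst))
  exact (h.contMDiff.comp_contMDiffOn (contMDiffOn_sec hk)).congr fun x hx => lift_sub_p_eq hk hx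

lemma exists_mem_vertexStar (x : BlowUp J) : ∃ k, k ∉ J.1 ∧ x ∈ vertexStar k := by
  cases x with
  | plus y hy => exact ⟨_, (exists_notMem J).choose_spec, trivial⟩
  | minus y hy => exact ⟨_, (exists_notMem J).choose_spec, trivial⟩
  | exc k hk m hm => exact ⟨k, hk, rfl⟩

end BlowUp

end

section

variable {n : ℕ} {J : Face n} {k : Fin (n + 2)}

/-! ### The functions `F` and `h` in polar coordinates -/

lemma notMem_whole (k : Fin (n + 2)) : k ∉ (whole n).1 := Finset.notMem_empty k

lemma mem_tangentDir_whole (v : NR n) : v ∈ tangentDir (whole n) :=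
  fun _ hi => absurd hi (Finset.notMem_empty _)

/-- The point of `C̃` with polar coordinates `(v, t)` at `p_k`. -/
def paramC (k : Fin (n + 2)) (v : NR n) (t : ℝ) : Ctilde n :=
  param (notMem_whole k) (⟨v, mem_tangentDir_whole v⟩, t)

lemma Fplus_p (k : Fin (n + 2)) : Fplus (p n k) = 0 := by
  have : trigProd (p n k) = 0 := by
    have := trigProd_add_smul k (0 : NR n) 0
    rw [smul_zero, add_zero] at this
    rw [this]
    simp
  rw [Fplus, this, realRoot, Real.sign_zero, zero_mul]

lemma F_paramC {v : NR n} {t : ℝ} (h : (v, t) ∈ polarDomain (whole n) k) :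
    F (paramC k v t) = t * Psi k v t := by
  have hq : ((⟨v, mem_tangentDir_whole v⟩ : tangentDir (whole n)), t) ∈ paramDomain (whole n) k := h
  rcases lt_trichotomy t 0 with ht | ht | ht
  · obtain ⟨hy, e⟩ := param_of_neg (notMem_whole k) hq ht
    rw [paramC, e, F, Fminus_neg, sub_eq_add_neg, ← neg_smul,
      Fplus_add_smul (neg_nonneg.2 ht.le) (polarDomain_neg.2 h), Psi_neg]
    ring
  · obtain ⟨hy, e⟩ := param_of_zero (notMem_whole k) hq ht
    rw [paramC, e, F, Fplus_p, ht, zero_mul]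
  · obtain ⟨hy, e⟩ := param_of_pos (notMem_whole k) hq ht
    rw [paramC, e, F, Fplus_add_smul ht.le h]

lemma gradF_paramC {v : NR n} {t : ℝ} (h : (v, t) ∈ polarDomain (whole n) k) (ht : t ≠ 0) :
    gradF (paramC k v t) = gradVec k v t := by
  have hq : ((⟨v, mem_tangentDir_whole v⟩ : tangentDir (whole n)), t) ∈ paramDomain (whole n) k := h
  rcases lt_or_gt_of_ne ht with ht | ht
  · obtain ⟨hy, e⟩ := param_of_neg (notMem_whole k) hq ht
    rw [paramC, e, gradF, partials_Fminus_neg, sub_eq_add_neg, ← neg_smul,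
      partials_Fplus (neg_pos.2 ht) (polarDomain_neg.2 h), gradVec_neg]
  · obtain ⟨hy, e⟩ := param_of_pos (notMem_whole k) hq ht
    rw [paramC, e, gradF, partials_Fplus ht h]

/-- The polar coordinates at `p_k` of a point of `C̃`, with `radius k v = 1`. -/
def secV (k : Fin (n + 2)) (x : Ctilde n) : NR n := (sec (notMem_whole k) x).1

/-- The signed distance from `p_k` for the normalized polar coordinates. -/
def secT (k : Fin (n + 2)) (x : Ctilde n) : ℝ := (sec (notMem_whole k) x).2

lemma sec_mem_polarDomain {x : Ctilde n} (hx : x ∈ vertexStar k) :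
    (secV k x, secT k x) ∈ polarDomain (whole n) k :=
  sec_mem (notMem_whole k) hx

lemma paramC_sec {x : Ctilde n} (hx : x ∈ vertexStar k) : paramC k (secV k x) (secT k x) = x :=
  param_sec (notMem_whole k) hx

lemma paramC_mem {v : NR n} {t : ℝ} (h : (v, t) ∈ polarDomain (whole n) k) :
    paramC k v t ∈ vertexStar k :=
  param_mem (notMem_whole k) h

lemma contMDiffOn_secVT (k : Fin (n + 2)) :
    ContMDiffOn (modelC n) 𝓘(ℝ, NR n × ℝ) ∞ (fun x => (secV k x, secT k x)) (vertexStar k) :=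
  contDiff_coe_prod.contMDiff.comp_contMDiffOn (contMDiffOn_sec (notMem_whole k))

lemma contMDiffOn_paramC (k : Fin (n + 2)) :
    ContMDiffOn 𝓘(ℝ, NR n × ℝ) (modelC n) ∞ (fun q => paramC k q.1 q.2)
      (polarDomain (whole n) k) := by
  refine (contMDiffOn_param (notMem_whole k)).comp (t := paramDomain (whole n) k)
    (f := fun q : NR n × ℝ => ((⟨q.1, mem_tangentDir_whole q.1⟩ : tangentDir (whole n)), q.2)) ?_
    fun q hq => hq
  let e : NR n →ₗ[ℝ] tangentDir (whole n) :=
    LinearMap.codRestrict _ LinearMap.id mem_tangentDir_whole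
  exact ((e.toContinuousLinearMap.contDiff.comp contDiff_fst).prodMk
    contDiff_snd).contMDiff.contMDiffOn

lemma gradF_eq_on_regular {x : Ctilde n} (hx : x ∈ vertexStar k) (hr : x ∈ regular (whole n)) :
    gradF x = gradVec k (secV k x) (secT k x) := by
  conv_lhs => rw [← paramC_sec hx]
  refine gradF_paramC (sec_mem_polarDomain hx) fun h0 => ?_
  obtain ⟨hm, e⟩ := param_of_zero (notMem_whole k) (sec_mem (notMem_whole k) hx) h0
  rw [param_sec (notMem_whole k) hx] at e
  rcases hr with ⟨y, hy, rfl⟩ | ⟨y, hy, rfl⟩ <;> cases e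

lemma contMDiffOn_gradVec_sec (k : Fin (n + 2)) :
    ContMDiffOn (modelC n) 𝓘(ℝ, MR n) ∞ (fun x => gradVec k (secV k x) (secT k x))
      (vertexStar k) :=
  ContMDiffOn.comp (g := fun q : NR n × ℝ => gradVec k q.1 q.2)
    (f := fun x : Ctilde n => (secV k x, secT k x)) (contDiffOn_gradVec k).contMDiffOn
    (contMDiffOn_secVT k) fun _ hx => sec_mem_polarDomain hx

/-- A point on an exceptional fibre is a limit of points with the same v and small nonzero t. This
density is needed for the extension by continuity that defines h. -/
lemma mem_closure_regular (x : Ctilde n) : x ∈ closure (regular (whole n)) := by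
  obtain ⟨k, -, hx⟩ := exists_mem_vertexStar x
  have hmem := sec_mem_polarDomain hx
  have hc : ContinuousAt (fun s : ℝ => paramC k (secV k x) (secT k x + s)) 0 := by
    have h1 : ContinuousAt (fun q : NR n × ℝ => paramC k q.1 q.2)
        (secV k x, secT k x + 0) := by
      rw [add_zero]
      exact (contMDiffOn_paramC k).continuousOn.continuousAt
        ((isOpen_polarDomain _ k).mem_nhds hmem)
    exact h1.comp (f := fun s : ℝ => (secV k x, secT k x + s)) (by fun_prop)
  rw [ContinuousAt, add_zero, paramC_sec hx] at hc
  have hc' := hc.mono_left (nhdsWithin_le_nhds (s := Ioi (0 : ℝ)))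
  refine mem_closure_of_frequently_of_tendsto ?_ hc'
  have hc2 : Continuous fun s : ℝ => (secV k x, secT k x + s) := by fun_prop
  have hev : ∀ᶠ s : ℝ in 𝓝 0, (secV k x, secT k x + s) ∈ polarDomain (whole n) k :=
    hc2.continuousAt.preimage_mem_nhds ((isOpen_polarDomain _ k).mem_nhds (by simpa using hmem))
  -- Increasing t by a small positive amount leads away from zero, whatever the sign of t.
  have hne : ∀ᶠ s : ℝ in 𝓝[>] 0, secT k x + s ≠ 0 := by
    rcases le_or_gt 0 (secT k x) with ht | ht
    · filter_upwards [self_mem_nhdsWithin] with s hs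
      exact (add_pos_of_nonneg_of_pos ht hs).ne'
    · filter_upwards [nhdsWithin_le_nhds (gt_mem_nhds (neg_pos.2 ht))] with s hs
      linarith
  refine Eventually.frequently ?_
  filter_upwards [nhdsWithin_le_nhds hev, hne] with s hs hs0
  rcases lt_or_gt_of_ne hs0 with h0 | h0
  · obtain ⟨hy, e⟩ := param_of_neg (notMem_whole k)
      (q := (⟨secV k x, mem_tangentDir_whole _⟩, secT k x + s)) hs h0
    exact Or.inr ⟨_, hy, e⟩
  · obtain ⟨hy, e⟩ := param_of_pos (notMem_whole k)
      (q := (⟨secV k x, mem_tangentDir_whole _⟩, secT k x + s)) hs h0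
    exact Or.inl ⟨_, hy, e⟩

/-- The smooth function on the right agrees with the gradient of F at regular points, and these are
dense, so it is the continuous extension. -/
lemma h_eq_gradVec_sec {x : Ctilde n} (hx : x ∈ vertexStar k) :
    h n x = gradVec k (secV k x) (secT k x) := by
  refine extendFrom_eq (mem_closure_regular x) ?_
  have hopen := isOpen_vertexStar (notMem_whole k)
  have hc := (contMDiffOn_gradVec_sec k).continuousOn.continuousAt (hopen.mem_nhds hx)
  refine (hc.mono_left nhdsWithin_le_nhds : Tendsto _ (𝓝[regular (whole n)] x) _).congr' ?_
  filter_upwards [self_mem_nhdsWithin, nhdsWithin_le_nhds (hopen.mem_nhds hx)] with z hz hzk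
  exact (gradF_eq_on_regular hzk hz).symm

lemma h_paramC {v : NR n} {t : ℝ} (hq : (v, t) ∈ polarDomain (whole n) k) :
    h n (paramC k v t) = gradVec k v t := by
  have hr := radius_pos_of_mem (J := whole n) (k := k) (q := (⟨v, mem_tangentDir_whole v⟩, t)) hq
  have hs := sec_param (notMem_whole k) (q := (⟨v, mem_tangentDir_whole v⟩, t)) hq
  rw [h_eq_gradVec_sec (paramC_mem hq)]
  have h1 : secV k (paramC k v t) = (radius k v)⁻¹ • v := by
    rw [secV, paramC, hs]
    rfl
  have h2 : secT k (paramC k v t) = ((radius k v)⁻¹)⁻¹ * t := by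
    rw [secT, paramC, hs, inv_inv, mul_comm]
  rw [h1, h2]
  exact gradVec_smul (inv_pos.2 hr) hq

theorem contMDiff_h : ContMDiff (modelC n) 𝓘(ℝ, MR n) ∞ (h n) := by
  intro x
  obtain ⟨k, -, hx⟩ := exists_mem_vertexStar x
  have hx' := (isOpen_vertexStar (notMem_whole k)).mem_nhds hx
  refine ((contMDiffOn_gradVec_sec k).contMDiffAt hx').congr_of_eventuallyEq ?_
  filter_upwards [hx'] with z hz using h_eq_gradVec_sec hz

lemma contMDiff_F : ContMDiff (modelC n) 𝓘(ℝ, ℝ) ∞ (F (n := n)) := by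
  intro x
  obtain ⟨k, -, hx⟩ := exists_mem_vertexStar x
  have hx' := (isOpen_vertexStar (notMem_whole k)).mem_nhds hx
  have h1 : ContMDiffOn (modelC n) 𝓘(ℝ, ℝ) ∞
      (fun x => secT k x * Psi k (secV k x) (secT k x)) (vertexStar k) :=
    (contDiff_snd.contDiffOn.mul (contDiffOn_Psi k)).contMDiffOn.comp (contMDiffOn_secVT k)
      fun _ hx => sec_mem_polarDomain hx
  refine (h1.contMDiffAt hx').congr_of_eventuallyEq ?_
  filter_upwards [hx'] with z hz
  conv_lhs => rw [← paramC_sec hz]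
  exact F_paramC (sec_mem_polarDomain hz)

end

section

variable {n : ℕ} {J : Face n} {k : Fin (n + 2)} {L : Submodule ℝ (NR n)}

/-! ### The projection to a face -/

/-- The projection of vectors to the directions of `E_J` along `L`. -/
def dirProj (hL : IsCompl L (tangentDir J)) : NR n →L[ℝ] tangentDir J :=
  ((tangentDir J).projectionOnto L hL.symm).toContinuousLinearMap

lemma sub_dirProj_mem (hL : IsCompl L (tangentDir J)) (v : NR n) :
    v - (dirProj hL v : NR n) ∈ L := by
  rw [← Submodule.projectionOnto_apply_eq_zero_iff hL.symm, map_sub,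
    Submodule.projectionOnto_apply_left]
  exact sub_self _

lemma dirProj_eq (hL : IsCompl L (tangentDir J)) {v : NR n} {w : tangentDir J}
    (h : v - (w : NR n) ∈ L) : dirProj hL v = w := by
  rw [← Submodule.projectionOnto_apply_eq_zero_iff hL.symm, map_sub,
    Submodule.projectionOnto_apply_left, sub_eq_zero] at h
  exact h

lemma mem_tangentDir_of_mem_openSimplex (hk : k ∉ J.1) {y : NR n} (hy : y ∈ openSimplex J.1) :
    y - p n k ∈ tangentDir J :=
  ((mem_openSimplex_iff hk y).1 hy).1

lemma mem_polarDomain_of_openSimplex (hk : k ∉ J.1) {w : NR n} {t c : ℝ}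
    (hc : 0 < c) (ht : |t| = c) (h : p n k + c • w ∈ openSimplex J.1) : (w, t) ∈ polarDomain J k := by
  obtain ⟨-, h2, h3⟩ := (mem_openSimplex_iff hk _).1 h
  rw [add_sub_cancel_left] at h2 h3
  refine ⟨fun i hi hik => ?_, ?_⟩
  · have := h2 i hi hik
    rw [dotProduct_smul, smul_eq_mul] at this
    exact pos_of_mul_pos_right this hc.le
  · rwa [radius_smul, ← ht] at h3

/-- The projection in polar coordinates. -/
lemma isProj_paramC_iff (hL : IsCompl L (tangentDir J)) (hk : k ∉ J.1) {v : NR n} {t : ℝ}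
    (h : (v, t) ∈ polarDomain (whole n) k) (x' : BlowUp J) :
    IsProj L (paramC k v t) x' ↔
      (dirProj hL v, t) ∈ paramDomain J k ∧ x' = param hk (dirProj hL v, t) := by
  have hq : ((⟨v, mem_tangentDir_whole v⟩ : tangentDir (whole n)), t) ∈ paramDomain (whole n) k := h
  have hsub := sub_dirProj_mem hL v
  rcases lt_trichotomy t 0 with ht | ht | ht
  · obtain ⟨hy, e⟩ := param_of_neg (notMem_whole k) hq ht
    rw [paramC, e]
    constructor
    · intro hp
      cases x' with
      | plus y' hy' => exact hp.elim
      | exc k' hk' m hm => exact hp.elim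
      | minus y' hy' =>
        have hT := mem_tangentDir_of_mem_openSimplex hk hy'
        have h1 : (-t) • v - ((⟨y' - p n k, hT⟩ : tangentDir J) : NR n) ∈ L := by
          have e1 : (-t) • v - (y' - p n k) = p n k - t • v - y' := by
            rw [neg_smul]
            abel
          change (-t) • v - (y' - p n k) ∈ L
          rw [e1]
          exact hp
        have h2 := dirProj_eq hL h1
        rw [map_smul] at h2
        have h3 : p n k + (-t) • (dirProj hL v : NR n) = y' := by
          rw [← Submodule.coe_smul, h2]
          simp
        have hd : (dirProj hL v, t) ∈ paramDomain J k :=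
          mem_polarDomain_of_openSimplex hk (neg_pos.2 ht) (abs_of_neg ht) (h3 ▸ hy')
        refine ⟨hd, ?_⟩
        obtain ⟨hy'', e'⟩ := param_of_neg hk hd ht
        rw [e']
        exact minus_congr _ _ (by rw [← h3, neg_smul, sub_eq_add_neg])
    · rintro ⟨hd, rfl⟩
      obtain ⟨hy'', e'⟩ := param_of_neg hk hd ht
      rw [e']
      change p n k - t • v - (p n k - t • (dirProj hL v : NR n)) ∈ L
      have : p n k - t • v - (p n k - t • (dirProj hL v : NR n))
          = (-t) • (v - (dirProj hL v : NR n)) := by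
        rw [neg_smul, smul_sub]
        abel
      rw [this]
      exact L.smul_mem _ hsub
  · obtain ⟨hy, e⟩ := param_of_zero (notMem_whole k) hq ht
    rw [paramC, e]
    constructor
    · intro hp
      cases x' with
      | plus y' hy' => exact hp.elim
      | minus y' hy' => exact hp.elim
      | exc k' hk' m hm =>
        obtain ⟨rfl, c, hc, hp⟩ := hp
        obtain ⟨h1, h2, h3⟩ := (mem_openSimplex_insert_iff hk' m).1 hm
        rw [add_sub_cancel_left] at hp
        have hr := radius_pos_of_mem hq
        have hT : m - p n k ∈ tangentDir J := h1
        -- The facet point given by `param_of_zero` comes from v divided by its radius, so the scale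
        -- c of the projected ray becomes `radius k v * c` for v itself.
        have h5 : v - (((radius k v * c) • ⟨m - p n k, hT⟩ : tangentDir J) : NR n) ∈ L := by
          have := L.smul_mem (radius k v) hp
          rwa [smul_sub, smul_smul, mul_inv_cancel₀ hr.ne', one_smul, smul_smul] at this
        have h6 : (dirProj hL v : NR n) = (radius k v * c) • (m - p n k) := by
          rw [dirProj_eq hL h5]
          rfl
        have hcr : 0 < radius k v * c := mul_pos hr hc
        have hd : (dirProj hL v, t) ∈ paramDomain J k := by
          refine ⟨fun i hi hik => ?_, ?_⟩
          · simp only [h6, dotProduct_smul]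
            exact mul_pos hcr (h2 i hi hik)
          · simp [ht]
        refine ⟨hd, ?_⟩
        obtain ⟨hm', e'⟩ := param_of_zero hk hd ht
        rw [e']
        refine exc_congr _ _ _ ?_
        simp only
        rw [h6, radius_smul, h3, mul_one, smul_smul, inv_mul_cancel₀ hcr.ne', one_smul,
          add_sub_cancel]
    · rintro ⟨hd, rfl⟩
      obtain ⟨hm', e'⟩ := param_of_zero hk hd ht
      rw [e']
      have hr := radius_pos_of_mem hq
      have hr' := radius_pos_of_mem hd
      refine ⟨rfl, (radius k v)⁻¹ * radius k (dirProj hL v : NR n),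
        mul_pos (inv_pos.2 hr) hr', ?_⟩
      simp only [add_sub_cancel_left]
      rw [smul_smul, mul_assoc, mul_inv_cancel₀ hr'.ne', mul_one, ← smul_sub]
      exact L.smul_mem _ hsub
  · obtain ⟨hy, e⟩ := param_of_pos (notMem_whole k) hq ht
    rw [paramC, e]
    constructor
    · intro hp
      cases x' with
      | minus y' hy' => exact hp.elim
      | exc k' hk' m hm => exact hp.elim
      | plus y' hy' =>
        have hT := mem_tangentDir_of_mem_openSimplex hk hy'
        have h1 : t • v - ((⟨y' - p n k, hT⟩ : tangentDir J) : NR n) ∈ L := by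
          have e1 : t • v - (y' - p n k) = p n k + t • v - y' := by abel
          change t • v - (y' - p n k) ∈ L
          rw [e1]
          exact hp
        have h2 := dirProj_eq hL h1
        rw [map_smul] at h2
        have h3 : p n k + t • (dirProj hL v : NR n) = y' := by
          rw [← Submodule.coe_smul, h2]
          simp
        have hd : (dirProj hL v, t) ∈ paramDomain J k :=
          mem_polarDomain_of_openSimplex hk ht (abs_of_pos ht) (h3 ▸ hy')
        refine ⟨hd, ?_⟩
        obtain ⟨hy'', e'⟩ := param_of_pos hk hd ht
        rw [e']
        exact plus_congr _ _ h3.symm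
    · rintro ⟨hd, rfl⟩
      obtain ⟨hy'', e'⟩ := param_of_pos hk hd ht
      rw [e']
      change p n k + t • v - (p n k + t • (dirProj hL v : NR n)) ∈ L
      rw [add_sub_add_left_eq_sub, ← smul_sub]
      exact L.smul_mem _ hsub

lemma isProj_mem_vertexStar {x : Ctilde n} {x' : BlowUp J} (h : IsProj L x x') :
    x ∈ vertexStar k ↔ x' ∈ vertexStar k := by
  cases x <;> cases x' <;> first | exact h.elim | skip
  · exact Iff.rfl
  · exact Iff.rfl
  · obtain ⟨rfl, -⟩ := h
    exact Iff.rfl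

/-- In polar coordinates at a vertex of the face the projection is given by a formula, so the choice
made in `yProj` is immaterial. -/
lemma IsProj.unique (hL : IsCompl L (tangentDir J)) {x : Ctilde n} {x₁ x₂ : BlowUp J}
    (h₁ : IsProj L x x₁) (h₂ : IsProj L x x₂) : x₁ = x₂ := by
  obtain ⟨k, hk, hx⟩ := exists_mem_vertexStar x₁
  have hx := (isProj_mem_vertexStar h₁).2 hx
  rw [← paramC_sec hx] at h₁ h₂
  have hm := sec_mem_polarDomain hx
  rw [((isProj_paramC_iff hL hk hm x₁).1 h₁).2, ((isProj_paramC_iff hL hk hm x₂).1 h₂).2]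

lemma isProj_yProj {x : Ctilde n} (hx : x ∈ Utilde J L) : IsProj L x (yProj J L x) := by
  have hx' : ∃ x' : BlowUp J, IsProj L x x' := hx
  rw [yProj, dif_pos hx']
  exact hx'.choose_spec

lemma paramC_mem_Utilde_iff (hL : IsCompl L (tangentDir J)) (hk : k ∉ J.1) {v : NR n} {t : ℝ}
    (h : (v, t) ∈ polarDomain (whole n) k) :
    paramC k v t ∈ Utilde J L ↔ (dirProj hL v, t) ∈ paramDomain J k :=
  ⟨fun ⟨x', hx'⟩ => ((isProj_paramC_iff hL hk h x').1 hx').1,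
    fun hd => ⟨_, (isProj_paramC_iff hL hk h _).2 ⟨hd, rfl⟩⟩⟩

lemma yProj_paramC (hL : IsCompl L (tangentDir J)) (hk : k ∉ J.1) {v : NR n} {t : ℝ}
    (h : (v, t) ∈ polarDomain (whole n) k) (hd : (dirProj hL v, t) ∈ paramDomain J k) :
    yProj J L (paramC k v t) = param hk (dirProj hL v, t) :=
  ((isProj_paramC_iff hL hk h _).1
    (isProj_yProj ((paramC_mem_Utilde_iff hL hk h).2 hd))).2

lemma exists_star_of_mem_Utilde {x : Ctilde n} (hx : x ∈ Utilde J L) :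
    ∃ k, k ∉ J.1 ∧ x ∈ vertexStar k ∧ yProj J L x ∈ vertexStar k := by
  obtain ⟨k, hk, h⟩ := exists_mem_vertexStar (yProj J L x)
  exact ⟨k, hk, (isProj_mem_vertexStar (isProj_yProj hx)).2 h, h⟩

lemma mem_Utilde_iff (hL : IsCompl L (tangentDir J)) (hk : k ∉ J.1) {x : Ctilde n}
    (hx : x ∈ vertexStar k) :
    x ∈ Utilde J L ↔ (dirProj hL (secV k x), secT k x) ∈ paramDomain J k := by
  conv_lhs => rw [← paramC_sec hx]
  exact paramC_mem_Utilde_iff hL hk (sec_mem_polarDomain hx)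

lemma contDiff_dirProj_prod (hL : IsCompl L (tangentDir J)) :
    ContDiff ℝ ∞ fun q : NR n × ℝ => (dirProj hL q.1, q.2) :=
  ((dirProj hL).contDiff.comp contDiff_fst).prodMk contDiff_snd

lemma contMDiffOn_dirProj_sec (hL : IsCompl L (tangentDir J)) (k : Fin (n + 2)) :
    ContMDiffOn (modelC n) 𝓘(ℝ, tangentDir J × ℝ) ∞
      (fun x => (dirProj hL (secV k x), secT k x)) (vertexStar k) :=
  (contDiff_dirProj_prod hL).contMDiff.comp_contMDiffOn (contMDiffOn_secVT k)

lemma isOpen_Utilde (hL : IsCompl L (tangentDir J)) : IsOpen (Utilde J L) := by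
  rw [isOpen_iff_mem_nhds]
  intro x hx
  obtain ⟨k, hk, hxk, -⟩ := exists_star_of_mem_Utilde hx
  have hopen := isOpen_vertexStar (notMem_whole k)
  have h1 := (contMDiffOn_dirProj_sec hL k).continuousOn.continuousAt (hopen.mem_nhds hxk)
  filter_upwards [hopen.mem_nhds hxk, h1.preimage_mem_nhds
    ((isOpen_paramDomain J k).mem_nhds ((mem_Utilde_iff hL hk hxk).1 hx))] with z hz hz'
  exact (mem_Utilde_iff hL hk hz).2 hz'

lemma contMDiffOn_yProj (hL : IsCompl L (tangentDir J)) :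
    ContMDiffOn (modelC n) 𝓘(ℝ, tangentDir J) ∞ (yProj J L) (Utilde J L) := by
  intro x hx
  obtain ⟨k, hk, hxk, -⟩ := exists_star_of_mem_Utilde hx
  have hopen := isOpen_vertexStar (notMem_whole k)
  have h1 := (contMDiffOn_dirProj_sec hL k).contMDiffAt (hopen.mem_nhds hxk)
  have h2 := (contMDiffOn_param hk).contMDiffAt
    ((isOpen_paramDomain J k).mem_nhds ((mem_Utilde_iff hL hk hxk).1 hx))
  refine ContMDiffAt.contMDiffWithinAt ((h2.comp x h1).congr_of_eventuallyEq ?_)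
  filter_upwards [hopen.mem_nhds hxk, (isOpen_Utilde hL).mem_nhds hx] with z hz hzU
  conv_lhs => rw [← paramC_sec hz]
  exact yProj_paramC hL hk (sec_mem_polarDomain hz) ((mem_Utilde_iff hL hk hz).1 hzU)

/-- The projection `x_{J,L}` as a continuous linear map. -/
def xProjL (hL : IsCompl L (tangentDir J)) : MR n →L[ℝ] VJ J := (xProj hL).toContinuousLinearMap

lemma contMDiff_hProj (hL : IsCompl L (tangentDir J)) :
    ContMDiff (modelC n) 𝓘(ℝ, VJ J) ∞ (hProj hL) :=
  (xProjL hL).contDiff.contMDiff.comp contMDiff_h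

lemma contMDiffOn_gProj (hL : IsCompl L (tangentDir J)) :
    ContMDiffOn (modelC n) (modelEV J) ∞ (gProj hL) (Utilde J L) :=
  (contMDiffOn_yProj hL).prodMk (contMDiff_hProj hL).contMDiffOn

end

section

/-! ### An inverse function theorem for injective maps -/

/-- An injective derivative between spaces of equal dimension is invertible, so local smooth
inverses exist; injectivity of f on s glues them to the single inverse `invFunOn`. -/
lemma isOpen_image_and_contDiffOn_invFunOn {E F : Type*} [NormedAddCommGroup E] [NormedSpace ℝ E]
    [FiniteDimensional ℝ E] [NormedAddCommGroup F] [NormedSpace ℝ F] [FiniteDimensional ℝ F]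
    (hdim : Module.finrank ℝ E = Module.finrank ℝ F) {f : E → F} {s : Set E} (hs : IsOpen s)
    (hf : ContDiffOn ℝ ∞ f s) (hinj : InjOn f s)
    (hd : ∀ x ∈ s, Function.Injective (fderiv ℝ f x)) :
    IsOpen (f '' s) ∧ ContDiffOn ℝ ∞ (Function.invFunOn f s) (f '' s) := by
  have : CompleteSpace E := FiniteDimensional.complete ℝ E
  have key : ∀ x ∈ s, f '' s ∈ 𝓝 (f x) ∧ ContDiffAt ℝ ∞ (Function.invFunOn f s) (f x) := by
    intro x hx
    have hfx : ContDiffAt ℝ ∞ f x := hf.contDiffAt (hs.mem_nhds hx)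
    let f' : E ≃L[ℝ] F := (LinearEquiv.ofInjectiveOfFinrankEq (fderiv ℝ f x : E →ₗ[ℝ] F)
      (hd x hx) hdim).toContinuousLinearEquiv
    have hf' : HasFDerivAt f (f' : E →L[ℝ] F) x := by
      convert! (hfx.differentiableAt (by simp)).hasFDerivAt using 1
    have hst : HasStrictFDerivAt f (f' : E →L[ℝ] F) x := hfx.hasStrictFDerivAt' hf' (by simp)
    have him : f '' s ∈ 𝓝 (f x) := by
      rw [← hst.map_nhds_eq_of_equiv]
      exact image_mem_map (hs.mem_nhds hx)
    refine ⟨him, (hfx.to_localInverse hf' (by simp)).congr_of_eventuallyEq ?_⟩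
    have h1 : Tendsto (hst.localInverse f f' x) (𝓝 (f x)) (𝓝 x) := by
      have := hst.localInverse_continuousAt
      rwa [ContinuousAt, hst.localInverse_apply_image] at this
    filter_upwards [him, h1.eventually (hs.mem_nhds hx), hst.eventually_right_inverse]
      with y hy hy1 hy2
    -- The local inverse takes values in s near f x, so injectivity on s forces it to agree with
    -- `invFunOn`.
    exact hinj (Function.invFunOn_mem hy) hy1 ((Function.invFunOn_eq hy).trans hy2.symm)
  constructor
  · rw [isOpen_iff_mem_nhds]
    rintro _ ⟨x, hx, rfl⟩
    exact (key x hx).1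
  · rintro _ ⟨x, hx, rfl⟩
    exact (key x hx).2.contDiffWithinAt

variable {n : ℕ} {J : Face n} {k : Fin (n + 2)} {L : Submodule ℝ (NR n)}

/-! ### The map `g` is a diffeomorphism -/

lemma sub_xProj_mem (hL : IsCompl L (tangentDir J)) (m : MR n) :
    m - (xProj hL m : MR n) ∈ perp L := by
  rw [← Submodule.projectionOnto_apply_eq_zero_iff (isCompl_perp hL), map_sub,
    Submodule.projectionOnto_apply_left]
  exact sub_self _

lemma xProj_eq (hL : IsCompl L (tangentDir J)) {m : MR n} {a : VJ J}
    (h : m - (a : MR n) ∈ perp L) : xProj hL m = a := by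
  rw [← Submodule.projectionOnto_apply_eq_zero_iff (isCompl_perp hL), map_sub,
    Submodule.projectionOnto_apply_left, sub_eq_zero] at h
  exact h

/-- The projection along `perp L` changes m by an element that annihilates L. Hence h_{J,L} carries
exactly the derivatives of F in the directions of L. -/
lemma xProj_dot (hL : IsCompl L (tangentDir J)) (m : MR n) {ξ : NR n} (hξ : ξ ∈ L) :
    (xProj hL m : MR n) ⬝ᵥ ξ = m ⬝ᵥ ξ := by
  have := sub_xProj_mem hL m ξ hξ
  rw [sub_dotProduct, sub_eq_zero] at this
  exact this.symm

lemma VJ_dot_tangentDir (a : VJ J) (w : tangentDir J) : (a : MR n) ⬝ᵥ (w : NR n) = 0 := by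
  have h : (w : NR n) ∈ perp (VJ J) := tangentDir_eq_perp J ▸ w.2
  rw [dotProduct_comm]
  exact h a a.2

/-- The points of `C̃` with given projection to `Ẽ_J`, in polar coordinates, are obtained by adding
elements of `L`. -/
def fibreDomain (J : Face n) (L : Submodule ℝ (NR n)) (k : Fin (n + 2)) :
    Set ((tangentDir J × ℝ) × L) :=
  {q | q.1 ∈ paramDomain J k ∧ ((q.1.1 : NR n) + (q.2 : NR n), q.1.2) ∈ polarDomain (whole n) k}

/-- The map `g` in polar coordinates. -/
def fibreMap (hL : IsCompl L (tangentDir J)) (k : Fin (n + 2)) (q : (tangentDir J × ℝ) × L) :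
    (tangentDir J × ℝ) × VJ J :=
  (q.1, xProjL hL (gradVec k ((q.1.1 : NR n) + (q.2 : NR n)) q.1.2))

lemma contDiff_fibre_add :
    ContDiff ℝ ∞ fun q : (tangentDir J × ℝ) × L => ((q.1.1 : NR n) + (q.2 : NR n), q.1.2) :=
  (((tangentDir J).subtypeL.contDiff.comp (contDiff_fst.comp contDiff_fst)).add
    (L.subtypeL.contDiff.comp contDiff_snd)).prodMk (contDiff_snd.comp contDiff_fst)

lemma isOpen_fibreDomain (J : Face n) (L : Submodule ℝ (NR n)) (k : Fin (n + 2)) :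
    IsOpen (fibreDomain J L k) :=
  ((isOpen_paramDomain J k).preimage continuous_fst).inter
    ((isOpen_polarDomain (whole n) k).preimage contDiff_fibre_add.continuous)

lemma contDiffOn_fibreMap (hL : IsCompl L (tangentDir J)) (k : Fin (n + 2)) :
    ContDiffOn ℝ ∞ (fibreMap hL k) (fibreDomain J L k) := by
  refine contDiff_fst.contDiffOn.prodMk ((xProjL hL).contDiff.comp_contDiffOn ?_)
  exact ContDiffOn.comp (g := fun q : NR n × ℝ => gradVec k q.1 q.2)
    (f := fun q : (tangentDir J × ℝ) × L => ((q.1.1 : NR n) + (q.2 : NR n), q.1.2))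
    (contDiffOn_gradVec k) contDiff_fibre_add.contDiffOn fun q hq => hq.2

/-- A nonzero multiple of v + ℓ lying in L would put the tangent vector v into L, hence v = 0,
although its radius is positive. So the radial degeneracy of the Hessian at t = 0 is never met along
L. -/
lemma ne_smul_of_mem_fibre (hL : IsCompl L (tangentDir J))
    {q : (tangentDir J × ℝ) × L} (hq : q ∈ fibreDomain J L k) {ξ : NR n} (hξ : ξ ∈ L)
    (h0 : ξ ≠ 0) (c : ℝ) : ξ ≠ c • ((q.1.1 : NR n) + (q.2 : NR n)) := by
  intro h
  have hr := radius_pos_of_mem hq.1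
  have h1 : c • (q.1.1 : NR n) ∈ L := by
    have : c • (q.1.1 : NR n) = ξ - c • (q.2 : NR n) := by
      rw [h, smul_add, add_sub_cancel_right]
    rw [this]
    exact L.sub_mem hξ (L.smul_mem _ q.2.2)
  have h2 := Submodule.disjoint_def.1 hL.disjoint _ h1 ((tangentDir J).smul_mem c q.1.1.2)
  rcases smul_eq_zero.1 h2 with hc | hc
  · rw [hc, zero_smul] at h
    exact h0 h
  · rw [hc] at hr
    simp [radius] at hr

lemma injOn_fibreMap (hL : IsCompl L (tangentDir J)) (k : Fin (n + 2)) :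
    InjOn (fibreMap hL k) (fibreDomain J L k) := by
  rintro ⟨q, ℓ₁⟩ h₁ ⟨q', ℓ₂⟩ h₂ h
  obtain rfl : q = q' := congrArg Prod.fst h
  have h' : xProj hL (gradVec k ((q.1 : NR n) + (ℓ₁ : NR n)) q.2) =
      xProj hL (gradVec k ((q.1 : NR n) + (ℓ₂ : NR n)) q.2) := congrArg Prod.snd h
  by_contra hne
  have hξ : ((ℓ₂ - ℓ₁ : L) : NR n) ≠ 0 := by
    intro h0
    apply hne
    rw [Submodule.coe_eq_zero, sub_eq_zero] at h0
    rw [h0]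
  have e : (q.1 : NR n) + (ℓ₁ : NR n) + ((ℓ₂ - ℓ₁ : L) : NR n) = (q.1 : NR n) + (ℓ₂ : NR n) := by
    rw [Submodule.coe_sub]
    abel
  -- Two points with the same image differ by some ξ in L, and strict concavity makes the pairing of
  -- the gradient with ξ strictly smaller at the far end.
  have hlt := gradVec_dot_lt (ξ := ((ℓ₂ - ℓ₁ : L) : NR n)) h₁.2 (by rw [e]; exact h₂.2)
    (ne_smul_of_mem_fibre hL h₁ (ℓ₂ - ℓ₁).2 hξ)
  simp only [e] at hlt
  rw [← xProj_dot hL (gradVec k ((q.1 : NR n) + (ℓ₁ : NR n)) q.2) (ℓ₂ - ℓ₁).2, h',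
    xProj_dot hL _ (ℓ₂ - ℓ₁).2] at hlt
  exact lt_irrefl _ hlt

/-- A kernel vector has no component in the base, so it is some ξ in L. Pairing the derivative of
the second component with ξ gives the Hessian at ξ, which is negative unless ξ = 0. -/
lemma injective_fderiv_fibreMap (hL : IsCompl L (tangentDir J)) {q : (tangentDir J × ℝ) × L}
    (hq : q ∈ fibreDomain J L k) : Function.Injective (fderiv ℝ (fibreMap hL k) q) := by
  have hd : HasFDerivAt (fibreMap hL k) (fderiv ℝ (fibreMap hL k) q) q :=
    (((contDiffOn_fibreMap hL k).contDiffAt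
      ((isOpen_fibreDomain J L k).mem_nhds hq)).differentiableAt (by simp)).hasFDerivAt
  rw [injective_iff_map_eq_zero]
  intro δ hδ
  have h1 : δ.1 = 0 := by
    have e : HasFDerivAt (fun q => (fibreMap hL k q).1) _ q := hd.fst
    have := DFunLike.congr_fun (e.unique hasFDerivAt_fst) δ
    simpa [hδ] using this.symm
  obtain ⟨δ', ξ⟩ := δ
  obtain rfl : δ' = 0 := h1
  by_contra hne
  have hξ : (ξ : NR n) ≠ 0 := by
    intro h0
    rw [Submodule.coe_eq_zero] at h0
    exact hne (by rw [h0]; rfl)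
  have hl : HasDerivAt (fun s : ℝ => q + s • ((0 : tangentDir J × ℝ), ξ))
      ((0 : tangentDir J × ℝ), ξ) 0 := by
    simpa using ((hasDerivAt_id (0 : ℝ)).smul_const ((0 : tangentDir J × ℝ), ξ)).const_add q
  have h0 : q + (0 : ℝ) • ((0 : tangentDir J × ℝ), ξ) = q := by simp
  rw [← h0] at hd
  have h2 := hd.comp_hasDerivAt 0 hl
  rw [h0, hδ] at h2
  let φ : (tangentDir J × ℝ) × VJ J →ₗ[ℝ] ℝ :=
    { toFun := fun z => (z.2 : MR n) ⬝ᵥ (ξ : NR n)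
      map_add' := fun a b => by simp [add_dotProduct]
      map_smul' := fun a b => by simp [smul_dotProduct] }
  have h3 := (LinearMap.toContinuousLinearMap φ).hasFDerivAt.comp_hasDerivAt 0 h2
  rw [map_zero] at h3
  have hmem : (((q.1.1 : NR n) + (q.2 : NR n)) + (0 : ℝ) • (ξ : NR n), q.1.2) ∈
      polarDomain (whole n) k := by
    rw [zero_smul, add_zero]
    exact hq.2
  have h4 := hasDerivAt_gradVec_line hmem
  rw [zero_smul, add_zero] at h4
  have h5 := h4.unique (h3.congr_of_eventuallyEq (Eventually.of_forall fun s => ?_))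
  · exact (hessian_neg hq.2 hξ (ne_smul_of_mem_fibre hL hq ξ.2 hξ)).ne h5
  · simp only [Function.comp, LinearMap.coe_toContinuousLinearMap']
    change _ = (xProj hL _ : MR n) ⬝ᵥ (ξ : NR n)
    rw [xProj_dot hL _ ξ.2]
    simp [add_assoc]

lemma finrank_fibre (hL : IsCompl L (tangentDir J)) :
    Module.finrank ℝ ((tangentDir J × ℝ) × L) = Module.finrank ℝ ((tangentDir J × ℝ) × VJ J) := by
  have h2 := finrank_perp (VJ J)
  rw [← tangentDir_eq_perp] at h2
  have h3 := Submodule.finrank_add_eq_of_isCompl hL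
  have h4 : Module.finrank ℝ (NR n) = n + 1 := by simp
  have h5 : Module.finrank ℝ (tangentDir J) + Module.finrank ℝ (VJ J) = n + 1 := h2
  simp only [Module.finrank_prod]
  omega

lemma fibreMap_open (hL : IsCompl L (tangentDir J)) (k : Fin (n + 2)) :
    IsOpen (fibreMap hL k '' fibreDomain J L k) ∧
      ContDiffOn ℝ ∞ (Function.invFunOn (fibreMap hL k) (fibreDomain J L k))
        (fibreMap hL k '' fibreDomain J L k) :=
  isOpen_image_and_contDiffOn_invFunOn (finrank_fibre hL) (isOpen_fibreDomain J L k)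
    (contDiffOn_fibreMap hL k) (injOn_fibreMap hL k) fun _ hq => injective_fderiv_fibreMap hL hq

/-! ### Passing from `fibreMap` to the global inverse of g -/

/-- The point of `C̃` given by an element of `fibreDomain J L k`. -/
def fibrePoint (k : Fin (n + 2)) (q : (tangentDir J × ℝ) × L) : Ctilde n :=
  paramC k ((q.1.1 : NR n) + (q.2 : NR n)) q.1.2

lemma fibrePoint_spec (hL : IsCompl L (tangentDir J)) (hk : k ∉ J.1)
    {q : (tangentDir J × ℝ) × L} (hq : q ∈ fibreDomain J L k) :
    fibrePoint k q ∈ Utilde J L ∧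
      gProj hL (fibrePoint k q) = (param hk q.1, (fibreMap hL k q).2) := by
  have hπ : dirProj hL ((q.1.1 : NR n) + (q.2 : NR n)) = q.1.1 :=
    dirProj_eq hL (by simp)
  have hd : (dirProj hL ((q.1.1 : NR n) + (q.2 : NR n)), q.1.2) ∈ paramDomain J k := by
    rw [hπ]
    exact hq.1
  refine ⟨(paramC_mem_Utilde_iff hL hk hq.2).2 hd, ?_⟩
  rw [gProj, fibrePoint, yProj_paramC hL hk hq.2 hd, hπ, hProj, h_paramC hq.2]
  rfl

/-- The coordinates of x must be rescaled by the reciprocal of the radius of the projected vector,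
so that the normalized pair is the one of the projection and not the one of x. -/
lemma exists_fibrePoint (hL : IsCompl L (tangentDir J)) (hk : k ∉ J.1) {x : Ctilde n}
    (hx : x ∈ Utilde J L) (hxk : yProj J L x ∈ vertexStar k) :
    ∃ ℓ : L, (sec hk (yProj J L x), ℓ) ∈ fibreDomain J L k ∧
      fibrePoint k (sec hk (yProj J L x), ℓ) = x := by
  have hxs := (isProj_mem_vertexStar (isProj_yProj hx)).2 hxk
  have hm := sec_mem_polarDomain hxs
  have hd := (mem_Utilde_iff hL hk hxs).1 hx
  have hr := radius_pos_of_mem hd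
  have hy : yProj J L x = param hk (dirProj hL (secV k x), secT k x) := by
    conv_lhs => rw [← paramC_sec hxs]
    exact yProj_paramC hL hk hm hd
  set c := (radius k (dirProj hL (secV k x) : NR n))⁻¹ with hc
  have hc0 : 0 < c := inv_pos.2 hr
  have hs : sec hk (yProj J L x) = (c • dirProj hL (secV k x), c⁻¹ * secT k x) := by
    rw [hy, sec_param hk hd, hc, inv_inv, mul_comm]
  have e : ((c • dirProj hL (secV k x) : tangentDir J) : NR n) +
      c • (secV k x - (dirProj hL (secV k x) : NR n)) = c • secV k x := by
    rw [Submodule.coe_smul, ← smul_add, add_sub_cancel]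
  refine ⟨⟨c • (secV k x - (dirProj hL (secV k x) : NR n)),
    L.smul_mem _ (sub_dirProj_mem hL _)⟩, ⟨sec_mem hk hxk, ?_⟩, ?_⟩
  · simp only [hs]
    rw [e]
    exact polarDomain_smul hc0 hm
  · simp only [fibrePoint, hs]
    rw [e]
    conv_rhs => rw [← paramC_sec hxs]
    exact param_smul (notMem_whole k) (q := (⟨secV k x, mem_tangentDir_whole _⟩, secT k x)) hc0.ne'

lemma injOn_gProj (hL : IsCompl L (tangentDir J)) : InjOn (gProj hL) (Utilde J L) := by
  intro x hx z hz h
  have hy : yProj J L x = yProj J L z := congrArg Prod.fst h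
  obtain ⟨k, hk, hxk⟩ := exists_mem_vertexStar (yProj J L x)
  obtain ⟨ℓ, hℓ, e⟩ := exists_fibrePoint hL hk hx hxk
  obtain ⟨ℓ', hℓ', e'⟩ := exists_fibrePoint hL hk hz (hy ▸ hxk)
  rw [← e, ← e', (fibrePoint_spec hL hk hℓ).2, (fibrePoint_spec hL hk hℓ').2] at h
  have := injOn_fibreMap hL k hℓ hℓ' (Prod.ext (by simp [fibreMap, hy]) (Prod.ext_iff.1 h).2)
  rw [← e, ← e', this]

/-- The inverse of `g`. -/
def gInv (hL : IsCompl L (tangentDir J)) : BlowUp J × VJ J → Ctilde n :=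
  Function.invFunOn (gProj hL) (Utilde J L)

lemma gInv_gProj (hL : IsCompl L (tangentDir J)) {x : Ctilde n} (hx : x ∈ Utilde J L) :
    gInv hL (gProj hL x) = x :=
  (injOn_gProj hL).leftInvOn_invFunOn hx

lemma mem_image_gProj_iff (hL : IsCompl L (tangentDir J)) (hk : k ∉ J.1) {z : BlowUp J × VJ J}
    (hz : z.1 ∈ vertexStar k) :
    z ∈ gProj hL '' Utilde J L ↔ (sec hk z.1, z.2) ∈ fibreMap hL k '' fibreDomain J L k := by
  constructor
  · rintro ⟨x, hx, rfl⟩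
    obtain ⟨ℓ, hℓ, e⟩ := exists_fibrePoint hL hk hx hz
    refine ⟨_, hℓ, Prod.ext rfl ?_⟩
    have := (fibrePoint_spec hL hk hℓ).2
    rw [e] at this
    exact (congrArg Prod.snd this).symm
  · rintro ⟨q, hq, e⟩
    have h := fibrePoint_spec hL hk hq
    refine ⟨_, h.1, ?_⟩
    have e1 : q.1 = sec hk z.1 := congrArg Prod.fst e
    rw [h.2, e, e1, param_sec hk hz]

/-- On the star of `p_k` the inverse of g is the inverse of `fibreMap` between smooth coordinate
maps, from which its smoothness follows. -/
lemma gInv_eq (hL : IsCompl L (tangentDir J)) (hk : k ∉ J.1) {z : BlowUp J × VJ J}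
    (hz : z ∈ gProj hL '' Utilde J L) (hzk : z.1 ∈ vertexStar k) :
    gInv hL z = fibrePoint k (Function.invFunOn (fibreMap hL k) (fibreDomain J L k)
      (sec hk z.1, z.2)) := by
  have h := (mem_image_gProj_iff hL hk hzk).1 hz
  have hq := Function.invFunOn_mem h
  have e := Function.invFunOn_eq h
  set q := Function.invFunOn (fibreMap hL k) (fibreDomain J L k) (sec hk z.1, z.2)
  have hs := fibrePoint_spec hL hk hq
  rw [← gInv_gProj hL hs.1, hs.2, e]
  have e1 : q.1 = sec hk z.1 := congrArg Prod.fst e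
  rw [e1, param_sec hk hzk]

lemma contMDiff_fst_sec (hk : k ∉ J.1) :
    ContMDiffOn (modelEV J) 𝓘(ℝ, (tangentDir J × ℝ) × VJ J) ∞
      (fun z : BlowUp J × VJ J => (sec hk z.1, z.2)) (Prod.fst ⁻¹' vertexStar k) :=
  ((contMDiffOn_sec hk).comp contMDiffOn_fst fun _ hz => hz).prodMk_space contMDiffOn_snd

lemma isOpen_image_gProj (hL : IsCompl L (tangentDir J)) : IsOpen (gProj hL '' Utilde J L) := by
  rw [isOpen_iff_mem_nhds]
  intro z hz
  obtain ⟨k, hk, hzk⟩ := exists_mem_vertexStar z.1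
  have hopen : IsOpen (Prod.fst ⁻¹' vertexStar k : Set (BlowUp J × VJ J)) :=
    (isOpen_vertexStar hk).preimage continuous_fst
  have h1 := (contMDiff_fst_sec hk).continuousOn.continuousAt (hopen.mem_nhds hzk)
  filter_upwards [hopen.mem_nhds hzk, h1.preimage_mem_nhds ((fibreMap_open hL k).1.mem_nhds
    ((mem_image_gProj_iff hL hk hzk).1 hz))] with y hy hy'
  exact (mem_image_gProj_iff hL hk hy).2 hy'

lemma contMDiffOn_gInv (hL : IsCompl L (tangentDir J)) :
    ContMDiffOn (modelEV J) (modelC n) ∞ (gInv hL) (gProj hL '' Utilde J L) := by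
  intro z hz
  obtain ⟨k, hk, hzk⟩ := exists_mem_vertexStar z.1
  have hopen : IsOpen (Prod.fst ⁻¹' vertexStar k : Set (BlowUp J × VJ J)) :=
    (isOpen_vertexStar hk).preimage continuous_fst
  have hm := (mem_image_gProj_iff hL hk hzk).1 hz
  have h1 := (contMDiff_fst_sec hk).contMDiffAt (hopen.mem_nhds hzk)
  have h2 := ((fibreMap_open hL k).2.contDiffAt
    ((fibreMap_open hL k).1.mem_nhds hm)).contMDiffAt
  have h3 := (contDiff_fibre_add (J := J) (L := L)).contMDiff.contMDiffAt
    (x := Function.invFunOn (fibreMap hL k) (fibreDomain J L k) (sec hk z.1, z.2))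
  have h4 := (contMDiffOn_paramC k).contMDiffAt ((isOpen_polarDomain _ k).mem_nhds
    (Function.invFunOn_mem hm).2)
  have h5 := (ContMDiffAt.comp (g := fun q : NR n × ℝ => paramC k q.1 q.2)
    (f := fun q : (tangentDir J × ℝ) × L => ((q.1.1 : NR n) + (q.2 : NR n), q.1.2))
    _ h4 h3).comp z (h2.comp z h1)
  refine ContMDiffAt.contMDiffWithinAt (h5.congr_of_eventuallyEq ?_)
  filter_upwards [hopen.mem_nhds hzk, (isOpen_image_gProj hL).mem_nhds hz] with y hy hy'
  exact gInv_eq hL hk hy' hy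

lemma gInv_mem (hL : IsCompl L (tangentDir J)) {z : BlowUp J × VJ J}
    (hz : z ∈ gProj hL '' Utilde J L) : gInv hL z ∈ Utilde J L :=
  Function.invFunOn_mem hz

lemma gProj_gInv (hL : IsCompl L (tangentDir J)) {z : BlowUp J × VJ J}
    (hz : z ∈ gProj hL '' Utilde J L) : gProj hL (gInv hL z) = z :=
  Function.invFunOn_eq hz

theorem isDiffeoOnto_gProj (hL : IsCompl L (tangentDir J)) {s : Set (Ctilde n)}
    (hs : IsOpen s) (hsub : s ⊆ Utilde J L) :
    IsDiffeoOnto (modelC n) (modelEV J) (gProj hL) s (gProj hL '' s) := by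
  refine ⟨hs, ?_, (contMDiffOn_gProj hL).mono hsub, gInv hL, mapsTo_image _ _, ?_, ⟨?_, ?_⟩,
    (contMDiffOn_gInv hL).mono (image_mono hsub)⟩
  · have : gProj hL '' s = gProj hL '' Utilde J L ∩ gInv hL ⁻¹' s := by
      ext z
      constructor
      · rintro ⟨x, hx, rfl⟩
        refine ⟨mem_image_of_mem _ (hsub hx), ?_⟩
        rw [mem_preimage, gInv_gProj hL (hsub hx)]
        exact hx
      · rintro ⟨hz, hz'⟩
        exact ⟨_, hz', gProj_gInv hL hz⟩
    rw [this]
    exact (contMDiffOn_gInv hL).continuousOn.isOpen_inter_preimage (isOpen_image_gProj hL) hs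
  · rintro _ ⟨x, hx, rfl⟩
    rw [gInv_gProj hL (hsub hx)]
    exact hx
  · intro x hx
    exact gInv_gProj hL (hsub hx)
  · rintro _ ⟨x, hx, rfl⟩
    rw [gInv_gProj hL (hsub hx)]

end

section

variable {n : ℕ} {J : Face n} {k : Fin (n + 2)} {L : Submodule ℝ (NR n)}

/-! ### Recovering a point of `C̃` from `h` and the lift of the blow-down map -/

/-- The function `x cot x`, extended smoothly to `x = 0`. -/
def mulCot (x : ℝ) : ℝ := Real.cos x / Real.sinc x

/-- The denominator in the formula for `F` in terms of its gradient. -/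
def gradDenom (k : Fin (n + 2)) (w : NR n) : ℝ :=
  ∑ i ∈ Finset.univ.erase k, mulCot (u n i ⬝ᵥ w) -
    (u n k ⬝ᵥ w) * (Real.sin (u n k ⬝ᵥ w) / Real.cos (u n k ⬝ᵥ w))

/-- The coefficients of the gradient `m` at `p_k + w` with respect to the vectors `u_i`. -/
def recCoeff (k i : Fin (n + 2)) (q : MR n × NR n) : ℝ :=
  2 / Real.pi * (q.1 ⬝ᵥ (p n i - p n k)) -
    q.1 ⬝ᵥ q.2 / gradDenom k q.2 * (Real.sin (u n k ⬝ᵥ q.2) / Real.cos (u n k ⬝ᵥ q.2))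

/-- A vector in the direction of `w` that is recovered from the gradient at `p_k + w`. -/
def recVec (k : Fin (n + 2)) (q : MR n × NR n) : NR n :=
  ∑ i ∈ Finset.univ.erase k, (mulCot (u n i ⬝ᵥ q.2) / recCoeff k i q) • (p n i - p n k)

/-- The chart at `p_k` in terms of the gradient at `p_k + w` and `w`. -/
def recChart (k : Fin (n + 2)) (q : MR n × NR n) : NR n :=
  ((1 + radius k q.2) / radius k (recVec k q)) • recVec k q

/-- Because the u_i sum to zero, the gradient determines only the differences of its coefficients,
and these pairings read them off. -/
lemma gradVec_dot_p_sub_p (k i j : Fin (n + 2)) (v : NR n) (t : ℝ) :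
    2 / Real.pi * (gradVec k v t ⬝ᵥ (p n i - p n j)) = gradCoeff k v t i - gradCoeff k v t j := by
  rw [gradVec, sum_dotProduct, Finset.mul_sum]
  have : ∀ l, 2 / Real.pi * ((gradCoeff k v t l • u n l) ⬝ᵥ (p n i - p n j)) =
      gradCoeff k v t l * (if l = i then 1 else 0) - gradCoeff k v t l * (if l = j then 1 else 0) := by
    intro l
    rw [smul_dotProduct, smul_eq_mul, mul_left_comm, dot_p_sub_p, mul_sub]
  simp only [this, Finset.sum_sub_distrib]
  simp

lemma sum_smul_p_sub_p (k : Fin (n + 2)) (v : NR n) :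
    ∑ i ∈ Finset.univ.erase k, (2 / Real.pi * (u n i ⬝ᵥ v)) • (p n i - p n k) = v := by
  have hpi : (2 / Real.pi : ℝ) ≠ 0 := by
    have := Real.pi_pos
    positivity
  refine eq_of_dot_u (k := k) fun j hj => mul_left_cancel₀ hpi ?_
  rw [dotProduct_sum, Finset.mul_sum]
  have : ∀ i ∈ Finset.univ.erase k, 2 / Real.pi * (u n j ⬝ᵥ
      ((2 / Real.pi * (u n i ⬝ᵥ v)) • (p n i - p n k))) =
      if j = i then 2 / Real.pi * (u n i ⬝ᵥ v) else 0 := by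
    intro i _
    rw [dotProduct_smul, smul_eq_mul, mul_left_comm, dot_p_sub_p, if_neg hj]
    simp
  rw [Finset.sum_congr rfl this, Finset.sum_ite_eq, if_pos (by simpa using hj)]

lemma logDer_pos {i : Fin (n + 2)} {v : NR n} {t : ℝ} (h : (v, t) ∈ polarDomain (whole n) k)
    (hi : i ≠ k) : 0 < logDer k i t (u n i ⬝ᵥ v) := by
  have h1 := factor_pos h i
  rw [factor, if_neg hi] at h1
  rw [logDer, if_neg hi]
  refine div_pos ?_ h1
  rw [← Real.cos_abs, abs_mul, abs_of_pos (dot_pos_of_mem h hi)]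
  refine Real.cos_pos_of_mem_Ioo ⟨?_, abs_mul_dot_lt h hi⟩
  have := mul_nonneg (abs_nonneg t) (dot_pos_of_mem h hi).le
  linarith [Real.pi_pos]

lemma gradCoeff_pos {i : Fin (n + 2)} {v : NR n} {t : ℝ} (h : (v, t) ∈ polarDomain (whole n) k)
    (hi : i ≠ k) : 0 < gradCoeff k v t i :=
  mul_pos (div_pos (Psi_pos h) (by positivity)) (logDer_pos h hi)

/-- The product depends on t v alone. Thus t v and the coefficients of the gradient determine the
⟨u_i, v⟩ up to a common factor. -/
lemma logDer_mul_dot {i : Fin (n + 2)} {v : NR n} {t : ℝ}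
    (h : (v, t) ∈ polarDomain (whole n) k) (hi : i ≠ k) :
    logDer k i t (u n i ⬝ᵥ v) * (u n i ⬝ᵥ v) = mulCot (u n i ⬝ᵥ (t • v)) := by
  have h1 := (dot_pos_of_mem h hi).ne'
  rw [logDer, if_neg hi, mulCot, sinQuot, dotProduct_smul, smul_eq_mul]
  field_simp

lemma gradVec_dot_smul {v : NR n} {t : ℝ} (h : (v, t) ∈ polarDomain (whole n) k) :
    gradVec k v t ⬝ᵥ (t • v) = t * Psi k v t / ((n : ℝ) + 1) * gradDenom k (t • v) := by
  rw [dotProduct_smul, gradVec_dot, gradDenom, ← Finset.add_sum_erase _ _ (Finset.mem_univ k),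
    Finset.sum_congr rfl fun i hi => logDer_mul_dot h (Finset.ne_of_mem_erase hi), logDer,
    if_pos rfl, dotProduct_smul, smul_eq_mul, smul_eq_mul]
  ring

/-- The differences of coefficients leave the one at k undetermined. It is -tan⟨u_k, t v⟩ times t
Ψ/(n + 1), and the latter is obtained from the pairing of the gradient with t v by
`gradVec_dot_smul`. -/
lemma recCoeff_eq {v : NR n} {t : ℝ} (h : (v, t) ∈ polarDomain (whole n) k)
    (hd : gradDenom k (t • v) ≠ 0) {i : Fin (n + 2)} :
    recCoeff k i (gradVec k v t, t • v) = gradCoeff k v t i := by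
  rw [recCoeff, gradVec_dot_p_sub_p, gradVec_dot_smul h, mul_div_cancel_right₀ _ hd,
    gradCoeff, gradCoeff, logDer.eq_1 k k, if_pos rfl, dotProduct_smul, smul_eq_mul]
  ring

/-- Dividing `mulCot` by the coefficient leaves ⟨u_i, v⟩ times a positive constant independent of i,
so the vector with these components is a positive multiple of v. -/
lemma recVec_eq {v : NR n} {t : ℝ} (h : (v, t) ∈ polarDomain (whole n) k)
    (hd : gradDenom k (t • v) ≠ 0) :
    recVec k (gradVec k v t, t • v) =
      (Real.pi / 2 * (((n : ℝ) + 1) / Psi k v t)) • v := by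
  obtain ⟨c, hc⟩ : ∃ c, c = Real.pi / 2 * (((n : ℝ) + 1) / Psi k v t) := ⟨_, rfl⟩
  rw [← hc]
  conv_rhs => rw [← sum_smul_p_sub_p k v]
  rw [recVec, Finset.smul_sum]
  refine Finset.sum_congr rfl fun i hi => ?_
  have hi' := Finset.ne_of_mem_erase hi
  have h1 := (logDer_pos h hi').ne'
  have h2 := (Psi_pos h).ne'
  have := Real.pi_pos.ne'
  have : (n : ℝ) + 1 ≠ 0 := by positivity
  rw [recCoeff_eq h hd, smul_smul, gradCoeff]
  simp only
  rw [← logDer_mul_dot h hi', hc]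
  congr 1
  field_simp

lemma radius_recVec {v : NR n} {t : ℝ} (h : (v, t) ∈ polarDomain (whole n) k)
    (hd : gradDenom k (t • v) ≠ 0) : 0 < radius k (recVec k (gradVec k v t, t • v)) := by
  have hr := radius_pos_of_mem (J := whole n) (k := k) (q := (⟨v, mem_tangentDir_whole v⟩, t)) h
  have := Psi_pos h
  have := Real.pi_pos
  rw [recVec_eq h hd, radius_smul]
  exact mul_pos (by positivity) hr

lemma recChart_eq {v : NR n} {t : ℝ} (h : (v, t) ∈ polarDomain (whole n) k)
    (hd : gradDenom k (t • v) ≠ 0) :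
    recChart k (gradVec k v t, t • v) = ((1 + t * radius k v) / radius k v) • v := by
  have h1 := radius_recVec h hd
  have hr : 0 < radius k v :=
    radius_pos_of_mem (J := whole n) (k := k) (q := (⟨v, mem_tangentDir_whole v⟩, t)) h
  rw [recChart, recVec_eq h hd]
  rw [recVec_eq h hd] at h1
  rw [radius_smul] at h1 ⊢
  have h2 := left_ne_zero_of_mul h1.ne'
  rw [radius_smul, smul_smul]
  congr 1
  have := hr.ne'
  have := (Psi_pos h).ne'
  field_simp

lemma mulCot_zero : mulCot 0 = 1 := by simp [mulCot]

lemma gradDenom_zero (k : Fin (n + 2)) : gradDenom k (0 : NR n) = n + 1 := by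
  simp [gradDenom, mulCot_zero]

lemma contDiffAt_mulCot_dot (i : Fin (n + 2)) :
    ContDiffAt ℝ ∞ (fun w : NR n => mulCot (u n i ⬝ᵥ w)) 0 :=
  (Real.contDiff_cos.comp (contDiff_dot_u i)).contDiffAt.div
    (contDiff_sinc.comp (contDiff_dot_u i)).contDiffAt (by simp)

lemma contDiffAt_tan_dot (i : Fin (n + 2)) :
    ContDiffAt ℝ ∞ (fun w : NR n => Real.sin (u n i ⬝ᵥ w) / Real.cos (u n i ⬝ᵥ w)) 0 :=
  (Real.contDiff_sin.comp (contDiff_dot_u i)).contDiffAt.div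
    (Real.contDiff_cos.comp (contDiff_dot_u i)).contDiffAt (by simp)

lemma contDiffAt_gradDenom (k : Fin (n + 2)) : ContDiffAt ℝ ∞ (gradDenom k : NR n → ℝ) 0 :=
  (ContDiffAt.sum fun i _ => contDiffAt_mulCot_dot i).sub
    ((contDiff_dot_u k).contDiffAt.mul (contDiffAt_tan_dot k))

lemma contDiff_dotProduct : ContDiff ℝ ∞ fun q : MR n × NR n => q.1 ⬝ᵥ q.2 := by
  unfold dotProduct
  fun_prop

lemma contDiffAt_recCoeff (k i : Fin (n + 2)) (m : MR n) :
    ContDiffAt ℝ ∞ (recCoeff k i) (m, (0 : NR n)) := by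
  have h1 : ContDiffAt ℝ ∞ (fun q : MR n × NR n => gradDenom k q.2) (m, (0 : NR n)) :=
    ContDiffAt.comp (m, (0 : NR n)) (g := gradDenom k) (f := Prod.snd) (contDiffAt_gradDenom k)
      contDiffAt_snd
  have h2 : ContDiffAt ℝ ∞ (fun q : MR n × NR n => Real.sin (u n k ⬝ᵥ q.2) /
      Real.cos (u n k ⬝ᵥ q.2)) (m, (0 : NR n)) :=
    ContDiffAt.comp (m, (0 : NR n)) (f := Prod.snd)
      (g := fun w : NR n => Real.sin (u n k ⬝ᵥ w) / Real.cos (u n k ⬝ᵥ w)) (contDiffAt_tan_dot k)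
      contDiffAt_snd
  have h3 : ContDiff ℝ ∞ fun q : MR n × NR n => q.1 ⬝ᵥ (p n i - p n k) :=
    contDiff_dotProduct.comp (contDiff_fst.prodMk contDiff_const)
  refine (contDiffAt_const.mul h3.contDiffAt).sub
    ((contDiff_dotProduct.contDiffAt.div h1 ?_).mul h2)
  simp only [gradDenom_zero]
  positivity

lemma contDiffAt_recChart (k : Fin (n + 2)) {m : MR n}
    (h1 : ∀ i, i ≠ k → recCoeff k i (m, (0 : NR n)) ≠ 0)
    (h2 : radius k (recVec k (m, (0 : NR n))) ≠ 0) :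
    ContDiffAt ℝ ∞ (recChart k) (m, (0 : NR n)) := by
  have hV : ContDiffAt ℝ ∞ (recVec k) (m, (0 : NR n)) := by
    refine ContDiffAt.sum fun i hi => ContDiffAt.smul (ContDiffAt.div ?_ (contDiffAt_recCoeff k i m)
      (h1 i (Finset.ne_of_mem_erase hi))) contDiffAt_const
    exact ContDiffAt.comp (m, (0 : NR n)) (f := Prod.snd)
      (g := fun w : NR n => mulCot (u n i ⬝ᵥ w)) (contDiffAt_mulCot_dot i) contDiffAt_snd
  have hr : ContDiffAt ℝ ∞ (fun q : MR n × NR n => 1 + radius k q.2) (m, (0 : NR n)) :=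
    (contDiff_const.add ((contDiff_radius k).comp contDiff_snd)).contDiffAt
  exact (hr.div ((contDiff_radius k).contDiffAt.comp _ hV) h2).smul hV

lemma starChart_eq_sec {x : Ctilde n} (hx : x ∈ vertexStar k) :
    (starChart (notMem_whole k) x : NR n) =
      ((1 + secT k x * radius k (secV k x)) / radius k (secV k x)) • secV k x := by
  have h := starChart_param (notMem_whole k) (sec_mem (notMem_whole k) hx)
  rw [param_sec (notMem_whole k) hx] at h
  rw [h]
  rfl

lemma lift_eq_sec {x : Ctilde n} (hx : x ∈ vertexStar k) :
    lift k x = p n k + secT k x • secV k x :=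
  lift_sub_p_eq (notMem_whole k) hx

/-- On the star of a vertex, the chart is locally a smooth function of `h` and of the lift of the
blow-down map. -/
lemma exists_chart_eq {x₀ : Ctilde n} (hx₀ : x₀ ∈ vertexStar k) :
    ∃ R : MR n × NR n → tangentDir (whole n), ContDiffAt ℝ ∞ R (h n x₀, lift k x₀) ∧
      ∀ᶠ q in 𝓝 (h n x₀, lift k x₀), ∀ x ∈ (vertexStar k : Set (Ctilde n)),
        (h n x, lift k x) = q → R q = starChart (notMem_whole k) x := by
  let e : NR n →L[ℝ] tangentDir (whole n) :=
    (LinearMap.codRestrict _ LinearMap.id mem_tangentDir_whole).toContinuousLinearMap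
  have he : ∀ w : tangentDir (whole n), e (w : NR n) = w := fun w => rfl
  have hr₀ : radius k (secV k x₀) = 1 := radius_sec (notMem_whole k) hx₀
  -- On the exceptional fibre the direction has to be recovered from the gradient through
  -- `recChart`. Elsewhere the lift suffices: t is the radius of t v when v is normalized.
  by_cases ht : secT k x₀ = 0
  · have hl₀ : lift k x₀ = p n k := by rw [lift_eq_sec hx₀, ht, zero_smul, add_zero]
    have hm := sec_mem_polarDomain hx₀
    rw [ht] at hm
    have hd : gradDenom k ((0 : ℝ) • secV k x₀) ≠ 0 := by
      rw [zero_smul, gradDenom_zero]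
      positivity
    have h1 : h n x₀ = gradVec k (secV k x₀) 0 := by rw [h_eq_gradVec_sec hx₀, ht]
    have hsub : ContDiff ℝ ∞ fun q : MR n × NR n => (q.1, q.2 - p n k) := by fun_prop
    refine ⟨fun q => e (recChart k (q.1, q.2 - p n k)), ?_, ?_⟩
    · refine e.contDiff.contDiffAt.comp _ (ContDiffAt.comp (g := recChart k)
        (f := fun q : MR n × NR n => (q.1, q.2 - p n k)) _ ?_ hsub.contDiffAt)
      simp only [hl₀, sub_self, h1]
      refine contDiffAt_recChart k (fun i hi => ?_) ?_
      · have := recCoeff_eq hm hd (i := i)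
        rw [zero_smul] at this
        rw [this]
        exact (gradCoeff_pos hm hi).ne'
      · have := (radius_recVec hm hd).ne'
        rwa [zero_smul] at this
    · have hc : ContinuousAt (fun q : MR n × NR n => gradDenom k (q.2 - p n k))
          (h n x₀, lift k x₀) := by
        refine ContinuousAt.comp (g := gradDenom k) (f := fun q : MR n × NR n => q.2 - p n k)
          ?_ (by fun_prop)
        simp only [hl₀, sub_self]
        exact (contDiffAt_gradDenom k).continuousAt
      filter_upwards [hc.eventually_ne (show gradDenom k (lift k x₀ - p n k) ≠ 0 by
        rw [hl₀, sub_self, gradDenom_zero]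
        positivity)] with q hq x hx hxq
      subst hxq
      have hs : lift k x - p n k = secT k x • secV k x := by
        rw [lift_eq_sec hx, add_sub_cancel_left]
      rw [← he (starChart (notMem_whole k) x)]
      simp only [hs] at hq ⊢
      rw [h_eq_gradVec_sec hx, recChart_eq (sec_mem_polarDomain hx) hq, starChart_eq_sec hx]
  · have hrc : ContDiff ℝ ∞ fun q : MR n × NR n => radius k (q.2 - p n k) :=
      (contDiff_radius k).comp (contDiff_snd.sub contDiff_const)
    have hrl : ∀ x ∈ (vertexStar k : Set (Ctilde n)), radius k (lift k x - p n k) = secT k x := by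
      intro x hx
      have hr : radius k (secV k x) = 1 := radius_sec (notMem_whole k) hx
      rw [lift_eq_sec hx, add_sub_cancel_left, radius_smul, hr, mul_one]
    refine ⟨fun q => e (((1 + radius k (q.2 - p n k)) / radius k (q.2 - p n k)) •
      (q.2 - p n k)), ?_, ?_⟩
    · refine e.contDiff.contDiffAt.comp _ (ContDiffAt.smul (ContDiffAt.div
        (contDiffAt_const.add hrc.contDiffAt) hrc.contDiffAt ?_)
        (contDiffAt_snd.sub contDiffAt_const))
      simp only [hrl x₀ hx₀]
      exact ht
    · filter_upwards [hrc.continuous.continuousAt.eventually_ne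
        (show radius k (lift k x₀ - p n k) ≠ 0 by rwa [hrl x₀ hx₀])] with q hq x hx hxq
      subst hxq
      rw [← he (starChart (notMem_whole k) x)]
      simp only [hrl x hx] at hq ⊢
      have hr : radius k (secV k x) = 1 := radius_sec (notMem_whole k) hx
      rw [starChart_eq_sec hx, lift_eq_sec hx, add_sub_cancel_left, smul_smul, hr, mul_one, div_one,
        div_mul_cancel₀ _ hq]

/-! ### The embedding `Φ` -/

lemma eq_of_toTorus_eq {a b : NR n} (h : toTorus a = toTorus b) (hlt : ∀ j, |a j - b j| < Real.pi) :
    a = b := by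
  funext j
  have h1 : ((a j : ℝ) : AddCircle Real.pi) = b j := congrFun h j
  rw [← sub_eq_zero, ← AddCircle.coe_sub, AddCircle.coe_eq_zero_iff] at h1
  obtain ⟨m, hm⟩ := h1
  have h2 := hlt j
  rw [← hm, zsmul_eq_mul, abs_mul, abs_of_pos Real.pi_pos] at h2
  have h3 : |(m : ℝ)| < 1 := by
    have := Real.pi_pos
    nlinarith
  have h4 : m = 0 := by
    rw [← Int.abs_lt_one_iff]
    exact_mod_cast h3
  rw [h4, zero_smul] at hm
  linarith

/-- The star lifts into the open cube of side π centred at `p_k`, on which the projection to the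
torus is injective. -/
lemma abs_lift_sub_lt {x : Ctilde n} (hx : x ∈ vertexStar k) (j : Fin (n + 1)) :
    |lift k x j - p n k j| < Real.pi / 2 := by
  have hm := sec_mem_polarDomain hx
  have e : lift k x j - p n k j = secT k x * (u n j.succ ⬝ᵥ secV k x) := by
    rw [lift_eq_sec hx, dot_u_succ]
    simp
  rw [e, abs_mul]
  by_cases hj : j.succ = k
  · rw [hj, abs_of_neg (dot_vertex_neg hm)]
    exact abs_mul_dot_vertex_lt hm
  · rw [abs_of_pos (dot_pos_of_mem hm hj)]
    exact abs_mul_dot_lt hm hj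

lemma p_apply (k : Fin (n + 2)) (j : Fin (n + 1)) : p n k j = 0 ∨ p n k j = Real.pi / 2 := by
  refine Fin.cases (Or.inl rfl) (fun i => ?_) k
  by_cases h : j = i
  · subst h
    exact Or.inr (by simp [p])
  · exact Or.inl (by simp [p, h])

/-- If the image were another vertex, the lift would be equal to that vertex, whose radius as seen
from `p_k` is one; but |t| < 1 on the star. -/
lemma proj_ne_p {x : Ctilde n} (hx : x ∈ vertexStar k) {k' : Fin (n + 2)} (hk : k' ≠ k) :
    proj x ≠ toTorus (p n k') := by
  intro h
  rw [← toTorus_lift k] at h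
  have h1 := eq_of_toTorus_eq h fun j => by
    have h2 := abs_lift_sub_lt hx j
    have h3 : |p n k j - p n k' j| ≤ Real.pi / 2 := by
      have := Real.pi_pos
      rcases p_apply k j with h | h <;> rcases p_apply k' j with h' | h' <;> rw [h, h', abs_le] <;>
        constructor <;> linarith
    calc |lift k x j - p n k' j| = |(lift k x j - p n k j) + (p n k j - p n k' j)| := by ring_nf
      _ ≤ |lift k x j - p n k j| + |p n k j - p n k' j| := abs_add_le _ _
      _ < Real.pi := by linarith
  have hr : radius k (secV k x) = 1 := radius_sec (notMem_whole k) hx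
  have h4 : radius k (lift k x - p n k) = secT k x := by
    rw [lift_eq_sec hx, add_sub_cancel_left, radius_smul, hr, mul_one]
  rw [h1, radius_sub_p, bary_p, if_neg hk.symm, sub_zero] at h4
  have h5 := (sec_mem_polarDomain hx).2
  simp only [hr, ← h4] at h5
  norm_num at h5

lemma mem_vertexStar_of_proj {x : Ctilde n}
    (h : ∀ k', k' ≠ k → proj x ≠ toTorus (p n k')) : x ∈ vertexStar k := by
  cases x with
  | plus y hy => trivial
  | minus y hy => trivial
  | exc k' hk' m hm =>
    by_contra hne
    exact h k' hne rfl

lemma injective_Phi : Function.Injective (Phi (n := n)) := by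
  intro x z hxz
  have h1 : h n x = h n z := congrArg Prod.fst hxz
  have h2 : proj x = proj z := congrArg Prod.snd hxz
  obtain ⟨k, -, hx⟩ := exists_mem_vertexStar x
  have hz : z ∈ vertexStar k := mem_vertexStar_of_proj fun k' hk' => h2 ▸ proj_ne_p hx hk'
  have h3 : lift k x = lift k z := by
    refine eq_of_toTorus_eq (by rw [toTorus_lift, toTorus_lift, h2]) fun j => ?_
    have h4 := abs_lt.1 (abs_lift_sub_lt hx j)
    have h5 := abs_lt.1 (abs_lift_sub_lt hz j)
    rw [abs_lt]
    constructor <;> linarith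
  obtain ⟨R, -, hR⟩ := exists_chart_eq hx
  have hR := hR.self_of_nhds
  refine (starChart (notMem_whole k)).injOn hx hz ?_
  rw [← hR x hx rfl, hR z hz (by rw [h1, h3])]

lemma continuous_toTorus : Continuous (toTorus (n := n)) :=
  continuous_pi fun j => (AddCircle.continuous_mk' Real.pi).comp (continuous_apply j)

lemma continuous_proj : Continuous (proj : BlowUp J → Torus n) := by
  rw [continuous_iff_continuousAt]
  intro x
  obtain ⟨k, hk, hx⟩ := exists_mem_vertexStar x
  have h1 := (contMDiffOn_lift hk).continuousOn.continuousAt ((isOpen_vertexStar hk).mem_nhds hx)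
  have h2 := continuous_toTorus.continuousAt.comp h1
  refine h2.congr (Eventually.of_forall fun z => toTorus_lift k z)

lemma continuous_Phi : Continuous (Phi (n := n)) :=
  contMDiff_h.continuous.prodMk continuous_proj

theorem isEmbedding_Phi : IsEmbedding (Phi (n := n)) := by
  refine ⟨isInducing_iff_nhds.2 fun x₀ => le_antisymm
    (map_le_iff_le_comap.1 continuous_Phi.continuousAt) ?_, injective_Phi⟩
  obtain ⟨k, -, hx₀⟩ := exists_mem_vertexStar x₀
  -- It remains to see that x tends to x₀ along the filter of points whose image tends to that of
  -- x₀; the chart is recovered from h and from the lift.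
  set l := comap Phi (𝓝 (Phi x₀)) with hl
  have hPhi : Tendsto Phi l (𝓝 (Phi x₀)) := tendsto_comap
  have hh : Tendsto (h n) l (𝓝 (h n x₀)) := (continuous_fst.tendsto _).comp hPhi
  have hp : Tendsto proj l (𝓝 (proj x₀)) := (continuous_snd.tendsto _).comp hPhi
  have hstar : ∀ᶠ x in l, x ∈ (vertexStar k : Set (Ctilde n)) := by
    have : ∀ᶠ x in l, ∀ k', k' ≠ k → proj x ≠ toTorus (p n k') := by
      rw [eventually_all]
      intro k'
      by_cases hk' : k' = k
      · exact Eventually.of_forall fun _ h => absurd hk' h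
      · filter_upwards [hp.eventually_ne (proj_ne_p hx₀ hk')] with x hx _ using hx
    exact this.mono fun x hx => mem_vertexStar_of_proj hx
  have hlift : Tendsto (lift k) l (𝓝 (lift k x₀)) := by
    rw [tendsto_pi_nhds]
    intro j
    have : Fact (0 < Real.pi) := ⟨Real.pi_pos⟩
    -- The circle minus a point lifts continuously to the interval of length π centred at the j-th
    -- coordinate of `p_k`, which contains that coordinate of the lift.
    let e := AddCircle.openPartialHomeomorphCoe Real.pi (p n k j - Real.pi / 2)
    have hmem : ∀ x ∈ (vertexStar k : Set (Ctilde n)), lift k x j ∈ e.source := by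
      intro x hx
      have := abs_lt.1 (abs_lift_sub_lt hx j)
      change lift k x j ∈ Ioo (p n k j - Real.pi / 2) (p n k j - Real.pi / 2 + Real.pi)
      constructor <;> linarith
    have he : ∀ x ∈ (vertexStar k : Set (Ctilde n)), e.symm (proj x j) = lift k x j := by
      intro x hx
      rw [← toTorus_lift k x]
      exact e.left_inv (hmem x hx)
    have ht : proj x₀ j ∈ e.target := by
      rw [← toTorus_lift k x₀]
      exact e.map_source (hmem x₀ hx₀)
    have h1 := (e.continuousAt_symm ht).tendsto.comp (tendsto_pi_nhds.1 hp j)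
    rw [he x₀ hx₀] at h1
    exact h1.congr' (hstar.mono fun x hx => he x hx)
  obtain ⟨R, hRc, hR⟩ := exists_chart_eq hx₀
  have h1 := hh.prodMk_nhds hlift
  have h2 : Tendsto (fun x => (starChart (notMem_whole k)).symm (R (h n x, lift k x))) l
      (𝓝 ((starChart (notMem_whole k)).symm (starChart (notMem_whole k) x₀))) := by
    rw [← hR.self_of_nhds x₀ hx₀ rfl]
    refine Tendsto.comp ?_ (hRc.continuousAt.tendsto.comp h1)
    rw [hR.self_of_nhds x₀ hx₀ rfl]
    exact (starChart (notMem_whole k)).continuousAt_symm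
      ((starChart (notMem_whole k)).map_source hx₀)
  rw [(starChart (notMem_whole k)).left_inv hx₀] at h2
  refine (tendsto_id'.1 (h2.congr' ?_))
  filter_upwards [hstar, h1.eventually hR] with x hx hRx
  rw [hRx x hx rfl]
  exact (starChart (notMem_whole k)).left_inv hx

end

section

variable {n : ℕ} {J : Face n} {k : Fin (n + 2)} {L : Submodule ℝ (NR n)}

/-! ### The Legendre transform -/

/-- A point and its projection lie on the same sheet, so the vectors 2 p_k added by `lift` cancel in
the difference. -/
lemma IsProj.rep_sub {x : Ctilde n} {x' : BlowUp J} (h : IsProj L x x') (k : Fin (n + 2)) :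
    rep x - rep x' = lift k x - lift k x' := by
  cases x <;> cases x' <;> first | exact h.elim | skip
  · rfl
  · simp only [rep, lift]
    abel
  · rfl

lemma IsProj.rep_sub_mem {x : Ctilde n} {x' : BlowUp J} (h : IsProj L x x') :
    rep x - rep x' ∈ L := by
  cases x <;> cases x' <;> first | exact h.elim | skip
  · exact h
  · have e : ∀ a b : NR n, -a - -b = -(a - b) := fun a b => by abel
    rw [rep, rep, e]
    exact L.neg_mem h
  · obtain ⟨rfl, -⟩ := h
    simp [rep]

/-- The difference between a point and its projection, as a function on the image of `g`. -/
def fibreVec (hL : IsCompl L (tangentDir J)) (z : BlowUp J × VJ J) : NR n :=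
  rep (gInv hL z) - rep z.1

/-- The Legendre transform of `F` along `L`. -/
def legendre (hL : IsCompl L (tangentDir J)) (z : BlowUp J × VJ J) : ℝ :=
  (z.2 : MR n) ⬝ᵥ fibreVec hL z - F (gInv hL z)

/-- The projection to `L` along the directions of `E_J`. -/
def fibreProj (hL : IsCompl L (tangentDir J)) : NR n →L[ℝ] L :=
  (L.projectionOnto (tangentDir J) hL).toContinuousLinearMap

/-- The projection to `L^⊥` along `V_J`. -/
def perpProj (hL : IsCompl L (tangentDir J)) : MR n →L[ℝ] perp L :=
  ((perp L).projectionOnto (VJ J) (isCompl_perp hL).symm).toContinuousLinearMap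

lemma coe_fibreProj (hL : IsCompl L (tangentDir J)) {v : NR n} (hv : v ∈ L) :
    (fibreProj hL v : NR n) = v :=
  congrArg Subtype.val (Submodule.projectionOnto_apply_left hL ⟨v, hv⟩)

lemma coe_perpProj (hL : IsCompl L (tangentDir J)) (m : MR n) :
    (perpProj hL m : MR n) = m - (xProj hL m : MR n) := by
  have h := congrArg Subtype.val (Submodule.projectionOnto_apply_left (isCompl_perp hL).symm
    ⟨_, sub_xProj_mem hL m⟩)
  simp only at h
  rw [map_sub, Submodule.projectionOnto_apply_right, sub_zero] at h
  exact h

/-- The differential of the Legendre transform, with values in `L^⊥ × L`. -/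
def legendreDiff (hL : IsCompl L (tangentDir J)) (z : BlowUp J × VJ J) : perp L × L :=
  (perpProj hL (h n (gInv hL z)), fibreProj hL (fibreVec hL z))

lemma isProj_gInv (hL : IsCompl L (tangentDir J)) {z : BlowUp J × VJ J}
    (hz : z ∈ gProj hL '' Utilde J L) : IsProj L (gInv hL z) z.1 := by
  have h1 := isProj_yProj (gInv_mem hL hz)
  have h2 : yProj J L (gInv hL z) = z.1 := congrArg Prod.fst (gProj_gInv hL hz)
  rwa [h2] at h1

lemma xProj_h_gInv (hL : IsCompl L (tangentDir J)) {z : BlowUp J × VJ J}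
    (hz : z ∈ gProj hL '' Utilde J L) : xProj hL (h n (gInv hL z)) = z.2 :=
  congrArg Prod.snd (gProj_gInv hL hz)

lemma fibreVec_eq (hL : IsCompl L (tangentDir J)) {z : BlowUp J × VJ J}
    (hz : z ∈ gProj hL '' Utilde J L) (k : Fin (n + 2)) :
    fibreVec hL z = lift k (gInv hL z) - lift k z.1 :=
  (isProj_gInv hL hz).rep_sub k

lemma gInv_mem_vertexStar (hL : IsCompl L (tangentDir J)) {z : BlowUp J × VJ J}
    (hz : z ∈ gProj hL '' Utilde J L) (hzk : z.1 ∈ vertexStar k) : gInv hL z ∈ vertexStar k :=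
  (isProj_mem_vertexStar (isProj_gInv hL hz)).2 hzk

lemma coe_legendreDiff_fst (hL : IsCompl L (tangentDir J)) {z : BlowUp J × VJ J}
    (hz : z ∈ gProj hL '' Utilde J L) :
    ((legendreDiff hL z).1 : MR n) = h n (gInv hL z) - (z.2 : MR n) := by
  rw [legendreDiff, coe_perpProj, xProj_h_gInv hL hz]

lemma coe_legendreDiff_snd (hL : IsCompl L (tangentDir J)) {z : BlowUp J × VJ J}
    (hz : z ∈ gProj hL '' Utilde J L) : ((legendreDiff hL z).2 : NR n) = fibreVec hL z :=
  coe_fibreProj hL (isProj_gInv hL hz).rep_sub_mem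

lemma isOpen_fst_vertexStar (hk : k ∉ J.1) :
    IsOpen (Prod.fst ⁻¹' vertexStar k : Set (BlowUp J × VJ J)) :=
  (isOpen_vertexStar hk).preimage continuous_fst

lemma contMDiffAt_gInv (hL : IsCompl L (tangentDir J)) {z : BlowUp J × VJ J}
    (hz : z ∈ gProj hL '' Utilde J L) : ContMDiffAt (modelEV J) (modelC n) ∞ (gInv hL) z :=
  (contMDiffOn_gInv hL).contMDiffAt ((isOpen_image_gProj hL).mem_nhds hz)

lemma contMDiffAt_lift_fst (hk : k ∉ J.1) {z : BlowUp J × VJ J} (hzk : z.1 ∈ vertexStar k) :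
    ContMDiffAt (modelEV J) 𝓘(ℝ, NR n) ∞ (fun z : BlowUp J × VJ J => lift k z.1) z :=
  ((contMDiffOn_lift hk).contMDiffAt ((isOpen_vertexStar hk).mem_nhds hzk)).comp z contMDiffAt_fst

lemma contMDiffAt_fibreVec (hL : IsCompl L (tangentDir J)) {z : BlowUp J × VJ J}
    (hz : z ∈ gProj hL '' Utilde J L) :
    ContMDiffAt (modelEV J) 𝓘(ℝ, NR n) ∞ (fibreVec hL) z := by
  obtain ⟨k, hk, hzk⟩ := exists_mem_vertexStar z.1
  have h1 := ((contMDiffOn_lift (notMem_whole k)).contMDiffAt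
    ((isOpen_vertexStar (notMem_whole k)).mem_nhds (gInv_mem_vertexStar hL hz hzk))).comp z
    (contMDiffAt_gInv hL hz)
  refine (h1.sub (contMDiffAt_lift_fst hk hzk)).congr_of_eventuallyEq ?_
  filter_upwards [(isOpen_image_gProj hL).mem_nhds hz] with y hy
  exact fibreVec_eq hL hy k

lemma contMDiffAt_legendre (hL : IsCompl L (tangentDir J)) {z : BlowUp J × VJ J}
    (hz : z ∈ gProj hL '' Utilde J L) :
    ContMDiffAt (modelEV J) 𝓘(ℝ, ℝ) ∞ (legendre hL) z := by
  have h1 : ContMDiffAt (modelEV J) 𝓘(ℝ, MR n) ∞ (fun z : BlowUp J × VJ J => (z.2 : MR n)) z :=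
    (VJ J).subtypeL.contDiff.contMDiff.contMDiffAt.comp z contMDiffAt_snd
  have h2 := contDiff_dotProduct.contMDiff.contMDiffAt.comp z
    (h1.prodMk_space (contMDiffAt_fibreVec hL hz))
  exact h2.sub (contMDiff_F.contMDiffAt.comp z (contMDiffAt_gInv hL hz))

lemma contMDiffAt_legendreDiff (hL : IsCompl L (tangentDir J)) {z : BlowUp J × VJ J}
    (hz : z ∈ gProj hL '' Utilde J L) :
    ContMDiffAt (modelEV J) 𝓘(ℝ, perp L × L) ∞ (legendreDiff hL) z :=
  ((perpProj hL).contDiff.contMDiff.contMDiffAt.comp z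
    (contMDiff_h.contMDiffAt.comp z (contMDiffAt_gInv hL hz))).prodMk_space
    ((fibreProj hL).contDiff.contMDiff.contMDiffAt.comp z (contMDiffAt_fibreVec hL hz))

/-! ### The differential of the Legendre transform in polar coordinates -/

/-- The map `g` in redundant polar coordinates. -/
def gParam (hL : IsCompl L (tangentDir J)) (k : Fin (n + 2)) (q : NR n × ℝ) : BlowUp J × VJ J :=
  gProj hL (paramC k q.1 q.2)

lemma contMDiffAt_gParam (hL : IsCompl L (tangentDir J)) {q : NR n × ℝ}
    (hq : q ∈ polarDomain (whole n) k) (hU : paramC k q.1 q.2 ∈ Utilde J L) :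
    ContMDiffAt 𝓘(ℝ, NR n × ℝ) (modelEV J) ∞ (gParam hL k) q :=
  ContMDiffAt.comp q (g := gProj hL) (f := fun q : NR n × ℝ => paramC k q.1 q.2)
    ((contMDiffOn_gProj hL).contMDiffAt ((isOpen_Utilde hL).mem_nhds hU))
    ((contMDiffOn_paramC k).contMDiffAt ((isOpen_polarDomain _ k).mem_nhds hq))

/-- The map `g` is a submersion in redundant polar coordinates. -/
lemma surjective_mfderiv_gParam (hL : IsCompl L (tangentDir J)) {z : BlowUp J × VJ J}
    (hz : z ∈ gProj hL '' Utilde J L) (hk : k ∉ J.1) (hzk : z.1 ∈ vertexStar k)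
    {q : NR n × ℝ} (hq : q = (secV k (gInv hL z), secT k (gInv hL z))) :
    Function.Surjective (mfderiv 𝓘(ℝ, NR n × ℝ) (modelEV J) (gParam hL k) q) := by
  have hx := gInv_mem_vertexStar hL hz hzk
  have hm : q ∈ polarDomain (whole n) k := hq ▸ sec_mem_polarDomain hx
  have hU : paramC k q.1 q.2 ∈ Utilde J L := by
    rw [hq, paramC_sec hx]
    exact gInv_mem hL hz
  have h1 := contMDiffAt_gParam hL hm hU
  have h2 : ContMDiffAt (modelEV J) 𝓘(ℝ, NR n × ℝ) ∞
      (fun z => (secV k (gInv hL z), secT k (gInv hL z))) z :=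
    ContMDiffAt.comp z (g := fun x : Ctilde n => (secV k x, secT k x))
      ((contMDiffOn_secVT k).contMDiffAt ((isOpen_vertexStar (notMem_whole k)).mem_nhds hx))
      (contMDiffAt_gInv hL hz)
  subst hq
  have h3 := mfderiv_comp z (h1.mdifferentiableAt (by simp)) (h2.mdifferentiableAt (by simp))
  -- The normalized coordinates of the inverse of g are a smooth local right inverse of `gParam`,
  -- hence its derivative is surjective.
  have h4 : gParam hL k ∘ (fun z => (secV k (gInv hL z), secT k (gInv hL z))) =ᶠ[𝓝 z] id := by
    filter_upwards [(isOpen_image_gProj hL).mem_nhds hz,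
      (isOpen_fst_vertexStar hk).mem_nhds hzk] with y hy hyk
    simp only [Function.comp, gParam, id]
    rw [paramC_sec (gInv_mem_vertexStar hL hy hyk), gProj_gInv hL hy]
  rw [h4.mfderiv_eq, mfderiv_id] at h3
  intro w
  refine ⟨mfderiv (modelEV J) 𝓘(ℝ, NR n × ℝ)
    (fun z => (secV k (gInv hL z), secT k (gInv hL z))) z w, ?_⟩
  exact (DFunLike.congr_fun h3 w).symm

lemma gParam_snd (hL : IsCompl L (tangentDir J)) {q : NR n × ℝ}
    (hq : q ∈ polarDomain (whole n) k) :
    (gParam hL k q).2 = xProjL hL (gradVec k q.1 q.2) := by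
  change xProj hL (h n (paramC k q.1 q.2)) = _
  rw [h_paramC hq]
  rfl

lemma gParam_fst (hL : IsCompl L (tangentDir J)) (hk : k ∉ J.1) {q : NR n × ℝ}
    (hq : q ∈ polarDomain (whole n) k) (hU : paramC k q.1 q.2 ∈ Utilde J L) :
    (gParam hL k q).1 = param hk (dirProj hL q.1, q.2) :=
  yProj_paramC hL hk hq ((paramC_mem_Utilde_iff hL hk hq).1 hU)

lemma fibreVec_gParam (hL : IsCompl L (tangentDir J)) (hk : k ∉ J.1) {q : NR n × ℝ}
    (hq : q ∈ polarDomain (whole n) k) (hU : paramC k q.1 q.2 ∈ Utilde J L) :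
    fibreVec hL (gParam hL k q) = q.2 • (q.1 - (dirProj hL q.1 : NR n)) := by
  have hd := (paramC_mem_Utilde_iff hL hk hq).1 hU
  have h1 : lift k (paramC k q.1 q.2) = p n k + q.2 • q.1 := lift_param (notMem_whole k) hq
  have hz : gParam hL k q ∈ gProj hL '' Utilde J L := mem_image_of_mem _ hU
  rw [fibreVec_eq hL hz k, gParam_fst hL hk hq hU, lift_param hk hd, gParam,
    gInv_gProj hL hU, h1, smul_sub]
  abel

lemma hasFDerivAt_dotProduct {E : Type*} [NormedAddCommGroup E] [NormedSpace ℝ E] {f g : E → NR n}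
    {f' g' : E →L[ℝ] NR n} {x : E} (hf : HasFDerivAt f f' x) (hg : HasFDerivAt g g' x) :
    DifferentiableAt ℝ (fun x => f x ⬝ᵥ g x) x ∧
      ∀ δ, fderiv ℝ (fun x => f x ⬝ᵥ g x) x δ = f' δ ⬝ᵥ g x + f x ⬝ᵥ g' δ := by
  have h : HasFDerivAt (fun x => f x ⬝ᵥ g x) _ x :=
    HasFDerivAt.fun_sum fun j (_ : j ∈ Finset.univ) =>
      (hasFDerivAt_pi'.1 hf j).mul (hasFDerivAt_pi'.1 hg j)
  refine ⟨h.differentiableAt, fun δ => ?_⟩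
  rw [h.fderiv]
  simp only [sum_apply, add_apply, smul_apply, smul_eq_mul, dotProduct,
    ← Finset.sum_add_distrib, ContinuousLinearMap.comp_apply, ContinuousLinearMap.proj_apply]
  exact Finset.sum_congr rfl fun j _ => by ring

/-- As `gParam` is a submersion, it is enough to differentiate along vectors δ in the redundant
coordinates, where the lift is p_k + t v. There all functions are explicit and t = 0 is not special.
-/
lemma mfderiv_legendre (hL : IsCompl L (tangentDir J)) {z : BlowUp J × VJ J}
    (hz : z ∈ gProj hL '' Utilde J L) (hk : k ∉ J.1) (hzk : z.1 ∈ vertexStar k)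
    (ξ : tangentDir J) (v : VJ J) :
    (mfderiv (modelEV J) 𝓘(ℝ, ℝ) (legendre hL) z (ξ, v) : ℝ) =
      cotangentForm (legendreDiff hL z) v
        (mfderiv 𝓘(ℝ, tangentDir J) 𝓘(ℝ, NR n) (lift k) z.1 ξ) := by
  have hx := gInv_mem_vertexStar hL hz hzk
  obtain ⟨q, hq⟩ : ∃ q : NR n × ℝ, q = (secV k (gInv hL z), secT k (gInv hL z)) := ⟨_, rfl⟩
  have hm : q ∈ polarDomain (whole n) k := hq ▸ sec_mem_polarDomain hx
  have hpx : paramC k q.1 q.2 = gInv hL z := by rw [hq, paramC_sec hx]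
  have hU : paramC k q.1 q.2 ∈ Utilde J L := by
    rw [hpx]
    exact gInv_mem hL hz
  have hqz : gParam hL k q = z := by rw [gParam, hpx, gProj_gInv hL hz]
  obtain ⟨δ, hδ⟩ : ∃ δ : NR n × ℝ,
      mfderiv 𝓘(ℝ, NR n × ℝ) (modelEV J) (gParam hL k) q δ = (ξ, v) :=
    surjective_mfderiv_gParam hL hz hk hzk hq (ξ, v)
  have hα := (contMDiffAt_gParam hL hm hU).mdifferentiableAt (by simp)
  -- the coordinate expressions near `q`
  have hnhds : ∀ᶠ y in 𝓝 q, y ∈ polarDomain (whole n) k ∧ paramC k y.1 y.2 ∈ Utilde J L := by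
    have hc : ContinuousAt (fun q : NR n × ℝ => paramC k q.1 q.2) q :=
      (contMDiffOn_paramC k).continuousOn.continuousAt ((isOpen_polarDomain _ k).mem_nhds hm)
    exact ((isOpen_polarDomain _ k).eventually_mem hm).and
      (hc.eventually ((isOpen_Utilde hL).mem_nhds hU))
  have hA : DifferentiableAt ℝ (fun q : NR n × ℝ => xProjL hL (gradVec k q.1 q.2)) q :=
    ((xProjL hL).contDiff.contDiffAt.comp q
      ((contDiffOn_gradVec k).contDiffAt ((isOpen_polarDomain _ k).mem_nhds hm))).differentiableAt
      (by simp)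
  -- the component `v`
  have hv : v = fderiv ℝ (fun q : NR n × ℝ => xProjL hL (gradVec k q.1 q.2)) q δ := by
    have h1 := mfderiv_comp (I'' := 𝓘(ℝ, VJ J)) q
      (g := (Prod.snd : BlowUp J × VJ J → VJ J)) mdifferentiableAt_snd hα
    have h2 : (Prod.snd : BlowUp J × VJ J → VJ J) ∘ gParam hL k =ᶠ[𝓝 q]
        fun q : NR n × ℝ => xProjL hL (gradVec k q.1 q.2) :=
      hnhds.mono fun y hy => gParam_snd hL hy.1
    rw [h2.mfderiv_eq, mfderiv_snd, mfderiv_eq_fderiv] at h1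
    have h3 := DFunLike.congr_fun h1 δ
    exact (h3.trans (congrArg Prod.snd hδ)).symm
  -- the derivative of the lift
  have hl : (mfderiv 𝓘(ℝ, tangentDir J) 𝓘(ℝ, NR n) (lift k) z.1 ξ : NR n) =
      q.2 • (dirProj hL δ.1 : NR n) + δ.2 • (dirProj hL q.1 : NR n) := by
    have hlift := (contMDiffAt_lift_fst hk hzk).mdifferentiableAt (by simp)
    rw [← hqz] at hlift
    have h1 := mfderiv_comp q hlift hα
    have h2 : (fun z : BlowUp J × VJ J => lift k z.1) ∘ gParam hL k =ᶠ[𝓝 q]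
        fun q : NR n × ℝ => p n k + q.2 • (dirProj hL q.1 : NR n) := by
      filter_upwards [hnhds] with y hy
      simp only [Function.comp]
      rw [gParam_fst hL hk hy.1 hy.2, lift_param hk ((paramC_mem_Utilde_iff hL hk hy.1).1 hy.2)]
    rw [h2.mfderiv_eq, mfderiv_eq_fderiv] at h1
    have h3 := DFunLike.congr_fun h1 δ
    have h4 : fderiv ℝ (fun q : NR n × ℝ => p n k + q.2 • (dirProj hL q.1 : NR n)) q δ =
        q.2 • (dirProj hL δ.1 : NR n) + δ.2 • (dirProj hL q.1 : NR n) := by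
      have h : HasFDerivAt (fun q : NR n × ℝ => p n k + q.2 • (dirProj hL q.1 : NR n)) _ q :=
        (hasFDerivAt_snd.smul ((((tangentDir J).subtypeL.comp (dirProj hL)).comp
          (ContinuousLinearMap.fst ℝ (NR n) ℝ)).hasFDerivAt)).const_add (p n k)
      rw [h.fderiv]
      simp
    have h5 := mfderiv_comp (I' := 𝓘(ℝ, tangentDir J)) (gParam hL k q)
      (g := (lift k : BlowUp J → NR n)) (f := (Prod.fst : BlowUp J × VJ J → BlowUp J))
      (((contMDiffOn_lift hk).contMDiffAt ((isOpen_vertexStar hk).mem_nhds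
        (hqz ▸ hzk))).mdifferentiableAt (by simp))
      (mdifferentiableAt_fst (I := 𝓘(ℝ, tangentDir J)) (I' := 𝓘(ℝ, VJ J)))
    have h6 := DFunLike.congr_fun h5 (mfderiv 𝓘(ℝ, NR n × ℝ) (modelEV J) (gParam hL k) q δ)
    rw [mfderiv_fst] at h6
    have h7 : mfderiv 𝓘(ℝ, tangentDir J) 𝓘(ℝ, NR n) (lift k) (gParam hL k q).1 ξ =
      mfderiv 𝓘(ℝ, tangentDir J) 𝓘(ℝ, NR n) (lift k) (gParam hL k q).1
        (mfderiv 𝓘(ℝ, NR n × ℝ) (modelEV J) (gParam hL k) q δ).1 := by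
      rw [hδ]
    rw [← hqz]
    exact h7.trans (h6.symm.trans (h3.symm.trans h4))
  -- the derivative of the Legendre transform
  have hG : (mfderiv (modelEV J) 𝓘(ℝ, ℝ) (legendre hL) z (ξ, v) : ℝ) =
      (v : MR n) ⬝ᵥ (q.2 • (q.1 - (dirProj hL q.1 : NR n))) +
      (xProjL hL (gradVec k q.1 q.2) : MR n) ⬝ᵥ (q.2 • (δ.1 - (dirProj hL δ.1 : NR n)) +
        δ.2 • (q.1 - (dirProj hL q.1 : NR n))) -
      gradVec k q.1 q.2 ⬝ᵥ (q.2 • δ.1 + δ.2 • q.1) := by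
    have hleg := (contMDiffAt_legendre hL hz).mdifferentiableAt (by simp)
    rw [← hqz] at hleg
    have h1 := mfderiv_comp q hleg hα
    have h2 : legendre hL ∘ gParam hL k =ᶠ[𝓝 q] fun q : NR n × ℝ =>
        (xProjL hL (gradVec k q.1 q.2) : MR n) ⬝ᵥ (q.2 • (q.1 - (dirProj hL q.1 : NR n))) -
          q.2 * Psi k q.1 q.2 := by
      filter_upwards [hnhds] with y hy
      simp only [Function.comp, legendre]
      rw [fibreVec_gParam hL hk hy.1 hy.2, gParam_snd hL hy.1, gParam, gInv_gProj hL hy.2,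
        F_paramC hy.1]
    rw [h2.mfderiv_eq, mfderiv_eq_fderiv] at h1
    have h3 := DFunLike.congr_fun h1 δ
    have hP : DifferentiableAt ℝ (fun q : NR n × ℝ => q.2 * Psi k q.1 q.2) q :=
      (contDiffAt_snd.mul ((contDiffOn_Psi k).contDiffAt
        ((isOpen_polarDomain _ k).mem_nhds hm))).differentiableAt (by simp)
    have hB : HasFDerivAt (fun q : NR n × ℝ => q.2 • (q.1 - (dirProj hL q.1 : NR n))) _ q :=
      hasFDerivAt_snd.smul (hasFDerivAt_fst.sub (((tangentDir J).subtypeL.comp (dirProj hL)).comp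
        (ContinuousLinearMap.fst ℝ (NR n) ℝ)).hasFDerivAt)
    have hA' : HasFDerivAt (fun q : NR n × ℝ => (xProjL hL (gradVec k q.1 q.2) : MR n)) _ q :=
      (VJ J).subtypeL.hasFDerivAt.comp q hA.hasFDerivAt
    have hAB := hasFDerivAt_dotProduct hA' hB
    have h4 : fderiv ℝ (fun q : NR n × ℝ =>
        (xProjL hL (gradVec k q.1 q.2) : MR n) ⬝ᵥ (q.2 • (q.1 - (dirProj hL q.1 : NR n))) -
          q.2 * Psi k q.1 q.2) q δ = (v : MR n) ⬝ᵥ (q.2 • (q.1 - (dirProj hL q.1 : NR n))) +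
      (xProjL hL (gradVec k q.1 q.2) : MR n) ⬝ᵥ (q.2 • (δ.1 - (dirProj hL δ.1 : NR n)) +
        δ.2 • (q.1 - (dirProj hL q.1 : NR n))) -
      gradVec k q.1 q.2 ⬝ᵥ (q.2 • δ.1 + δ.2 • q.1) := by
      rw [fderiv_fun_sub hAB.1 hP, sub_apply, fderiv_mul_Psi hm, hAB.2, hv]
      simp
    have h7 : mfderiv (modelEV J) 𝓘(ℝ, ℝ) (legendre hL) (gParam hL k q) (ξ, v) =
      mfderiv (modelEV J) 𝓘(ℝ, ℝ) (legendre hL) (gParam hL k q)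
        (mfderiv 𝓘(ℝ, NR n × ℝ) (modelEV J) (gParam hL k) q δ) := by
      rw [hδ]
    rw [← hqz]
    exact h7.trans (h3.symm.trans h4)
  have hs1 : ((legendreDiff hL z).1 : MR n) =
      gradVec k q.1 q.2 - (xProjL hL (gradVec k q.1 q.2) : MR n) := by
    rw [coe_legendreDiff_fst hL hz, ← gParam_snd hL hm, hqz, ← hpx, h_paramC hm]
  have hs2 : ((legendreDiff hL z).2 : NR n) = q.2 • (q.1 - (dirProj hL q.1 : NR n)) := by
    rw [coe_legendreDiff_snd hL hz, ← hqz, fibreVec_gParam hL hk hm hU]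
  have hx1 : ∀ w : NR n, (xProjL hL (gradVec k q.1 q.2) : MR n) ⬝ᵥ (w - (dirProj hL w : NR n)) =
      gradVec k q.1 q.2 ⬝ᵥ (w - (dirProj hL w : NR n)) := fun w =>
    xProj_dot hL _ (sub_dirProj_mem hL w)
  have hx2 : ∀ w : tangentDir J, (xProjL hL (gradVec k q.1 q.2) : MR n) ⬝ᵥ (w : NR n) = 0 :=
    fun w => VJ_dot_tangentDir _ w
  have hc : ∀ (s : perp L × L) (v w : NR n),
      cotangentForm s v w = v ⬝ᵥ (s.2 : NR n) - (s.1 : MR n) ⬝ᵥ w := fun _ _ _ => rfl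
  -- The variation of t v is split along L and along E_J. On L the projected gradient pairs like the
  -- gradient and the terms cancel; on tangent vectors of E_J the space V_J pairs to zero, which
  -- leaves the component of the gradient in L^⊥.
  have key : (v : MR n) ⬝ᵥ (q.2 • (q.1 - (dirProj hL q.1 : NR n))) +
      (xProjL hL (gradVec k q.1 q.2) : MR n) ⬝ᵥ (q.2 • (δ.1 - (dirProj hL δ.1 : NR n)) +
        δ.2 • (q.1 - (dirProj hL q.1 : NR n))) -
      gradVec k q.1 q.2 ⬝ᵥ (q.2 • δ.1 + δ.2 • q.1) =
      cotangentForm (legendreDiff hL z) v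
        (q.2 • (dirProj hL δ.1 : NR n) + δ.2 • (dirProj hL q.1 : NR n)) := by
    rw [hc, hs1, hs2]
    simp only [dotProduct_add, dotProduct_smul, sub_dotProduct, hx1, hx2, smul_eq_mul, sub_zero,
      dotProduct_sub]
    ring
  exact hG.trans (key.trans (congrArg (cotangentForm (legendreDiff hL z) (v : MR n)) hl.symm))

end

section

variable {n : ℕ} {J : Face n} {k : Fin (n + 2)} {L : Submodule ℝ (NR n)}

/-! ### The graph of the differential of the Legendre transform -/

lemma toTorus_add (a b : NR n) : toTorus (a + b) = toTorus a + toTorus b := by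
  funext j
  exact AddCircle.coe_add _ _ _

/-- The covering reassembles h and y from their parts along V_J, L^⊥ and along E_J, L. This reduces
statements about the graph to statements about Φ. -/
lemma covering_legendreDiff (hL : IsCompl L (tangentDir J)) {z : BlowUp J × VJ J}
    (hz : z ∈ gProj hL '' Utilde J L) :
    covering z.2 (proj z.1) (legendreDiff hL z) = Phi (gInv hL z) := by
  refine Prod.ext ?_ ?_
  · simp only [covering, coe_legendreDiff_fst hL hz, Phi]
    abel
  · simp only [covering, coe_legendreDiff_snd hL hz, Phi, fibreVec, proj, ← toTorus_add]
    rw [add_sub_cancel]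

lemma continuous_covering :
    Continuous fun e : (VJ J × Torus n) × (perp L × L) => covering e.1.1 e.1.2 e.2 := by
  refine Continuous.prodMk ?_ ?_
  · fun_prop
  · exact (continuous_snd.comp continuous_fst).add
      (continuous_toTorus.comp (continuous_subtype_val.comp (continuous_snd.comp continuous_snd)))

lemma isEmbedding_gInv (hL : IsCompl L (tangentDir J)) {Z : Set (BlowUp J × VJ J)}
    (hZ : Z ⊆ gProj hL '' Utilde J L) : IsEmbedding fun z : Z => gInv hL z.1 := by
  have hc : Continuous fun z : Z => gInv hL z.1 :=
    continuousOn_iff_continuous_domRestrict.1 ((contMDiffOn_gInv hL).continuousOn.mono hZ)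
  let ι : Z → Utilde J L := fun z => ⟨gInv hL z.1, gInv_mem hL (hZ z.2)⟩
  have hι : Continuous ι := hc.subtype_mk _
  have hg : Continuous fun x : Utilde J L => gProj hL x.1 :=
    continuousOn_iff_continuous_domRestrict.1 (contMDiffOn_gProj hL).continuousOn
  have h1 : (fun x : Utilde J L => gProj hL x.1) ∘ ι = Subtype.val :=
    funext fun z => gProj_gInv hL (hZ z.2)
  exact IsEmbedding.subtypeVal.comp (IsEmbedding.of_comp hι hg (h1 ▸ IsEmbedding.subtypeVal))

lemma contMDiffOn_legendreDiff (hL : IsCompl L (tangentDir J)) :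
    ContMDiffOn (modelEV J) 𝓘(ℝ, perp L × L) ∞ (legendreDiff hL) (gProj hL '' Utilde J L) :=
  fun _ hz => (contMDiffAt_legendreDiff hL hz).contMDiffWithinAt

/-- A continuous map whose composite with another continuous map is an embedding is itself an
embedding; here the composite with the covering is Φ ∘ g⁻¹. -/
lemma isEmbedding_legendreDiff (hL : IsCompl L (tangentDir J)) {Z : Set (BlowUp J × VJ J)}
    (hZ : Z ⊆ gProj hL '' Utilde J L) :
    IsEmbedding fun z : Z => ((z.1.2, proj z.1.1), legendreDiff hL z.1) := by
  have hc : Continuous fun z : Z => legendreDiff hL z.1 :=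
    continuousOn_iff_continuous_domRestrict.1 ((contMDiffOn_legendreDiff hL).continuousOn.mono hZ)
  have hE : Continuous fun z : Z => ((z.1.2, proj z.1.1), legendreDiff hL z.1) :=
    ((continuous_snd.comp continuous_subtype_val).prodMk
      (continuous_proj.comp (continuous_fst.comp continuous_subtype_val))).prodMk hc
  refine IsEmbedding.of_comp hE continuous_covering ?_
  have h1 : (fun e : (VJ J × Torus n) × (perp L × L) => covering e.1.1 e.1.2 e.2) ∘
      (fun z : Z => ((z.1.2, proj z.1.1), legendreDiff hL z.1)) = Phi ∘ fun z : Z => gInv hL z.1 :=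
    funext fun z => covering_legendreDiff hL (hZ z.2)
  rw [h1]
  exact isEmbedding_Phi.comp (isEmbedding_gInv hL hZ)

/-- There is a smooth local left inverse: the linear sum A gives h and the lift, R gives the chart
of the point of C̃, and g returns to the base. -/
lemma injective_mfderiv_legendreDiff (hL : IsCompl L (tangentDir J)) {z : BlowUp J × VJ J}
    (hz : z ∈ gProj hL '' Utilde J L) (hk : k ∉ J.1) (hzk : z.1 ∈ vertexStar k) :
    Function.Injective (mfderiv (modelEV J) 𝓘(ℝ, (VJ J × NR n) × (perp L × L))
      (fun z => ((z.2, lift k z.1), legendreDiff hL z)) z) := by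
  have hx := gInv_mem_vertexStar hL hz hzk
  obtain ⟨R, hR, hRe⟩ := exists_chart_eq hx
  let E : BlowUp J × VJ J → (VJ J × NR n) × (perp L × L) :=
    fun z => ((z.2, lift k z.1), legendreDiff hL z)
  let A : (VJ J × NR n) × (perp L × L) →L[ℝ] MR n × NR n :=
    (((VJ J).subtypeL.comp ((ContinuousLinearMap.fst ℝ _ _).comp (ContinuousLinearMap.fst ℝ _ _))) +
      ((perp L).subtypeL.comp
        ((ContinuousLinearMap.fst ℝ _ _).comp (ContinuousLinearMap.snd ℝ _ _)))).prod
    (((ContinuousLinearMap.snd ℝ _ _).comp (ContinuousLinearMap.fst ℝ _ _)) +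
      (L.subtypeL.comp ((ContinuousLinearMap.snd ℝ _ _).comp (ContinuousLinearMap.snd ℝ _ _))))
  have hA : ∀ y ∈ gProj hL '' Utilde J L, A (E y) = (h n (gInv hL y), lift k (gInv hL y)) := by
    intro y hy
    refine Prod.ext ?_ ?_
    · change (y.2 : MR n) + ((legendreDiff hL y).1 : MR n) = _
      rw [coe_legendreDiff_fst hL hy]
      abel
    · change lift k y.1 + ((legendreDiff hL y).2 : NR n) = _
      rw [coe_legendreDiff_snd hL hy, fibreVec_eq hL hy k]
      abel
  let W : (VJ J × NR n) × (perp L × L) → BlowUp J × VJ J :=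
    fun e => gProj hL (ofPolar (notMem_whole k) (R (A e)))
  have hE : ContMDiffAt (modelEV J) 𝓘(ℝ, (VJ J × NR n) × (perp L × L)) ∞ E z :=
    (contMDiffAt_snd.prodMk_space (contMDiffAt_lift_fst hk hzk)).prodMk_space
      (contMDiffAt_legendreDiff hL hz)
  have hAz : A (E z) = (h n (gInv hL z), lift k (gInv hL z)) := hA z hz
  have hRz : R (A (E z)) = starChart (notMem_whole k) (gInv hL z) := by
    rw [hAz]
    exact hRe.self_of_nhds _ hx rfl
  have hpz : ofPolar (notMem_whole k) (R (A (E z))) = gInv hL z := by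
    rw [hRz]
    exact (starChart (notMem_whole k)).left_inv hx
  have hW : ContMDiffAt 𝓘(ℝ, (VJ J × NR n) × (perp L × L)) (modelEV J) ∞ W (E z) := by
    have h1 : ContMDiffAt 𝓘(ℝ, (VJ J × NR n) × (perp L × L)) 𝓘(ℝ, tangentDir (whole n)) ∞
        (fun e => R (A e)) (E z) := by
      refine ContDiffAt.contMDiffAt (ContDiffAt.comp (g := R) _ ?_ A.contDiff.contDiffAt)
      rw [hAz]
      exact hR
    have h2 : ContMDiffAt 𝓘(ℝ, tangentDir (whole n)) (modelC n) ∞ (ofPolar (notMem_whole k))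
        (R (A (E z))) :=
      (contMDiffOn_ofPolar (notMem_whole k)).contMDiffAt ((isOpen_polarTarget _ k).mem_nhds
        (hRz ▸ (starChart (notMem_whole k)).map_source hx))
    refine ContMDiffAt.comp (E z) (g := gProj hL) (f := fun e => ofPolar _ (R (A e))) ?_
      (ContMDiffAt.comp (E z) (f := fun e => R (A e)) h2 h1)
    rw [hpz]
    exact (contMDiffOn_gProj hL).contMDiffAt ((isOpen_Utilde hL).mem_nhds (gInv_mem hL hz))
  have hWE : W ∘ E =ᶠ[𝓝 z] id := by
    have h1 : Tendsto (fun y => A (E y)) (𝓝 z) (𝓝 (h n (gInv hL z), lift k (gInv hL z))) := by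
      rw [← hAz]
      exact A.continuous.continuousAt.comp hE.continuousAt
    filter_upwards [(isOpen_image_gProj hL).mem_nhds hz,
      (isOpen_fst_vertexStar hk).mem_nhds hzk, h1.eventually hRe] with y hy hyk hRy
    have hyx := gInv_mem_vertexStar hL hy hyk
    change gProj hL (ofPolar _ (R (A (E y)))) = y
    rw [hRy _ hyx (hA y hy).symm]
    have h2 : ofPolar (notMem_whole k) (starChart (notMem_whole k) (gInv hL y)) = gInv hL y :=
      (starChart (notMem_whole k)).left_inv hyx
    rw [h2, gProj_gInv hL hy]
  have h3 := mfderiv_comp z (hW.mdifferentiableAt (by simp)) (hE.mdifferentiableAt (by simp))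
  rw [hWE.mfderiv_eq, mfderiv_id] at h3
  intro a b hab
  have ha := DFunLike.congr_fun h3 a
  have hb := DFunLike.congr_fun h3 b
  exact ha.trans ((congrArg (mfderiv 𝓘(ℝ, (VJ J × NR n) × (perp L × L)) (modelEV J) W (E z))
    hab).trans hb.symm)

theorem isExactGraph_legendre (hL : IsCompl L (tangentDir J)) {s : Set (Ctilde n)}
    (hs : s ⊆ Utilde J L) :
    IsExactGraph J L (gProj hL '' s) (legendre hL) (Phi '' s) := by
  have hZ : gProj hL '' s ⊆ gProj hL '' Utilde J L := image_mono hs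
  refine ⟨legendreDiff hL, fun z hz => (contMDiffAt_legendre hL (hZ hz)).contMDiffWithinAt,
    (contMDiffOn_legendreDiff hL).mono hZ,
    fun z hz k hk hzk ξ v => mfderiv_legendre hL (hZ hz) hk hzk ξ v,
    isEmbedding_legendreDiff hL hZ,
    fun z hz k hk hzk => injective_mfderiv_legendreDiff hL (hZ hz) hk hzk, ?_⟩
  rw [image_image]
  refine image_congr fun x hx => ?_
  rw [covering_legendreDiff hL (hZ (mem_image_of_mem _ hx)), gInv_gProj hL (hs hx)]

theorem isLegendreTransform_legendre (hL : IsCompl L (tangentDir J)) {s : Set (Ctilde n)}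
    (hs : s ⊆ Utilde J L) : IsLegendreTransform hL s (legendre hL) := by
  intro x hx
  rw [legendre, fibreVec, gInv_gProj hL (hs hx)]
  rfl

end

section

variable {n : ℕ} {J : Face n} {k k' : Fin (n + 2)}

/-! ### The standard projections -/

lemma p_sub_p_mem_stdL {j : Fin (n + 2)} (hj : j ∈ J.1) : p n j - p n k ∈ stdL J k :=
  Submodule.subset_span ⟨j, hj, rfl⟩

lemma mem_perp_stdL_iff {m : MR n} :
    m ∈ perp (stdL J k) ↔ ∀ j ∈ J.1, m ⬝ᵥ (p n j - p n k) = 0 := by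
  refine ⟨fun h j hj => h _ (p_sub_p_mem_stdL hj), fun h y hy => ?_⟩
  induction hy using Submodule.span_induction with
  | mem y hy =>
    obtain ⟨j, hj, rfl⟩ := hy
    exact h j hj
  | zero => simp
  | add y z _ _ hy hz => rw [dotProduct_add, hy, hz, add_zero]
  | smul c y _ hy => rw [dotProduct_smul, hy, smul_zero]

lemma xProj_stdL_eq (hk : k ∉ J.1) {m : MR n} {a : VJ J}
    (h : ∀ j ∈ J.1, m ⬝ᵥ (p n j - p n k) = (a : MR n) ⬝ᵥ (p n j - p n k)) :
    xProj (isCompl_stdL hk) m = a :=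
  xProj_eq _ (mem_perp_stdL_iff.2 fun j hj => by rw [sub_dotProduct, h j hj, sub_self])

lemma sum_smul_u_dot (hk : k ∉ J.1) (c : Fin (n + 2) → ℝ) {j : Fin (n + 2)} (hj : j ∈ J.1) :
    2 / Real.pi * ((∑ i ∈ J.1, c i • u n i) ⬝ᵥ (p n j - p n k)) = c j := by
  rw [sum_dotProduct, Finset.mul_sum, Finset.sum_congr rfl (g := fun i => if i = j then c i else 0)]
  · simp [hj]
  · intro i hi
    rw [smul_dotProduct, smul_eq_mul, mul_left_comm, dot_p_sub_p,
      if_neg (ne_of_mem_of_not_mem hi hk), sub_zero]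
    simp

/-- The vectors (2/π)(p_j - p_k) restrict to the basis of coordinate functions on V_J dual to the
u_j. -/
lemma mem_interiorCone_iff (hk : k ∉ J.1) {a : VJ J} :
    a ∈ interiorCone J ↔ ∀ j ∈ J.1, 0 < (a : MR n) ⬝ᵥ (p n j - p n k) := by
  have hpi : 0 < 2 / Real.pi := by
    have := Real.pi_pos
    positivity
  constructor
  · rintro ⟨c, hc, e⟩ j hj
    rw [← mul_pos_iff_of_pos_left hpi, e, sum_smul_u_dot hk c hj]
    exact hc j hj
  · intro h
    let c : Fin (n + 2) → ℝ := fun j => 2 / Real.pi * ((a : MR n) ⬝ᵥ (p n j - p n k))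
    refine ⟨c, fun j hj => mul_pos hpi (h j hj), ?_⟩
    have hm : ∑ j ∈ J.1, c j • u n j ∈ VJ J :=
      Submodule.sum_mem _ fun j hj => Submodule.smul_mem _ _ (Submodule.subset_span ⟨j, hj, rfl⟩)
    have h1 : xProj (isCompl_stdL hk) (a : MR n) = ⟨_, hm⟩ :=
      xProj_stdL_eq hk fun j hj => mul_left_cancel₀ hpi.ne' (sum_smul_u_dot hk c hj).symm
    have h2 : xProj (isCompl_stdL hk) (a : MR n) = a := xProj_stdL_eq hk fun j _ => rfl
    exact congrArg Subtype.val (h2.symm.trans h1)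

lemma isOpen_interiorCone (J : Face n) : IsOpen (interiorCone J) := by
  obtain ⟨k, hk⟩ := exists_notMem J
  have : interiorCone J = ⋂ j ∈ J.1, {a : VJ J | 0 < (a : MR n) ⬝ᵥ (p n j - p n k)} := by
    ext a
    simp [mem_interiorCone_iff hk]
  rw [this]
  exact isOpen_biInter_finset fun j _ => isOpen_lt continuous_const
    (continuous_subtype_val.dotProduct continuous_const)

/-! ### The order of the gradient coefficients and the interior of `Wtilde` -/

lemma hProj_paramC_mem_interiorCone_iff (hk : k ∉ J.1) {v : NR n} {t : ℝ}
    (h : (v, t) ∈ polarDomain (whole n) k') :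
    hProj (isCompl_stdL hk) (paramC k' v t) ∈ interiorCone J ↔
      ∀ j ∈ J.1, gradCoeff k' v t k < gradCoeff k' v t j := by
  rw [mem_interiorCone_iff hk]
  refine forall₂_congr fun j hj => ?_
  have hpi : 0 < 2 / Real.pi := by
    have := Real.pi_pos
    positivity
  rw [hProj, xProj_dot _ _ (p_sub_p_mem_stdL hj), h_paramC h, ← mul_pos_iff_of_pos_left hpi,
    gradVec_dot_p_sub_p, sub_pos]

/-- Away from the vertex index all logarithmic derivatives are the same function of ⟨u_i, v⟩, and it
is strictly decreasing. -/
lemma logDer_lt {i j : Fin (n + 2)} {v : NR n} {t : ℝ} (h : (v, t) ∈ polarDomain (whole n) k)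
    (hi : i ≠ k) (hj : j ≠ k) (hij : u n i ⬝ᵥ v < u n j ⬝ᵥ v) :
    logDer k j t (u n j ⬝ᵥ v) < logDer k i t (u n i ⬝ᵥ v) := by
  have e : logDer k j t (u n j ⬝ᵥ v) = logDer k i t (u n j ⬝ᵥ v) := by
    rw [logDer, logDer, if_neg hi, if_neg hj]
  have hf : ∀ a ∈ Icc (u n i ⬝ᵥ v) (u n j ⬝ᵥ v), 0 < factor k i t a := by
    intro a ha
    rw [factor, if_neg hi]
    refine sinQuot_pos ((dot_pos_of_mem h hi).trans_le ha.1) ?_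
    have h1 := mul_le_mul_of_nonneg_left ha.2 (abs_nonneg t)
    linarith [abs_mul_dot_lt h hj, Real.pi_pos]
  rw [e]
  refine strictAntiOn_of_deriv_neg (convex_Icc (u n i ⬝ᵥ v) (u n j ⬝ᵥ v))
    (fun a ha => (hasDerivAt_logDer k i (hf a ha).ne').continuousAt.continuousWithinAt)
    (fun a ha => ?_) (left_mem_Icc.2 hij.le) (right_mem_Icc.2 hij.le) hij
  rw [interior_Icc] at ha
  have h1 := hf a (Ioo_subset_Icc_self ha)
  rw [(hasDerivAt_logDer k i h1.ne').deriv, neg_lt_zero, curvRoot, if_neg hi]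
  rw [factor, if_neg hi] at h1
  positivity

lemma gradCoeff_lt_iff {i j : Fin (n + 2)} {v : NR n} {t : ℝ}
    (h : (v, t) ∈ polarDomain (whole n) k) (hi : i ≠ k) (hj : j ≠ k) :
    gradCoeff k v t j < gradCoeff k v t i ↔ u n i ⬝ᵥ v < u n j ⬝ᵥ v := by
  have hp : 0 < Psi k v t / ((n : ℝ) + 1) := div_pos (Psi_pos h) (by positivity)
  rw [gradCoeff, gradCoeff, mul_lt_mul_iff_right₀ hp]
  refine ⟨fun hlt => ?_, logDer_lt h hi hj⟩
  rcases lt_trichotomy (u n i ⬝ᵥ v) (u n j ⬝ᵥ v) with h1 | h1 | h1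
  · exact h1
  · simp only [logDer, if_neg hi, if_neg hj, h1, lt_self_iff_false] at hlt
  · exact absurd hlt (logDer_lt h hj hi h1).not_gt

lemma gradCoeff_vertex_lt {i : Fin (n + 2)} {v : NR n} (h : (v, 0) ∈ polarDomain (whole n) k)
    (hi : i ≠ k) : gradCoeff k v 0 k < gradCoeff k v 0 i := by
  have : gradCoeff k v 0 k = 0 := by simp [gradCoeff, logDer]
  rw [this]
  exact gradCoeff_pos h hi

lemma bary_base_paramC {i : Fin (n + 2)} {v : NR n} {t : ℝ}
    (h : (v, t) ∈ polarDomain (whole n) k) (hi : i ≠ k) :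
    bary i (base (paramC k v t)) = |t| * (2 / Real.pi * (u n i ⬝ᵥ v)) := by
  have h1 : base (paramC k v t) = p n k + |t| • v := base_param (notMem_whole k) h
  rw [h1, bary_add_smul, bary_p, if_neg hi, zero_add]

lemma exists_star (J : Face n) (k : Fin (n + 2)) : ∃ k', k' ∉ J.1 ∧ k' ≠ k := by
  have hlt : (insert k J.1).card < (Finset.univ : Finset (Fin (n + 2))).card := by
    rw [Finset.card_univ, Fintype.card_fin]
    have := Finset.card_insert_le k J.1
    have := J.2
    omega
  obtain ⟨i, -, hi⟩ := Finset.exists_mem_notMem_of_card_lt_card hlt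
  rw [Finset.mem_insert, not_or] at hi
  exact ⟨i, hi.2, hi.1⟩

lemma exc_eq_param {J : Face n} (hk : k ∉ J.1) {m : NR n} (hm : m ∈ openSimplex (insert k J.1)) :
    ∃ v : tangentDir J, (v, (0 : ℝ)) ∈ paramDomain J k ∧ exc k hk m hm = param hk (v, 0) := by
  obtain ⟨h1, h2, h3⟩ := (mem_openSimplex_insert_iff hk m).1 hm
  have hq : ((⟨m - p n k, h1⟩ : tangentDir J), (0 : ℝ)) ∈ paramDomain J k := ⟨h2, by simp⟩
  refine ⟨_, hq, ?_⟩
  obtain ⟨hm', e⟩ := param_of_zero hk hq rfl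
  rw [e]
  refine exc_congr _ _ _ ?_
  simp only [h3, inv_one, one_smul, add_sub_cancel]

/-- A point of `Ẽ_J` lies in the star of a vertex other than `p_k` or in the exceptional fibre over
`p_k`. -/
lemma exists_star_or_param (hk : k ∉ J.1) (x : BlowUp J) :
    (∃ k', k' ∉ J.1 ∧ k' ≠ k ∧ x ∈ vertexStar k') ∨
      ∃ v : tangentDir J, (v, (0 : ℝ)) ∈ paramDomain J k ∧ x = param hk (v, 0) := by
  obtain ⟨l, hl, hlk⟩ := exists_star J k
  cases x with
  | plus y hy => exact Or.inl ⟨l, hl, hlk, trivial⟩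
  | minus y hy => exact Or.inl ⟨l, hl, hlk, trivial⟩
  | exc i hi m hm =>
    by_cases h : i = k
    · subst h
      exact Or.inr (exc_eq_param hi hm)
    · exact Or.inl ⟨i, hi, h, rfl⟩

/-- Coordinates at a vertex other than `p_k` treat the indices j ∈ J and k on an equal footing. Only
the exceptional fibre over `p_k`, where t = 0, is not covered by them. -/
lemma exists_paramC_of_mem_Utilde {L : Submodule ℝ (NR n)} {x : Ctilde n}
    (hx : x ∈ Utilde J L) (k : Fin (n + 2)) :
    (∃ k' v t, k' ∉ J.1 ∧ k' ≠ k ∧ (v, t) ∈ polarDomain (whole n) k' ∧ x = paramC k' v t) ∨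
      ∃ v, (v, (0 : ℝ)) ∈ polarDomain (whole n) k ∧ x = paramC k v 0 := by
  suffices h : (∃ k', k' ∉ J.1 ∧ k' ≠ k ∧ x ∈ vertexStar k') ∨
      ∃ v, (v, (0 : ℝ)) ∈ polarDomain (whole n) k ∧ x = paramC k v 0 by
    refine h.imp_left ?_
    rintro ⟨k', h1, h2, h3⟩
    exact ⟨k', _, _, h1, h2, sec_mem_polarDomain h3, (paramC_sec h3).symm⟩
  obtain ⟨l, hl, hlk⟩ := exists_star J k
  obtain ⟨i, hi, hxi, -⟩ := exists_star_of_mem_Utilde hx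
  cases x with
  | plus y hy => exact Or.inl ⟨l, hl, hlk, trivial⟩
  | minus y hy => exact Or.inl ⟨l, hl, hlk, trivial⟩
  | exc i' hi' m hm =>
    obtain rfl : i' = i := hxi
    by_cases h : i' = k
    · subst h
      obtain ⟨v, hv, e⟩ := exc_eq_param hi' hm
      exact Or.inr ⟨v, hv, e⟩
    · exact Or.inl ⟨i', hi, h, rfl⟩

lemma dot_sum_smul_p_sub_p (J : Face n) (k : Fin (n + 2)) (c : Fin (n + 2) → ℝ) (i : Fin (n + 2)) :
    2 / Real.pi * (u n i ⬝ᵥ (∑ j ∈ J.1, c j • (p n j - p n k))) =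
      (if i ∈ J.1 then c i else 0) - if i = k then ∑ j ∈ J.1, c j else 0 := by
  have : ∀ j ∈ J.1, 2 / Real.pi * (u n i ⬝ᵥ (c j • (p n j - p n k))) =
      (if i = j then c j else 0) - if i = k then c j else 0 := by
    intro j _
    rw [dotProduct_smul, smul_eq_mul, mul_left_comm, dot_p_sub_p]
    split_ifs <;> ring
  rw [dotProduct_sum, Finset.mul_sum, Finset.sum_congr rfl this, Finset.sum_sub_distrib,
    Finset.sum_ite_eq]
  congr 1
  split_ifs <;> simp

/-- The standard projection transfers the weights of the vertices in J to `p_k` and leaves the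
remaining weights unchanged. -/
lemma dot_dirProj_stdL (hk : k ∉ J.1) {i : Fin (n + 2)} (hi : i ∉ J.1) (v : NR n) :
    u n i ⬝ᵥ (dirProj (isCompl_stdL hk) v : NR n) =
      u n i ⬝ᵥ v + if i = k then ∑ j ∈ J.1, u n j ⬝ᵥ v else 0 := by
  have hpi : (2 / Real.pi : ℝ) ≠ 0 := by
    have := Real.pi_pos
    positivity
  have hs : ∀ l, u n l ⬝ᵥ (∑ j ∈ J.1, (2 / Real.pi * (u n j ⬝ᵥ v)) • (p n j - p n k)) =
      (if l ∈ J.1 then u n l ⬝ᵥ v else 0) - if l = k then ∑ j ∈ J.1, u n j ⬝ᵥ v else 0 := by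
    intro l
    refine mul_left_cancel₀ hpi ?_
    rw [dot_sum_smul_p_sub_p, ← Finset.mul_sum, mul_sub, mul_ite, mul_ite, mul_zero]
  have hm : v - ∑ j ∈ J.1, (2 / Real.pi * (u n j ⬝ᵥ v)) • (p n j - p n k) ∈ tangentDir J := by
    intro l hl
    rw [dotProduct_sub, hs, if_pos hl, if_neg (ne_of_mem_of_not_mem hl hk), sub_zero, sub_self]
  have e : dirProj (isCompl_stdL hk) v = ⟨_, hm⟩ := by
    refine dirProj_eq _ ?_
    rw [sub_sub_cancel]
    exact Submodule.sum_mem _ fun j hj => Submodule.smul_mem _ _ (p_sub_p_mem_stdL hj)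
  rw [e]
  simp only
  rw [dotProduct_sub, hs, if_neg hi, zero_sub, sub_neg_eq_add]

/-- Projecting does not decrease the pairings with indices outside J, and for k' ≠ k it preserves
the radius. At k' = k only t = 0 is required, where the bound on the radius is vacuous. -/
lemma paramC_mem_Utilde_stdL (hk : k ∉ J.1) (hk' : k' ∉ J.1) {v : NR n} {t : ℝ}
    (h : (v, t) ∈ polarDomain (whole n) k') (ht : k' = k → t = 0) :
    paramC k' v t ∈ Utilde J (stdL J k) := by
  rw [paramC_mem_Utilde_iff (isCompl_stdL hk) hk' h]
  refine ⟨fun i hi hik => ?_, ?_⟩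
  · rw [dot_dirProj_stdL hk hi]
    refine add_pos_of_pos_of_nonneg (dot_pos_of_mem h hik) ?_
    split_ifs with hi'
    · exact Finset.sum_nonneg fun j hj =>
        (dot_pos_of_mem h (ne_of_mem_of_not_mem hj hk')).le
    · exact le_rfl
  · by_cases hkk : k' = k
    · simp [ht hkk]
    · simp only [radius]
      rw [dot_dirProj_stdL hk hk', if_neg hkk, add_zero]
      exact h.2

/-- All points off the exceptional fibres have a standard projection. The fibres over `p_i` with i ∈
J are excluded by the inequality b_i ≤ b_k, which fails at `p_i`. -/
lemma Wtilde_subset_Utilde (hk : k ∉ J.1) : Wtilde J k ⊆ Utilde J (stdL J k) := by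
  intro x hx
  obtain ⟨l, hl, hlk⟩ := exists_star J k
  have key : ∀ i ∉ J.1, i ≠ k → x ∈ vertexStar i → x ∈ Utilde J (stdL J k) := by
    intro i hi hik hxi
    rw [← paramC_sec hxi]
    exact paramC_mem_Utilde_stdL hk hi (sec_mem_polarDomain hxi) fun h => absurd h hik
  cases x with
  | plus y hy => exact key l hl hlk trivial
  | minus y hy => exact key l hl hlk trivial
  | exc i hi m hm =>
    by_cases hiJ : i ∈ J.1
    · have h1 := hx i hiJ
      have h2 : k ≠ i := fun h => hk (h ▸ hiJ)
      simp only [base, bary_p, if_true, if_neg h2] at h1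
      norm_num at h1
    · by_cases hik : i = k
      · subst hik
        obtain ⟨v, hv, e⟩ := exc_eq_param hi hm
        rw [e]
        exact paramC_mem_Utilde_stdL (v := v) hk hiJ hv fun _ => rfl
      · exact key i hiJ hik rfl

lemma exists_gt_of_eventually {f : ℝ → Prop} (h : ∀ᶠ s in 𝓝 (0 : ℝ), f s) (t : ℝ) :
    ∃ s, 0 < s ∧ t + s ≠ 0 ∧ f s := by
  have h1 : ∀ᶠ s in 𝓝[>] (0 : ℝ), f s := h.filter_mono nhdsWithin_le_nhds
  have h2 : ∀ᶠ s in 𝓝[>] (0 : ℝ), t + s ≠ 0 := by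
    by_cases ht : t = 0
    · filter_upwards [self_mem_nhdsWithin] with s hs
      rw [ht, zero_add]
      exact (mem_Ioi.1 hs).ne'
    · refine Eventually.filter_mono nhdsWithin_le_nhds (ContinuousAt.eventually_ne
        (g := fun s => t + s) (by fun_prop) ?_)
      simpa using ht
  have h3 : ∀ᶠ s in 𝓝[>] (0 : ℝ), 0 < s := self_mem_nhdsWithin
  obtain ⟨s, hs, hs1, hs2⟩ := (h3.and (h1.and h2)).exists
  exact ⟨s, hs, hs2, hs1⟩

/-- Moving v slightly in the direction p_j - p_k keeps the weak inequality, so it was strict before.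
The simultaneous shift of t matters on exceptional fibres: there both barycentric coordinates vanish
and the weak inequality says nothing. -/
lemma dot_lt_of_mem_interior_Wtilde (hk : k ∉ J.1) (hk' : k' ∉ J.1) (hkk : k' ≠ k) {v : NR n}
    {t : ℝ} (h : (v, t) ∈ polarDomain (whole n) k')
    (hx : paramC k' v t ∈ interior (Wtilde J k)) {j : Fin (n + 2)} (hj : j ∈ J.1) :
    u n j ⬝ᵥ v < u n k ⬝ᵥ v := by
  let c : ℝ → NR n × ℝ := fun s => (v + s • (p n j - p n k), t + s)
  have hc : Continuous c := by fun_prop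
  have hc0 : c 0 = (v, t) := by simp [c]
  have h1 : ∀ᶠ q in 𝓝 (v, t), q ∈ polarDomain (whole n) k' ∧ paramC k' q.1 q.2 ∈ Wtilde J k := by
    have hp : ContinuousAt (fun q : NR n × ℝ => paramC k' q.1 q.2) (v, t) :=
      (contMDiffOn_paramC k').continuousOn.continuousAt ((isOpen_polarDomain _ k').mem_nhds h)
    exact ((isOpen_polarDomain _ k').eventually_mem h).and
      (hp.eventually (mem_interior_iff_mem_nhds.1 hx))
  rw [← hc0] at h1
  obtain ⟨s, hs, hts, hm, hW⟩ := exists_gt_of_eventually (hc.continuousAt.eventually h1) t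
  have hjk : j ≠ k' := ne_of_mem_of_not_mem hj hk'
  have hjk0 : j ≠ k := ne_of_mem_of_not_mem hj hk
  have h2 := hW j hj
  have hpi := Real.pi_pos
  have ht : 0 < |t + s| := abs_pos.2 hts
  rw [bary_base_paramC hm hjk, bary_base_paramC hm hkk.symm, mul_le_mul_iff_right₀ ht] at h2
  simp only [dotProduct_add, dotProduct_smul, smul_eq_mul, mul_add] at h2
  rw [mul_left_comm _ s, mul_left_comm _ s, dot_p_sub_p, dot_p_sub_p, if_pos rfl, if_neg hjk0,
    if_neg hjk0.symm, if_pos rfl] at h2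
  have h3 : 2 / Real.pi * (u n j ⬝ᵥ v) < 2 / Real.pi * (u n k ⬝ᵥ v) := by linarith
  exact (mul_lt_mul_iff_right₀ (by positivity)).1 h3

/-- Strict inequalities between barycentric coordinates reverse into those between gradient
coefficients, that is, into membership in the open cone; over `p_k` both sides hold automatically.
As the right-hand set is open, its inclusion in `Wtilde` gives the converse. -/
theorem interior_Wtilde_eq (hk : k ∉ J.1) :
    interior (Wtilde J k) =
      Utilde J (stdL J k) ∩ hProj (isCompl_stdL hk) ⁻¹' interiorCone J := by
  refine subset_antisymm (fun x hx => ?_) (interior_maximal ?_ ?_)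
  · have hU := Wtilde_subset_Utilde hk (interior_subset hx)
    refine ⟨hU, ?_⟩
    rcases exists_paramC_of_mem_Utilde hU k with ⟨k', v, t, hk', hkk, hm, rfl⟩ | ⟨v, hm, rfl⟩
    · exact (hProj_paramC_mem_interiorCone_iff hk hm).2 fun j hj =>
        (gradCoeff_lt_iff hm (ne_of_mem_of_not_mem hj hk') hkk.symm).2
          (dot_lt_of_mem_interior_Wtilde hk hk' hkk hm hx hj)
    · exact (hProj_paramC_mem_interiorCone_iff hk hm).2 fun j hj =>
        gradCoeff_vertex_lt hm (ne_of_mem_of_not_mem hj hk)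
  · rintro x ⟨hU, hc⟩ j hj
    rcases exists_paramC_of_mem_Utilde hU k with ⟨k', v, t, hk', hkk, hm, rfl⟩ | ⟨v, hm, rfl⟩
    · have hjk := ne_of_mem_of_not_mem hj hk'
      have h1 := (gradCoeff_lt_iff hm hjk hkk.symm).1
        ((hProj_paramC_mem_interiorCone_iff hk hm).1 hc j hj)
      have := Real.pi_pos
      rw [bary_base_paramC hm hjk, bary_base_paramC hm hkk.symm]
      gcongr
    · have h1 : base (paramC k v 0) = p n k + |(0 : ℝ)| • v := base_param (notMem_whole k) hm
      rw [h1, abs_zero, zero_smul, add_zero, bary_p, bary_p,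
        if_neg (ne_of_mem_of_not_mem hj hk), if_pos rfl]
      exact zero_le_one
  · exact (isOpen_Utilde (isCompl_stdL hk)).inter
      ((isOpen_interiorCone J).preimage (contMDiff_hProj (isCompl_stdL hk)).continuous)

end

section

variable {n : ℕ} {J : Face n} {k k' : Fin (n + 2)}

/-! ### Surjectivity of the standard projections -/

/-- For vectors tangent to the face the factors in J vanish, unlike those outside J; this determines
the order of vanishing of Ψ at the face. -/
lemma factor_pos_of_mem_paramDomain {v : tangentDir J} {t : ℝ} (h : (v, t) ∈ paramDomain J k)
    {i : Fin (n + 2)} (hi : i ∉ J.1) : 0 < factor k i t (u n i ⬝ᵥ (v : NR n)) := by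
  have hpi := Real.pi_pos
  have hr : 0 < radius k (v : NR n) := radius_pos_of_mem h
  have h1 : |t| * radius k (v : NR n) < 1 := h.2
  have hneg : u n k ⬝ᵥ (v : NR n) < 0 := by
    rw [radius, neg_pos] at hr
    exact (pos_iff_neg_of_mul_neg hr).1 (by positivity)
  have h2 : |t| * -(u n k ⬝ᵥ (v : NR n)) < Real.pi / 2 := by
    have e : |t| * radius k (v : NR n) = |t| * -(u n k ⬝ᵥ (v : NR n)) * (2 / Real.pi) := by
      rw [radius]
      ring
    rw [e, ← lt_div_iff₀ (by positivity)] at h1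
    simpa using h1
  rw [factor]
  split_ifs with hik
  · subst hik
    rw [← Real.cos_abs, abs_mul, abs_of_neg hneg]
    refine Real.cos_pos_of_mem_Ioo ⟨?_, h2⟩
    have := mul_nonneg (abs_nonneg t) (neg_nonneg.2 hneg.le)
    linarith
  · refine sinQuot_pos (h.1 i hi hik) ?_
    have h3 : u n i ⬝ᵥ (v : NR n) ≤ -(u n k ⬝ᵥ (v : NR n)) := by
      rw [dot_u_eq_neg_sum k, neg_neg]
      refine Finset.single_le_sum (f := fun i => u n i ⬝ᵥ (v : NR n)) (fun j hj => ?_)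
        (Finset.mem_erase.2 ⟨hik, Finset.mem_univ i⟩)
      by_cases hjJ : j ∈ J.1
      · exact (v.2 j hjJ).ge
      · exact (h.1 j hjJ (Finset.ne_of_mem_erase hj)).le
    have := mul_le_mul_of_nonneg_left h3 (abs_nonneg t)
    linarith

/-- The element of `stdL J k` with coefficients `s`, added to `v`. -/
def shift (J : Face n) (k : Fin (n + 2)) (v : NR n) (s : Fin (n + 2) → ℝ) : NR n :=
  v + ∑ j ∈ J.1, s j • (p n j - p n k)

lemma dot_shift_mem (hk : k ∉ J.1) (v : tangentDir J) (s : Fin (n + 2) → ℝ) {j : Fin (n + 2)}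
    (hj : j ∈ J.1) : u n j ⬝ᵥ shift J k v s = Real.pi / 2 * s j := by
  have h := dot_sum_smul_p_sub_p J k s j
  rw [if_pos hj, if_neg (ne_of_mem_of_not_mem hj hk), sub_zero] at h
  have := Real.pi_pos
  rw [shift, dotProduct_add, v.2 j hj, zero_add, ← h]
  field_simp

lemma dot_shift_self (hk : k ∉ J.1) (v : NR n) (s : Fin (n + 2) → ℝ) :
    u n k ⬝ᵥ shift J k v s = u n k ⬝ᵥ v - Real.pi / 2 * ∑ j ∈ J.1, s j := by
  have h := dot_sum_smul_p_sub_p J k s k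
  rw [if_neg hk, if_pos rfl, zero_sub, eq_comm, neg_eq_iff_eq_neg] at h
  have := Real.pi_pos
  rw [shift, dotProduct_add, h]
  field_simp
  ring

lemma dot_shift_of_notMem (v : NR n) (s : Fin (n + 2) → ℝ) {i : Fin (n + 2)}
    (hi : i ∉ J.1) (hik : i ≠ k) : u n i ⬝ᵥ shift J k v s = u n i ⬝ᵥ v := by
  have h := dot_sum_smul_p_sub_p J k s i
  rw [if_neg hi, if_neg hik, sub_zero] at h
  have := Real.pi_pos
  rw [shift, dotProduct_add, (mul_eq_zero.1 h).resolve_left (by positivity), add_zero]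

lemma shift_sub_mem (v : NR n) (s : Fin (n + 2) → ℝ) : shift J k v s - v ∈ stdL J k := by
  rw [shift, add_sub_cancel_left]
  exact Submodule.sum_mem _ fun j hj => Submodule.smul_mem _ _ (p_sub_p_mem_stdL hj)

lemma continuous_shift (v : NR n) : Continuous (shift J k v) := by
  unfold shift
  fun_prop

lemma shift_add_single (v : NR n) (s : Fin (n + 2) → ℝ) {j : Fin (n + 2)} (hj : j ∈ J.1) (r : ℝ) :
    shift J k v (s + r • Pi.single j 1) = shift J k v s + r • (p n j - p n k) := by
  simp only [shift, Pi.add_apply, Pi.smul_apply, smul_eq_mul, add_smul, Finset.sum_add_distrib,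
    ← add_assoc]
  congr 1
  rw [Finset.sum_eq_single_of_mem j hj fun i _ hij => by simp [hij]]
  simp

lemma shift_mem_polarDomain (hk : k ∉ J.1) (hk' : k' ∉ J.1) (hkk : k' ≠ k) {v : tangentDir J}
    {t : ℝ} (h : (v, t) ∈ paramDomain J k') {s : Fin (n + 2) → ℝ} (hs : ∀ j ∈ J.1, 0 < s j)
    (hsum : Real.pi / 2 * ∑ j ∈ J.1, s j < u n k ⬝ᵥ (v : NR n)) :
    (shift J k v s, t) ∈ polarDomain (whole n) k' := by
  have := Real.pi_pos
  refine ⟨fun i _ hik => ?_, ?_⟩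
  · simp only
    by_cases hi : i ∈ J.1
    · rw [dot_shift_mem hk v s hi]
      exact mul_pos (by positivity) (hs i hi)
    · by_cases hik' : i = k
      · subst hik'
        rw [dot_shift_self hk]
        linarith
      · rw [dot_shift_of_notMem _ s hi hik']
        exact h.1 i hi hik
  · simp only [radius]
    rw [dot_shift_of_notMem _ s hk' hkk]
    exact h.2

/-- Continuity on all of N_ℝ, not only on `polarDomain`, is needed to maximize over a closed fibre.
-/
lemma continuous_Psi (k : Fin (n + 2)) (t : ℝ) : Continuous fun v : NR n => Psi k v t := by
  unfold Psi
  refine Continuous.rpow_const (continuous_finsetProd _ fun i _ => ?_)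
    fun _ => Or.inr (by positivity)
  exact (contDiff_factor k i).continuous.comp (continuous_id.prodMk continuous_const)

lemma Psi_eq_zero {v : NR n} {t : ℝ} {i : Fin (n + 2)} (h : factor k i t (u n i ⬝ᵥ v) = 0) :
    Psi k v t = 0 := by
  rw [Psi, Finset.prod_eq_zero (Finset.mem_univ i) h, Real.zero_rpow (by positivity)]

lemma factor_zero {i : Fin (n + 2)} (hi : i ≠ k) (t : ℝ) : factor k i t 0 = 0 := by
  simp [factor, hi, sinQuot]

/-- Near the face, `Ψ` grows faster than linearly in the distance. -/
lemma exists_lt_Psi_shift (hk : k ∉ J.1) (hk' : k' ∉ J.1) {v : tangentDir J} {t : ℝ}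
    (h : (v, t) ∈ paramDomain J k') (A : ℝ) {c : ℝ} (hc : 0 < c) :
    ∃ ε, 0 < ε ∧ ε ≤ c ∧ ε * A < Psi k' (shift J k v fun _ => ε) t := by
  have hpi := Real.pi_pos
  -- Each factor in J contributes one ε with a positive limiting coefficient. The function g is
  -- Ψ^(n+1) without the power ε^|J|.
  let g : ℝ → ℝ := fun ε => (∏ _j ∈ J.1, (Real.pi / 2 * Real.sinc (t * (Real.pi / 2 * ε)))) *
    ∏ i ∈ J.1ᶜ, factor k' i t (u n i ⬝ᵥ shift J k v fun _ => ε)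
  have hshift : Continuous fun ε : ℝ => shift J k (v : NR n) fun _ => ε :=
    (continuous_shift _).comp (continuous_pi fun _ => continuous_id)
  have hg : Continuous g := by
    refine (continuous_finsetProd _ fun _ _ => continuous_const.mul
      (contDiff_sinc.continuous.comp (by fun_prop))).mul
      (continuous_finsetProd _ fun i _ => ?_)
    exact (contDiff_factor k' i).continuous.comp (hshift.prodMk continuous_const)
  have hg0 : 0 < g 0 := by
    have e : (shift J k (v : NR n) fun _ => (0 : ℝ)) = v := by simp [shift]
    simp only [g, e, mul_zero, Real.sinc_zero, mul_one]
    exact mul_pos (Finset.prod_pos fun _ _ => by positivity)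
      (Finset.prod_pos fun i hi => factor_pos_of_mem_paramDomain h (Finset.mem_compl.1 hi))
  have hprod : ∀ ε : ℝ, ∏ i, factor k' i t (u n i ⬝ᵥ shift J k v fun _ => ε) =
      ε ^ J.1.card * g ε := by
    intro ε
    rw [← Finset.prod_mul_prod_compl J.1, ← Finset.prod_const, ← mul_assoc,
      ← Finset.prod_mul_distrib]
    congr 1
    refine Finset.prod_congr rfl fun j hj => ?_
    rw [factor, if_neg (ne_of_mem_of_not_mem hj hk'), dot_shift_mem hk v _ hj, sinQuot]
    ring
  have hJ := J.2
  have hl : Continuous fun ε : ℝ => ε ^ (n + 1 - J.1.card) * A ^ (n + 1) := by fun_prop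
  have hl0 : (0 : ℝ) ^ (n + 1 - J.1.card) * A ^ (n + 1) < g 0 := by
    -- The exponent n + 1 - |J| is positive because |J| ≤ n; this is where Ψ beats every linear
    -- function.
    rw [zero_pow (by omega), zero_mul]
    exact hg0
  have hev : ∀ᶠ ε in 𝓝 (0 : ℝ), (ε ^ (n + 1 - J.1.card) * A ^ (n + 1) < g ε ∧ 0 < g ε) ∧ ε < c :=
    ((hl.continuousAt.eventually_lt hg.continuousAt hl0).and
      (continuousAt_const.eventually_lt hg.continuousAt hg0)).and
      (continuousAt_id.eventually_lt continuousAt_const hc)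
  obtain ⟨ε, hε, -, ⟨h1, h2⟩, h3⟩ := exists_gt_of_eventually hev 0
  refine ⟨ε, hε, h3.le, ?_⟩
  have hnn : 0 ≤ ∏ i, factor k' i t (u n i ⬝ᵥ shift J k v fun _ => ε) := by
    rw [hprod]
    positivity
  refine lt_of_pow_lt_pow_left₀ (n + 1) (Real.rpow_nonneg hnn _) ?_
  rw [Psi_pow hnn, hprod, mul_pow]
  calc ε ^ (n + 1) * A ^ (n + 1) = ε ^ J.1.card * (ε ^ (n + 1 - J.1.card) * A ^ (n + 1)) := by
        rw [← mul_assoc, ← pow_add, Nat.add_sub_cancel' (by omega)]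
    _ < ε ^ J.1.card * g ε := by gcongr

/-- Outside the exceptional fibre over `p_k`, a critical point of `Ψ - τ` on a fibre of the
projection. -/
lemma exists_critical (hk : k ∉ J.1) (hk' : k' ∉ J.1) (hkk : k' ≠ k) {v : tangentDir J} {t : ℝ}
    (h : (v, t) ∈ paramDomain J k') {τ : Fin (n + 2) → ℝ} (hτ : ∀ j ∈ J.1, 0 < τ j) :
    ∃ w : NR n, w - v ∈ stdL J k ∧ (w, t) ∈ polarDomain (whole n) k' ∧
      ∀ j ∈ J.1, gradVec k' w t ⬝ᵥ (p n j - p n k) = τ j := by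
  have hpi := Real.pi_pos
  have hpi2 : 0 < Real.pi / 2 := by positivity
  -- The sum of the s_j equals c exactly where the pairing of the shifted vector with u_k becomes
  -- zero.
  obtain ⟨c, hc⟩ : ∃ c, Real.pi / 2 * c = u n k ⬝ᵥ (v : NR n) := ⟨2 / Real.pi * (u n k ⬝ᵥ (v : NR n)),
    by field_simp⟩
  have hc0 : 0 < c := (mul_pos_iff_of_pos_left hpi2).1 (hc ▸ h.1 k hk hkk.symm)
  let φ : (Fin (n + 2) → ℝ) → ℝ := fun s => Psi k' (shift J k v s) t - ∑ j ∈ J.1, s j * τ j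
  have hφ : Continuous φ :=
    ((continuous_Psi k' t).comp (continuous_shift _)).sub (by fun_prop)
  let K : Set (Fin (n + 2) → ℝ) := Icc 0 (fun _ => c) ∩ {s | ∑ j ∈ J.1, s j ≤ c}
  have hK : IsCompact K := isCompact_Icc.inter_right (isClosed_le (by fun_prop) continuous_const)
  -- The bound c/(n + 1) keeps both ε and the sum of |J| copies of ε below c, so the constant vector
  -- lies in K.
  obtain ⟨ε, hε, hεc, hlt⟩ := exists_lt_Psi_shift hk hk' h (∑ j ∈ J.1, τ j)
    (c := c / ((n : ℝ) + 1)) (by positivity)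
  have hεK : (fun _ => ε) ∈ K := by
    rw [le_div_iff₀ (by positivity)] at hεc
    refine ⟨⟨fun _ => hε.le, fun _ => ?_⟩, ?_⟩
    · have : 0 ≤ ε * n := by positivity
      simp only
      linarith
    · have hJ : (J.1.card : ℝ) ≤ n := by exact_mod_cast J.2
      have := mul_le_mul_of_nonneg_left hJ hε.le
      simp only [mem_ofPred_eq, Finset.sum_const, nsmul_eq_mul]
      linarith
  obtain ⟨s, hsK, hmax⟩ := hK.exists_isMaxOn ⟨_, hεK⟩ hφ.continuousOn
  -- The comparison with ε shows that the maximum of φ is positive, hence so is Ψ there. This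
  -- excludes the boundary parts s_j = 0 and ∑ s_j = c, on which a factor vanishes.
  have hpos : 0 < Psi k' (shift J k v s) t := by
    have h1 : φ (fun _ => ε) ≤ φ s := hmax hεK
    have h2 : 0 ≤ ∑ j ∈ J.1, s j * τ j :=
      Finset.sum_nonneg fun j hj => mul_nonneg (hsK.1.1 j) (hτ j hj).le
    simp only [φ, ← Finset.mul_sum] at h1
    linarith
  have hs : ∀ j ∈ J.1, 0 < s j := by
    intro j hj
    refine lt_of_le_of_ne (hsK.1.1 j) fun h0 => hpos.ne' (Psi_eq_zero (i := j) ?_)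
    rw [dot_shift_mem hk v s hj, ← h0, mul_zero]
    exact factor_zero (ne_of_mem_of_not_mem hj hk') t
  have hsum : ∑ j ∈ J.1, s j < c := by
    refine lt_of_le_of_ne hsK.2 fun h0 => hpos.ne' (Psi_eq_zero (i := k) ?_)
    rw [dot_shift_self hk, h0, hc, sub_self, factor_zero hkk.symm]
  have hm : (shift J k v s, t) ∈ polarDomain (whole n) k' :=
    shift_mem_polarDomain hk hk' hkk h hs (hc ▸ (mul_lt_mul_iff_right₀ hpi2).2 hsum)
  refine ⟨shift J k v s, shift_sub_mem _ s, hm, fun j hj => ?_⟩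
  have hd : HasDerivAt (fun r : ℝ => Psi k' (shift J k v s + r • (p n j - p n k)) t - r * τ j)
      (gradVec k' (shift J k v s) t ⬝ᵥ (p n j - p n k) - 1 * τ j) 0 := by
    have h1 := hasDerivAt_Psi_line (v := shift J k v s) (ξ := p n j - p n k) (s := 0) (k := k')
      (t := t) (by rw [zero_smul, add_zero]; exact hm)
    rw [zero_smul, add_zero] at h1
    exact h1.sub ((hasDerivAt_id (0 : ℝ)).mul_const (τ j))
  have hsingle : s j ≤ ∑ i ∈ J.1, s i := Finset.single_le_sum (fun i _ => hsK.1.1 i) hj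
  -- Varying the single coordinate s_j moves the point in the direction p_j - p_k and stays in K for
  -- small r.
  have hloc : IsLocalMax
      (fun r : ℝ => Psi k' (shift J k v s + r • (p n j - p n k)) t - r * τ j) 0 := by
    have h1 : ∀ᶠ r in 𝓝 (0 : ℝ), 0 < s j + r :=
      continuousAt_const.eventually_lt (by fun_prop) (by simpa using hs j hj)
    have h2 : ∀ᶠ r in 𝓝 (0 : ℝ), ∑ i ∈ J.1, s i + r < c :=
      ContinuousAt.eventually_lt (by fun_prop) continuousAt_const (by simpa using hsum)
    filter_upwards [h1, h2] with r hr1 hr2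
    have hsr : ∀ i, (s + r • Pi.single j 1 : Fin (n + 2) → ℝ) i = if i = j then s j + r else s i := by
      intro i
      by_cases hij : i = j
      · subst hij
        simp
      · simp [hij]
    have hadd : ∀ f : Fin (n + 2) → ℝ,
        ∑ i ∈ J.1, (s + r • Pi.single j 1 : Fin (n + 2) → ℝ) i * f i =
          ∑ i ∈ J.1, s i * f i + r * f j := by
      intro f
      simp only [Pi.add_apply, Pi.smul_apply, smul_eq_mul, add_mul, Finset.sum_add_distrib]
      congr 1
      rw [Finset.sum_eq_single_of_mem j hj fun i _ hij => by simp [hij]]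
      simp
    have hrK : (s + r • Pi.single j 1 : Fin (n + 2) → ℝ) ∈ K := by
      refine ⟨⟨fun i => ?_, fun i => ?_⟩, ?_⟩
      · rw [hsr]
        split_ifs
        · exact hr1.le
        · exact hsK.1.1 i
      · rw [hsr]
        split_ifs
        · simp only
          linarith
        · exact hsK.1.2 i
      · have := hadd fun _ => 1
        simp only [mul_one] at this
        simp only [mem_ofPred_eq, this]
        exact hr2.le
    have h3 : φ (s + r • Pi.single j 1) ≤ φ s := hmax hrK
    simp only [φ, shift_add_single _ s hj, hadd] at h3
    simp only [zero_smul, add_zero, zero_mul, sub_zero]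
    linarith
  have := hloc.hasDerivAt_eq_zero hd
  linarith

/-- On the exceptional fibre over `p_k`, an explicit point with given gradient. -/
lemma exists_critical_vertex (hk : k ∉ J.1) {v : tangentDir J} (h : (v, (0 : ℝ)) ∈ paramDomain J k)
    {τ : Fin (n + 2) → ℝ} (hτ : ∀ j ∈ J.1, 0 < τ j) :
    ∃ w : NR n, w - v ∈ stdL J k ∧ (w, (0 : ℝ)) ∈ polarDomain (whole n) k ∧
      ∀ j ∈ J.1, gradVec k w 0 ⬝ᵥ (p n j - p n k) = τ j := by
  have hpi := Real.pi_pos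
  have hn : (0 : ℝ) < (n : ℝ) + 1 := by positivity
  -- At t = 0 the coefficient of u_j is Ψ/((n + 1)⟨u_j, w⟩) and the one of u_k is zero, so the
  -- equations read ⟨u_j, w⟩ = Ψ/T_j.
  let T : Fin (n + 2) → ℝ := fun j => ((n : ℝ) + 1) * (2 / Real.pi * τ j)
  have hT : ∀ j ∈ J.1, 0 < T j := fun j hj => by
    have := hτ j hj
    positivity
  have hD : 0 < ∏ j ∈ J.1, T j := Finset.prod_pos hT
  have hC : 0 < ∏ i ∈ J.1ᶜ, factor k i 0 (u n i ⬝ᵥ (v : NR n)) :=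
    Finset.prod_pos fun i hi => factor_pos_of_mem_paramDomain h (Finset.mem_compl.1 hi)
  -- Substituting ⟨u_j, w⟩ = f/T_j into Ψ^(n+1) = f^(n+1) and cancelling f^|J| leaves this equation
  -- for the value f of Ψ.
  obtain ⟨f, hf, hfe⟩ : ∃ f : ℝ, 0 < f ∧ f ^ (n + 1 - J.1.card) =
      (∏ i ∈ J.1ᶜ, factor k i 0 (u n i ⬝ᵥ (v : NR n))) / ∏ j ∈ J.1, T j := by
    have hJ := J.2
    exact ⟨_, Real.rpow_pos_of_pos (div_pos hC hD) _,
      Real.rpow_inv_natCast_pow (div_pos hC hD).le (by omega)⟩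
  let s : Fin (n + 2) → ℝ := fun j => 2 / Real.pi * (f / T j)
  have hdot : ∀ j ∈ J.1, u n j ⬝ᵥ shift J k v s = f / T j := by
    intro j hj
    rw [dot_shift_mem hk v s hj]
    simp only [s]
    field_simp
  have hm : (shift J k v s, (0 : ℝ)) ∈ polarDomain (whole n) k := by
    refine ⟨fun i _ hik => ?_, by simp⟩
    simp only
    by_cases hi : i ∈ J.1
    · rw [hdot i hi]
      exact div_pos hf (hT i hi)
    · rw [dot_shift_of_notMem _ s hi hik]
      exact h.1 i hi hik
  have hPsi : Psi k (shift J k v s) 0 = f := by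
    refine (pow_left_inj₀ (Psi_pos hm).le hf.le (Nat.succ_ne_zero n)).1 ?_
    rw [Nat.succ_eq_add_one, Psi_pow (Finset.prod_pos fun i _ => factor_pos hm i).le,
      ← Finset.prod_mul_prod_compl J.1]
    have h1 : ∏ j ∈ J.1, factor k j 0 (u n j ⬝ᵥ shift J k v s) =
        f ^ J.1.card / ∏ j ∈ J.1, T j := by
      rw [← Finset.prod_const, ← Finset.prod_div_distrib]
      refine Finset.prod_congr rfl fun j hj => ?_
      rw [factor, if_neg (ne_of_mem_of_not_mem hj hk), sinQuot_zero, hdot j hj]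
    have h2 : ∏ i ∈ J.1ᶜ, factor k i 0 (u n i ⬝ᵥ shift J k v s) =
        ∏ i ∈ J.1ᶜ, factor k i 0 (u n i ⬝ᵥ (v : NR n)) := by
      refine Finset.prod_congr rfl fun i hi => ?_
      by_cases hik : i = k
      · simp [factor, hik]
      · rw [dot_shift_of_notMem _ s (Finset.mem_compl.1 hi) hik]
    have h3 : f ^ (n + 1) = f ^ J.1.card * f ^ (n + 1 - J.1.card) := by
      have hJ := J.2
      rw [← pow_add, Nat.add_sub_cancel' (by omega)]
    rw [h1, h2, h3, hfe, div_mul_eq_mul_div, mul_div_assoc]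
  refine ⟨_, shift_sub_mem _ s, hm, fun j hj => ?_⟩
  have hjk := ne_of_mem_of_not_mem hj hk
  have h2pi : (2 / Real.pi : ℝ) ≠ 0 := by positivity
  refine mul_left_cancel₀ h2pi ?_
  have hTj := hT j hj
  rw [gradVec_dot_p_sub_p, gradCoeff, gradCoeff, logDer, if_neg hjk, logDer, if_pos rfl, zero_mul,
    zero_mul, Real.cos_zero, sinQuot_zero, hdot j hj, hPsi, neg_zero, mul_zero, sub_zero]
  have : T j = ((n : ℝ) + 1) * (2 / Real.pi * τ j) := rfl
  have hτj := (hτ j hj).ne'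
  rw [this]
  field_simp

lemma mem_image_gProj_of_gradVec (hk : k ∉ J.1) (hk' : k' ∉ J.1) {v : tangentDir J} {t : ℝ}
    (h : (v, t) ∈ paramDomain J k') {a : VJ J} {w : NR n} (hw : w - v ∈ stdL J k)
    (hm : (w, t) ∈ polarDomain (whole n) k')
    (hg : ∀ j ∈ J.1, gradVec k' w t ⬝ᵥ (p n j - p n k) = (a : MR n) ⬝ᵥ (p n j - p n k)) :
    (param hk' (v, t), a) ∈ gProj (isCompl_stdL hk) '' Utilde J (stdL J k) := by
  have hq : ((v, t), (⟨w - v, hw⟩ : stdL J k)) ∈ fibreDomain J (stdL J k) k' := by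
    refine ⟨h, ?_⟩
    simp only [add_sub_cancel]
    exact hm
  obtain ⟨h1, h2⟩ := fibrePoint_spec (isCompl_stdL hk) hk' hq
  refine ⟨_, h1, h2.trans (Prod.ext rfl ?_)⟩
  change xProj (isCompl_stdL hk) (gradVec k' ((v : NR n) + (w - v)) t) = a
  rw [add_sub_cancel]
  exact xProj_stdL_eq hk hg

theorem image_gProj_interior_Wtilde (hk : k ∉ J.1) :
    gProj (isCompl_stdL hk) '' interior (Wtilde J k) = univ ×ˢ interiorCone J := by
  rw [interior_Wtilde_eq hk]
  refine subset_antisymm ?_ ?_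
  · rintro _ ⟨x, hx, rfl⟩
    exact ⟨mem_univ _, hx.2⟩
  · rintro ⟨x', a⟩ ⟨-, ha⟩
    have hτ := (mem_interiorCone_iff hk).1 ha
    suffices h : (x', a) ∈ gProj (isCompl_stdL hk) '' Utilde J (stdL J k) by
      obtain ⟨x, hx, e⟩ := h
      refine ⟨x, ⟨hx, ?_⟩, e⟩
      rw [mem_preimage, show hProj (isCompl_stdL hk) x = a from congrArg Prod.snd e]
      exact ha
    -- Off the exceptional fibre over `p_k` another vertex serves as origin and the fibre is
    -- bounded, so a maximum exists; over `p_k` the explicit solution is used.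
    rcases exists_star_or_param hk x' with ⟨k', hk', hkk, hx⟩ | ⟨v, hv, rfl⟩
    · have hmem := sec_mem hk' hx
      rw [← param_sec hk' hx]
      obtain ⟨⟨v, t⟩, hq⟩ : ∃ q, q = sec hk' x' := ⟨_, rfl⟩
      rw [← hq] at hmem ⊢
      obtain ⟨w, hw, hm, hg⟩ := exists_critical hk hk' hkk hmem hτ
      exact mem_image_gProj_of_gradVec hk hk' hmem hw hm hg
    · obtain ⟨w, hw, hm, hg⟩ := exists_critical_vertex hk hv hτ
      exact mem_image_gProj_of_gradVec hk hk hv hw hm hg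

theorem isTrivialBundleOn_hProj (hk : k ∉ J.1) :
    IsTrivialBundleOn (modelC n) 𝓘(ℝ, VJ J) 𝓘(ℝ, tangentDir J) (BlowUp J)
      (hProj (isCompl_stdL hk)) (interior (Wtilde J k)) (interiorCone J) := by
  have h := isDiffeoOnto_gProj (isCompl_stdL hk) isOpen_interior
    (interior_subset.trans (Wtilde_subset_Utilde hk))
  rw [image_gProj_interior_Wtilde hk] at h
  obtain ⟨h1, h2, h3, f, h4, h5, ⟨h6, h7⟩, h8⟩ := h
  refine ⟨fun x => (hProj (isCompl_stdL hk) x, yProj J (stdL J k) x), ⟨h1,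
    (isOpen_interiorCone J).prod isOpen_univ, ?_, fun z => f (z.2, z.1), ?_, ?_, ⟨h6, ?_⟩, ?_⟩,
    fun _ _ => rfl⟩
  · exact (contMDiffOn_snd.comp h3 fun x hx => h4 hx).prodMk
      (contMDiffOn_fst.comp h3 fun x hx => h4 hx)
  · exact fun x hx => ⟨(h4 hx).2, mem_univ _⟩
  · exact fun z hz => h5 ⟨mem_univ _, hz.1⟩
  · intro z hz
    have := h7 (show (z.2, z.1) ∈ univ ×ˢ interiorCone J from ⟨mem_univ _, hz.1⟩)
    exact Prod.ext (congrArg Prod.snd this) (congrArg Prod.fst this)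
  · exact h8.comp (contMDiffOn_snd.prodMk contMDiffOn_fst) fun z hz => ⟨mem_univ _, hz.1⟩

end

end PairOfPants

end

/-! ### Assembly of the theorem -/

theorem mainTheorem4 (n : ℕ) (hn : n = 1 ∨ n = 2) (J : Face n) (hJ : J.1.Nonempty) :
    ContMDiff (modelC n) 𝓘(ℝ, MR n) ∞ (h n) ∧
    (∀ (L : Submodule ℝ (NR n)) (hL : IsCompl L (tangentDir J)),
      IsDiffeoOnto (modelC n) (modelEV J) (gProj hL) (Utilde J L) (gProj hL '' Utilde J L) ∧
      ∃ G : BlowUp J × VJ J → ℝ,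
        IsLegendreTransform hL (Utilde J L) G ∧
        IsExactGraph J L (gProj hL '' Utilde J L) G (Phi '' Utilde J L)) ∧
    (∀ (k : Fin (n + 2)) (hk : k ∉ J.1),
      interior (Wtilde J k) ⊆ Utilde J (stdL J k) ∧
      IsDiffeoOnto (modelC n) (modelEV J) (gProj (isCompl_stdL hk)) (interior (Wtilde J k))
        (univ ×ˢ interiorCone J) ∧
      (∃ G : BlowUp J × VJ J → ℝ,
        IsLegendreTransform (isCompl_stdL hk) (interior (Wtilde J k)) G ∧
        IsExactGraph J (stdL J k) (univ ×ˢ interiorCone J) G (Phi '' interior (Wtilde J k))) ∧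
      IsTrivialBundleOn (modelC n) 𝓘(ℝ, VJ J) 𝓘(ℝ, tangentDir J) (BlowUp J)
        (hProj (isCompl_stdL hk)) (interior (Wtilde J k)) (interiorCone J)) := by
  refine ⟨contMDiff_h, fun L hL => ⟨isDiffeoOnto_gProj hL (isOpen_Utilde hL) subset_rfl,
    legendre hL, isLegendreTransform_legendre hL subset_rfl,
    isExactGraph_legendre hL subset_rfl⟩, fun k hk => ?_⟩
  have hsub := interior_subset.trans (Wtilde_subset_Utilde (k := k) hk)
  have hd := isDiffeoOnto_gProj (isCompl_stdL hk) isOpen_interior hsub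
  have hG := isExactGraph_legendre (isCompl_stdL hk) hsub
  rw [image_gProj_interior_Wtilde hk] at hd hG
  exact ⟨hsub, hd, ⟨_, isLegendreTransform_legendre _ hsub, hG⟩, isTrivialBundleOn_hProj hk⟩
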